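/- **Conventions.** A function $\nu$ is negligible if for every $c$ it satisfies $\nu(\lambda)<\lambda^{-c}$ for all large $\lambda$. Circuits use the gates $\mathsf{CNOT},H,T$. A *linear operation* is a sequence of CNOT gates. For bases $\theta\in\{0,1,\bot\}^n$ let $\Phi_\theta=\{w:\theta_w\ne\bot\}$; measuring in the bases $\theta$ uses the standard basis where $\theta_w=0$ and the Hadamard basis where $\theta_w=1$. **Programs.** A quantum program $(|\phi\rangle,C)$ consists of a state and a circuit on $|x\rangle|\phi\rangle$, where $x\in\{0,1\}^{m}$, followed by a standard-basis measurement of $m'$ output qubits. An *LM quantum program* consists of an $n$-qubit state $|\psi\rangle$ and a classical part: linear operations $L_1,\dots,L_{t+1}$, bases $\theta_1,\dots,\theta_{t+1}$, pairwise disjoint wire sets $V_1,\dots,V_{t+1}$ with union $[n]$ and $V_1\cup\dots\cup V_i\subseteq\Phi_{\theta_i}$, and classical functions $f_1,\dots,f_t$ (one output bit) and $g$ ($m'$ output bits). For $j<i$, $L_i$ does not act on $V_j$, and $\theta_i=\theta_j$ on $V_j$. Layer $i\le t$ applies $L_i$ and then the projective measurement in the bases $\theta_i$ with outcome $(v_i,r_i)$,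 where $v_i$ is the part of the string on $V_i$ and $r_i=f_i^{x,r_1,\dots,r_{i-1}}$ of the string on $\Phi_{\theta_i}$. Layer $t+1$ applies $L_{t+1}$, measures all wires in the bases $\theta_{t+1}$ and outputs $y=g^{x,r_1,\dots,r_t}$ of the result. A family of programs is $\epsilon$-*pseudo-deterministic* with induced maps $Q_\lambda$ if on every input $x$ it outputs $Q_\lambda(x)$ with probability at least $1-\epsilon(\lambda)$; it is called pseudo-deterministic if $\epsilon$ is negligible. **Ingredients.** (i) A signature token scheme with perfect correctness; $m$-bit inputs are signed bit by bit with $m$ independent tokens. (ii) Functions $F_{k'}:\{0,1\}^*\to\{0,1\}^\kappa$, $k'\in\{0,1\}^\lambda$, where $\kappa=\max\{\lambda,n^4\}$, that no family of polynomial-size quantum circuits with superposition queries distinguishes from a uniformly random function with non-negligible advantage. (iii) The random-subspace authentication scheme. Its key is $k=(S,\Delta,x,z)$ with a uniformly random $\kappa$-dimensional subspace $S\subset\mathbb F_2^{2\kappa+1}$, a uniform $\Delta\notin S$ and uniform $x_w,z_w\in\mathbb F_2^{2\kappa+1}$ for $w\in[n]$; $\mathsf{Enc}_k=X^xZ^zE_{S,\Delta}^{\otimes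 n}$ with $E_{S,\Delta}|b\rangle=2^{-\kappa/2}\sum_{s\in S}|s+b\Delta\rangle$; $\mathsf{LinEval}_L$ applies each CNOT transversally. With $(x_L,z_L)$ the Pauli exponents updated by $L$ and $S_\Delta=S\cup(S+\Delta)$, $\mathsf{Dec}_{k,L,\theta}$ decodes a block $c_w$ with $\theta_w=0$ to $0$ or $1$ if $c_w-x_{L,w}$ lies in $S$ or in $S+\Delta$, and one with $\theta_w=1$ if $c_w-z_{L,w}$ lies in $S_\Delta^\perp$ or in $S^\perp\setminus S_\Delta^\perp$; otherwise it outputs $\bot$. **Scheme (classical oracle model; the classical part of the LM program is public).** $\mathsf{QObf}(1^\lambda,|\psi\rangle)$ samples $k$, tokens $(\mathsf{vk},|\mathsf{sk}\rangle)$ at security parameter $\kappa$, and $k'$, and sets $\mathsf H=F_{k'}$. It outputs $\mathsf{Enc}_k|\psi\rangle\,|\mathsf{sk}\rangle$ and oracles $\mathsf F_1,\dots,\mathsf F_t,\mathsf G$. On $(x,\sigma,\widetilde v_1,\dots,\widetilde v_i,\widetilde w_i,\ell_1,\dots,\ell_{i-1})$, $\mathsf F_i$ verifies $\sigma$ as a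 signature of $x$; recovers each $r_\iota$, $\iota<i$, from $\ell_\iota=\mathsf H(x,\sigma,\widetilde v_1,\dots,\widetilde v_\iota,\ell_1,\dots,\ell_{\iota-1},r_\iota)$, with answer $\bot$ if the two candidate labels coincide or neither matches; decodes the blocks by $\mathsf{Dec}_{k,L_i\cdots L_1,\theta_i}$; applies $f_i^{x,r_1,\dots,r_{i-1}}$ to get $r_i$; and returns $\widetilde v_i$ and $\ell_i=\mathsf H(x,\sigma,\widetilde v_1,\dots,\widetilde v_i,\ell_1,\dots,\ell_{i-1},r_i)$. $\mathsf G$ does the same checks with all $t$ labels, decodes by $\mathsf{Dec}_{k,L_{t+1}\cdots L_1,\theta_{t+1}}$ and returns $y=g^{x,r_1,\dots,r_t}$. Any failed check gives $\bot$. $\mathsf{QEval}(x,\cdot)$ signs $x$ and, for $i\le t$, applies $\mathsf{LinEval}_{L_i}$ and Hadamard gates on the blocks with $\theta_{i,w}=1$, measures the output of $\mathsf F_i$ on the blocks in $\Phi_{\theta_i}$, and undoes the Hadamard gates; finally it does the same with $L_{t+1},\theta_{t+1}$ and measures and outputs the value of $\mathsf G$. **Theorem.** Let the tokens be correct and let $F$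 be a pseudorandom function secure against superposition queries. 1. For every family of LM quantum programs with polynomially bounded $n,m,m',t$ and total number of CNOT gates, the obfuscated state has polynomially many qubits; for each key $k$, $\mathsf{Enc}_k$ is carried out by a circuit with polynomially many gates; and $\mathsf{QEval}$ (after signing) makes polynomially many steps (gates and oracle calls). If the family is pseudo-deterministic with induced maps $Q_\lambda$, there is a negligible $\nu$ such that for all $\lambda$ and all $x\in\{0,1\}^{m(\lambda)}$ $$\Pr\left[\mathsf{QEval}\big(x,\mathsf{QObf}(1^\lambda,|\psi_\lambda\rangle)\big)=Q_\lambda(x)\right]\ \ge\ 1-\nu(\lambda).$$ 2. For all polynomially bounded $n,m,m'$ there is a polynomial-size family of classical parts of LM programs, depending only on $n,m,m'$ and universal for quantum programs with $n$ qubits and at most $n$ gates: on input state $|\phi\rangle|C\rangle|\mathrm{anc}\rangle$, with a bit string $|C\rangle$ encoding the circuit and a fixed ancilla state prepared by a polynomial-size circuit, it has exactly the output distribution of $(|\phi\rangle,C)$. Its $W$ wires are standard-basis-collapsible: with $W_i=\Phi_{\theta_i}\setminus(V_1\cup\dots\cup V_i)$, for all $i\le t$ and $w\in W_i$, $\theta_{i,w}=0$,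 $w\notin\Phi_{\theta_j}$ for $j<i$, and $w$ is not the target of a CNOT gate in $L_1,\dots,L_i$. Instantiated with this family, the scheme has the efficiency properties of part 1, and for every pseudo-deterministic family $(|\phi_\lambda\rangle,C_\lambda)$ of such quantum programs with induced maps $Q_\lambda$, evaluating the obfuscated program on any $x$ returns $Q_\lambda(x)$ with probability at least $1-\nu(\lambda)$ for a negligible $\nu$ that does not depend on $x$. -/

import Mathlib

open scoped ComplexOrder

noncomputable section

namespace QObf

/-! ### Asymptotics -/

/-- `f` is negligible: eventually below every inverse power. -/
def Negligible (f : ℕ → ℝ) : Prop :=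
  ∀ c : ℕ, ∃ N : ℕ, ∀ k : ℕ, N < k → f k < 1 / (k : ℝ) ^ c

/-- `f` is bounded by a polynomial. -/
def PolyBounded (f : ℕ → ℕ) : Prop :=
  ∃ c : ℕ, ∀ k : ℕ, f k ≤ k ^ c + c

/-- Expectation of `f` at a uniformly random element of a finite type. -/
def avg {α : Type} [Fintype α] (f : α → ℝ) : ℝ :=
  (∑ a, f a) / (Fintype.card α : ℝ)

/-! ### Qubits, gates and circuits -/

/-- Bits are elements of the field with two elements. -/
abbrev Bit : Type := ZMod 2

/-- Bit strings of length `n`. -/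
abbrev BitStr (n : ℕ) : Type := Fin n → Bit

/-- A (not necessarily normalised) vector of the Hilbert space of the qubits `ι`,
given by its amplitudes in the standard basis. -/
abbrev QState (ι : Type) : Type := (ι → Bit) → ℂ

section Circuits

variable {ι : Type} [Fintype ι] [DecidableEq ι]

/-- Squared norm. For the projection of a unit vector that belongs to a measurement outcome, this
is the probability of the outcome. -/
def weight (ψ : QState ι) : ℝ := ∑ s, ‖ψ s‖ ^ 2

/-- Unit vectors, that is, pure states. -/
def IsPure (ψ : QState ι) : Prop := weight ψ = 1

/-- The standard basis state `|b⟩`. -/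
def basisState (b : ι → Bit) : QState ι := fun s => if s = b then 1 else 0

open Classical in
/-- The projector onto the span of the standard basis states that satisfy `p`. -/
def project (p : (ι → Bit) → Prop) (ψ : QState ι) : QState ι :=
  fun s => if p s then ψ s else 0

/-- The universal gate set `{CNOT, H, T}`. In `cnot i j`, wire `i` is the control and wire `j`
the target. -/
inductive Gate (ι : Type) : Type
  | cnot (i j : ι) (h : i ≠ j) : Gate ι
  | had (i : ι) : Gate ι
  | tgate (i : ι) : Gate ι

/-- The unitary of a gate; `T` is the phase `exp (iπ/4)` on `|1⟩`. -/
def Gate.apply : Gate ι → QState ι → QState ι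
  | .cnot i j _, ψ => fun s => ψ (Function.update s j (s j + s i))
  | .had i, ψ => fun s =>
      (1 / (Real.sqrt 2 : ℂ)) *
        (ψ (Function.update s i 0) + (if s i = 0 then 1 else -1) * ψ (Function.update s i 1))
  | .tgate i, ψ => fun s =>
      (if s i = 0 then 1 else Complex.exp (Complex.I * (Real.pi / 4 : ℝ))) * ψ s

/-- Apply the gates of a list, the head first. -/
def runGates (gs : List (Gate ι)) (ψ : QState ι) : QState ι :=
  gs.foldl (fun φ g => g.apply φ) ψ

end Circuits

/-! ### Quantum programs with classical input and output -/

/-- A circuit that acts on an `m`-qubit classical input register and the `n` qubits of the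
program state (which also contain the work qubits), with a dedicated `m'`-qubit output register. -/
structure QCircuit (m n m' : ℕ) where
  gates : List (Gate (Fin m ⊕ Fin n))
  out : Fin m' ↪ Fin m ⊕ Fin n

/-- `Pr[C(|x⟩|φ⟩) → y]`. -/
def QCircuit.outProb {m n m' : ℕ} (C : QCircuit m n m') (φ : QState (Fin n))
    (x : BitStr m) (y : BitStr m') : ℝ :=
  weight (project (fun s => ∀ o, s (C.out o) = y o)
    (runGates C.gates
      (fun s => basisState x (fun i => s (Sum.inl i)) * φ (fun i => s (Sum.inr i)))))

/-- A family of programs, given by its output probabilities `Pr[x ↦ y]`, is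
`ε`-pseudo-deterministic with induced maps `Q`. -/
def IsPseudoDet {m m' : ℕ → ℕ}
    (pr : ∀ lam : ℕ, BitStr (m lam) → BitStr (m' lam) → ℝ)
    (ε : ℕ → ℝ) (Q : ∀ lam : ℕ, BitStr (m lam) → BitStr (m' lam)) : Prop :=
  ∀ lam x, 1 - ε lam ≤ pr lam x (Q lam x)

/-! ### Pseudorandom functions secure against superposition queries -/

/-- Gates of an oracle-aided circuit on `N` qubits; the oracle maps bit strings of arbitrary
length to `κ` bits. `query j w` sends `|u⟩|v⟩` to `|u⟩|v ⊕ F(u)⟩`, where the register of `u`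
consists of the `j` wires `w ∘ inl` and that of `v` of the `κ` wires `w ∘ inr`. -/
inductive OGate (κ N : ℕ) : Type
  | gate (g : Gate (Fin N)) : OGate κ N
  | query (j : ℕ) (w : Fin j ⊕ Fin κ ↪ Fin N) : OGate κ N

open Classical in
/-- The unitary of a gate of an oracle-aided circuit with oracle `F`. -/
def OGate.apply {κ N : ℕ} (F : List Bit → BitStr κ) :
    OGate κ N → QState (Fin N) → QState (Fin N)
  | .gate g, ψ => g.apply ψ
  | .query _ w, ψ => fun s => ψ (fun q =>
      s q + ∑ o, if w (Sum.inr o) = q then F (List.ofFn fun a => s (w (Sum.inl a))) o else 0)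

/-- An oracle-aided quantum circuit that starts in `|0…0⟩` and outputs the result of measuring
the wire `out`. -/
structure Distinguisher (κ : ℕ) where
  wires : ℕ
  circuit : List (OGate κ wires)
  out : Fin wires

/-- Number of qubits and gates. -/
def Distinguisher.size {κ : ℕ} (D : Distinguisher κ) : ℕ := D.wires + D.circuit.length

/-- The probability that `D`, with oracle `F`, outputs `1`. -/
def Distinguisher.accept {κ : ℕ} (D : Distinguisher κ) (F : List Bit → BitStr κ) : ℝ :=
  weight (project (fun s => s D.out = 1)
    (D.circuit.foldl (fun φ g => g.apply F φ) (basisState 0)))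

/-- Functions to `κ` bits on the bit strings of length at most `N`. -/
abbrev BoundedFn (κ N : ℕ) : Type := (j : Fin (N + 1)) → BitStr (j : ℕ) → BitStr κ

/-- A function on short strings as an oracle (the value on longer strings, which a circuit on `N`
wires cannot query, is immaterial). -/
def BoundedFn.toOracle {κ N : ℕ} (R : BoundedFn κ N) (l : List Bit) : BitStr κ :=
  if h : l.length ≤ N then R ⟨l.length, Nat.lt_succ_of_le h⟩ (fun i => l.get i) else 0

/-- A family of keyed functions `{0,1}* → {0,1}^κ`, with keys in `{0,1}^λ`. -/
abbrev KeyedFn (κ : ℕ → ℕ) : Type :=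
  ∀ lam : ℕ, BitStr lam → List Bit → BitStr (κ lam)

/-- `F` is a pseudorandom function secure against superposition queries: no family of
polynomial-size oracle-aided quantum circuits distinguishes it from a uniformly random function
with non-negligible advantage. -/
def IsPRF {κ : ℕ → ℕ} (F : KeyedFn κ) : Prop :=
  ∀ D : ∀ lam : ℕ, Distinguisher (κ lam), PolyBounded (fun lam => (D lam).size) →
    Negligible fun lam =>
      |avg (fun key : BitStr lam => (D lam).accept (F lam key)) -
        avg (fun R : BoundedFn (κ lam) (D lam).wires => (D lam).accept R.toOracle)|

/-! ### Signature tokens -/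

/-- Syntax of a signature token scheme. At security parameter `κ`, key generation outputs the
classical verification key `vk` with probability `vkProb κ vk`, and then the signing key is the
state `sk κ vk`, a density matrix. Signing a bit `b` is a quantum algorithm with a classical
output and hence is a POVM `sign κ b` on the signing key. -/
structure TokenScheme where
  vkLen : ℕ → ℕ
  skQubits : ℕ → ℕ
  sigLen : ℕ → ℕ
  vkLen_poly : PolyBounded vkLen
  skQubits_poly : PolyBounded skQubits
  sigLen_poly : PolyBounded sigLen
  vkProb : ∀ κ : ℕ, BitStr (vkLen κ) → ℝ
  vkProb_nonneg : ∀ κ vk, 0 ≤ vkProb κ vk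
  vkProb_sum : ∀ κ, ∑ vk, vkProb κ vk = 1
  sk : ∀ κ : ℕ, BitStr (vkLen κ) → Matrix (BitStr (skQubits κ)) (BitStr (skQubits κ)) ℂ
  sk_psd : ∀ κ vk, (sk κ vk).PosSemidef
  sk_trace : ∀ κ vk, (sk κ vk).trace = 1
  sign : ∀ κ : ℕ, Bit → BitStr (sigLen κ) →
    Matrix (BitStr (skQubits κ)) (BitStr (skQubits κ)) ℂ
  sign_psd : ∀ κ b σ, (sign κ b σ).PosSemidef
  sign_sum : ∀ κ b, ∑ σ, sign κ b σ = 1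
  ver : ∀ κ : ℕ, BitStr (vkLen κ) → Bit → BitStr (sigLen κ) → Prop

/-- The probability that signing `b` with the signing key `ρ` yields the signature `σ`. -/
def TokenScheme.signProb (tok : TokenScheme) (κ : ℕ)
    (ρ : Matrix (BitStr (tok.skQubits κ)) (BitStr (tok.skQubits κ)) ℂ)
    (b : Bit) (σ : BitStr (tok.sigLen κ)) : ℝ :=
  ((tok.sign κ b σ * ρ).trace).re

open Classical in
/-- Honestly generated signatures verify with probability one. -/
def TokenScheme.Correct (tok : TokenScheme) : Prop :=
  ∀ (κ : ℕ) (b : Bit),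
    ∑ vk, tok.vkProb κ vk *
      ∑ σ, (if tok.ver κ vk b σ then tok.signProb κ (tok.sk κ vk) b σ else 0) = 1

/-! ### Linear operations and `ZX` bases -/

/-- A CNOT on `n` wires, as a pair (control, target). -/
abbrev CnotPair (n : ℕ) : Type := {p : Fin n × Fin n // p.1 ≠ p.2}

/-- A linear operation is a sequence of CNOT gates, the head of the list being applied first. -/
abbrev LinOp (n : ℕ) : Type := List (CnotPair n)

/-- The gates of a linear operation. -/
def LinOp.gates {n : ℕ} (L : LinOp n) : List (Gate (Fin n)) :=
  L.map fun c => Gate.cnot c.1.1 c.1.2 c.2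

/-- A choice of bases: `some 0` for the standard basis, `some 1` for the Hadamard basis,
`none` for wires that are not measured. -/
abbrev Bases (n : ℕ) : Type := Fin n → Option Bit

/-- The set `Φ_θ` of measured wires. -/
def Bases.Phi {n : ℕ} (θ : Bases n) : Finset (Fin n) :=
  Finset.univ.filter fun w => θ w ≠ none

/-- The wires `Φ_{θ,1}` that are measured in the Hadamard basis, in increasing order. -/
def Bases.hadWires {n : ℕ} (θ : Bases n) : List (Fin n) :=
  (List.finRange n).filter fun w => decide (θ w = some 1)

/-- The gates of `H^{Φ_{θ,1}}`. -/
def Bases.hadGates {n : ℕ} (θ : Bases n) : List (Gate (Fin n)) :=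
  θ.hadWires.map Gate.had

/-! ### Linear + measurement quantum programs -/

/-- The classical part of an LM quantum program on `n` qubits, with `m` input bits, `m'` output
bits and layers `0, …, t`. The `i`-th layer applies `L i` and then, for `i < t`, the partial
measurement in the bases `θ i` whose outcome is `(v_i, r_i)`, where `v_i` is the restriction of
the measured string to `V i` and `r_i` is the bit `f i x (r_0, …, r_{i-1})` of the string on the
wires `Φ_i`. The last layer outputs `g x r` of the string on all wires. -/
structure LMPublic (n m m' t : ℕ) where
  L : Fin (t + 1) → LinOp n
  θ : Fin (t + 1) → Bases n
  V : Fin (t + 1) → Finset (Fin n)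
  f : (i : Fin t) → BitStr m → BitStr (i : ℕ) →
    ({w // w ∈ (θ i.castSucc).Phi} → Bit) → Bit
  g : BitStr m → BitStr t → ({w // w ∈ (θ (Fin.last t)).Phi} → Bit) → BitStr m'
  V_disjoint : ∀ i j, i ≠ j → Disjoint (V i) (V j)
  /-- `V_0, …, V_i` are among the wires of the `i`-th measurement. -/
  V_subset : ∀ i j, j ≤ i → V j ⊆ (θ i).Phi
  /-- The sets `V_0, …, V_t` exhaust the wires. -/
  V_cover : ∀ w, ∃ j, w ∈ V j
  /-- A wire that has been collapsed keeps its basis. -/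
  θ_stable : ∀ i j, j ≤ i → ∀ w ∈ V j, θ i w = θ j w
  /-- A wire that has been collapsed is no longer computed on. -/
  L_fresh : ∀ i j, j < i → ∀ c ∈ L i, c.1.1 ∉ V j ∧ c.1.2 ∉ V j

namespace LMPublic

variable {n m m' t : ℕ} (P : LMPublic n m m' t)

/-- The wires `W_i` of the `i`-th measurement that it collapses only partially:
`Φ_i = (V_0, …, V_i, W_i)`. -/
def W (i : Fin t) : Finset (Fin n) :=
  (P.θ i.castSucc).Phi.filter fun w => ∀ j : Fin (t + 1), j ≤ i.castSucc → w ∉ P.V j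

/-- Standard-basis-collapsible `W` wires: up to and including the `i`-th measurement, the program
is diagonal in the standard basis on `W_i`. -/
def Collapsible : Prop :=
  ∀ (i : Fin t), ∀ w ∈ P.W i,
    P.θ i.castSucc w = some 0 ∧
    (∀ j : Fin (t + 1), j < i.castSucc → w ∉ (P.θ j).Phi) ∧
    (∀ j : Fin (t + 1), j ≤ i.castSucc → ∀ c ∈ P.L j, c.1.2 ≠ w)

/-- The (unnormalised) state after layer `i < t` with outcome `(v_i, r_i)`: the projector
`H^{Φ_1} (∑_{s : outcome of s is (v_i, r_i)} |s⟩⟨s|) H^{Φ_1}` after the linear operation. -/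
def layer (x : BitStr m) (r : BitStr t)
    (v : (i : Fin t) → {w // w ∈ P.V i.castSucc} → Bit)
    (ψ : QState (Fin n)) (i : Fin t) : QState (Fin n) :=
  runGates (P.θ i.castSucc).hadGates
    (project
      (fun s : Fin n → Bit => (∀ w : {w // w ∈ P.V i.castSucc}, s w.1 = v i w) ∧
        P.f i x (fun j => r (Fin.castLE i.isLt.le j)) (fun w => s w.1) = r i)
      (runGates ((P.L i.castSucc).gates ++ (P.θ i.castSucc).hadGates) ψ))

/-- `Pr[LMEval(x, ψ) → y]`, as the sum over all transcripts `(v_i, r_i)_{i<t}` of the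
probability of the transcript followed by output `y`. -/
def evalProb (ψ : QState (Fin n)) (x : BitStr m) (y : BitStr m') : ℝ :=
  ∑ r : BitStr t, ∑ v : ((i : Fin t) → {w // w ∈ P.V i.castSucc} → Bit),
    weight (project (fun s : Fin n → Bit => P.g x r (fun w => s w.1) = y)
      (runGates ((P.L (Fin.last t)).gates ++ (P.θ (Fin.last t)).hadGates)
        ((List.finRange t).foldl (P.layer x r v) ψ)))

/-- The linear operation `L_i ⋯ L_0` (with `L_0` applied first). -/
def cumL (i : Fin (t + 1)) : LinOp n :=
  ((List.finRange (t + 1)).filter fun j => decide (j ≤ i)).flatMap P.L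

/-- Total number of CNOT gates. -/
def linSize : ℕ := ∑ i, (P.L i).length

end LMPublic

/-! ### The authentication scheme -/

/-- Vectors over the field with two elements of dimension `2κ + 1`, the basis states of one
encoded qubit. -/
abbrev Block (κ : ℕ) : Type := Fin (2 * κ + 1) → Bit

/-- The pairs of a `κ`-dimensional subspace `S` and a vector `Δ` outside of `S`. -/
abbrev SubspaceShift (κ : ℕ) : Type :=
  {SD : Submodule Bit (Block κ) × Block κ // Module.finrank Bit SD.1 = κ ∧ SD.2 ∉ SD.1}

/-- Authentication keys `(S, Δ, x, z)` for `n` qubits. Key generation samples uniformly. -/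
abbrev QASKey (κ n : ℕ) : Type := SubspaceShift κ × (Fin n → Block κ) × (Fin n → Block κ)

instance instFintypeSubspaceShift (κ : ℕ) : Fintype (SubspaceShift κ) := Fintype.ofFinite _

/-- The orthogonal complement for the standard bilinear form. -/
def perp {κ : ℕ} (S : Submodule Bit (Block κ)) : Submodule Bit (Block κ) where
  carrier := {v | ∀ s ∈ S, dotProduct s v = 0}
  add_mem' := by
    intro a b ha hb s hs
    rw [dotProduct_add, ha s hs, hb s hs, add_zero]
  zero_mem' := by
    intro s _
    exact dotProduct_zero s
  smul_mem' := by
    intro c v hv s hs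
    rw [dotProduct_smul, hv s hs, smul_zero]

namespace QASKey

variable {κ n : ℕ} (k : QASKey κ n)

/-- The subspace `S`. -/
def S : Submodule Bit (Block κ) := k.1.1.1

/-- The shift `Δ`. -/
def Δ : Block κ := k.1.1.2

/-- The exponents of the bit flips. -/
def x : Fin n → Block κ := k.2.1

/-- The exponents of the phase flips. -/
def z : Fin n → Block κ := k.2.2

/-- The subspace `S_Δ = S ∪ (S + Δ)`. -/
def SΔ : Submodule Bit (Block κ) := k.S ⊔ Submodule.span Bit {k.Δ}

open Classical in
/-- The amplitude of `|c⟩` in `E_{S,Δ}|b⟩ = |S + b·Δ⟩`. -/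
def encAmp (b : Bit) (c : Block κ) : ℂ :=
  if c - b • k.Δ ∈ k.S then 1 / (Real.sqrt (2 ^ κ) : ℂ) else 0

/-- The encoding `Enc_k = X^x Z^z E_{S,Δ}^{⊗n}`. The encoded qubit `i` consists of the wires
`(i, a)`. -/
def enc (ψ : QState (Fin n)) : QState (Fin n × Fin (2 * κ + 1)) := fun c =>
  (if ∑ i, ∑ a, k.z i a * (c (i, a) - k.x i a) = 0 then 1 else -1) *
    ∑ b : BitStr n, ψ b * ∏ i, k.encAmp (b i) (fun a => c (i, a) - k.x i a)

/-- The update `L(x, z) = (x_L, z_L)` of the Pauli exponents under a linear operation: for each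
CNOT from `i` to `j`, add `x_i` to `x_j` and `z_j` to `z_i`. -/
def update (L : LinOp n) : (Fin n → Block κ) × (Fin n → Block κ) :=
  L.foldl (fun q c =>
    (Function.update q.1 c.1.2 (q.1 c.1.2 + q.1 c.1.1),
     Function.update q.2 c.1.1 (q.2 c.1.1 + q.2 c.1.2))) (k.x, k.z)

open Classical in
/-- Decoding of a block in the standard basis: `S` is read as `0`, `S + Δ` as `1`. -/
def decZ (c : Block κ) : Option Bit :=
  if c ∈ k.S then some 0 else if c - k.Δ ∈ k.S then some 1 else none

open Classical in
/-- Decoding of a block in the Hadamard basis: the dual `S_Δ^⊥` is read as `0`, and its other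
coset in `S^⊥` as `1`. -/
def decX (c : Block κ) : Option Bit :=
  if c ∈ perp k.SΔ then some 0 else if c ∈ perp k.S then some 1 else none

/-- Decoding of the block of wire `w` in the basis `θ w`. -/
def decWire (L : LinOp n) (θ : Bases n) (w : Fin n) (c : Block κ) : Option Bit :=
  if θ w = some 0 then k.decZ (c - (k.update L).1 w) else k.decX (c - (k.update L).2 w)

open Classical in
/-- `Dec_{k,L,θ}`; the value `none` stands for `⊥`. -/
def dec (L : LinOp n) (θ : Bases n) (c : {w // w ∈ θ.Phi} → Block κ) :
    Option ({w // w ∈ θ.Phi} → Bit) :=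
  if h : ∀ w : {w // w ∈ θ.Phi}, (k.decWire L θ w (c w)).isSome then
    some fun w => (k.decWire L θ w (c w)).get (h w)
  else none

end QASKey

/-- `LinEval_L`: the transversal CNOT gates. -/
def linEvalGates {n : ℕ} (κ : ℕ) (L : LinOp n) : List (Gate (Fin n × Fin (2 * κ + 1))) :=
  L.flatMap fun c => (List.finRange (2 * κ + 1)).map fun a =>
    Gate.cnot (c.1.1, a) (c.1.2, a) (fun h => c.2 (Prod.ext_iff.mp h).1)

/-- `H^{Φ̃_{θ,1}}`: Hadamard gates on all qubits of the blocks in `Φ_{θ,1}`. -/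
def encHadGates {n : ℕ} (κ : ℕ) (θ : Bases n) : List (Gate (Fin n × Fin (2 * κ + 1))) :=
  θ.hadWires.flatMap fun w => (List.finRange (2 * κ + 1)).map fun a => Gate.had (w, a)

/-! ### The obfuscation scheme -/

/-- The derived security parameter. -/
def kappa (lam n : ℕ) : ℕ := max lam (n ^ 4)

section Scheme

variable {n m m' t : ℕ}

/-- An obfuscated program: the encoded state, the signing keys (one for each bit of the input;
the quantum part of the obfuscated program is the product of these states), and the oracles
`F_i` and `G`, where the value `none` stands for `⊥`. -/
structure Obfuscated (tok : TokenScheme) (κ : ℕ) (P : LMPublic n m m' t) where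
  state : QState (Fin n × Fin (2 * κ + 1))
  sk : Fin m → Matrix (BitStr (tok.skQubits κ)) (BitStr (tok.skQubits κ)) ℂ
  F : (i : Fin t) → BitStr m → (Fin m → BitStr (tok.sigLen κ)) →
    ({w // w ∈ (P.θ i.castSucc).Phi} → Block κ) → (Fin (i : ℕ) → BitStr κ) →
    Option (({w // w ∈ P.V i.castSucc} → Block κ) × BitStr κ)
  G : BitStr m → (Fin m → BitStr (tok.sigLen κ)) →
    ({w // w ∈ (P.θ (Fin.last t)).Phi} → Block κ) → (Fin t → BitStr κ) →
    Option (BitStr m')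

/-- Extension by zero of a string of blocks on the wires `A`. -/
def extendBlocks {κ : ℕ} (A : Finset (Fin n)) (c : {w // w ∈ A} → Block κ) : Fin n → Block κ :=
  fun w => if h : w ∈ A then c ⟨w, h⟩ else 0

/-- The bit string `(x, σ, ṽ_0, …, ṽ_ι, ℓ_0, …, ℓ_{ι-1}, b)`, where `ṽ_j` is the part on `V_j` of
the string of blocks `c`. -/
def hashInput {sl κ : ℕ} (P : LMPublic n m m' t) (x : BitStr m) (σ : Fin m → BitStr sl)
    (c : Fin n → Block κ) (ι : ℕ) (ℓ : Fin ι → BitStr κ) (b : Bit) : List Bit :=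
  List.ofFn x ++
  (List.finRange m).flatMap (fun i => List.ofFn (σ i)) ++
  ((List.finRange (t + 1)).filter fun j => decide (j.val ≤ ι)).flatMap (fun j =>
    ((P.V j).sort (· ≤ ·)).flatMap fun w => List.ofFn (c w)) ++
  (List.finRange ι).flatMap (fun j => List.ofFn (ℓ j)) ++
  [b]

open Classical in
/-- Recover the bits `r_ι` from the labels `ℓ_ι`, for `ι < i`; the result is `⊥` if for some `ι`
the two candidates `ℓ_{ι,0}`, `ℓ_{ι,1}` coincide or `ℓ_ι` is none of them. -/
def readLabels {sl κ : ℕ} (P : LMPublic n m m' t) (hash : List Bit → BitStr κ)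
    (x : BitStr m) (σ : Fin m → BitStr sl) (c : Fin n → Block κ)
    (i : ℕ) (ℓ : Fin i → BitStr κ) : Option (BitStr i) :=
  let cand : Fin i → Bit → BitStr κ := fun ι b =>
    hash (hashInput P x σ c ι (fun j => ℓ (Fin.castLE ι.isLt.le j)) b)
  if ∀ ι, cand ι 0 ≠ cand ι 1 ∧ (ℓ ι = cand ι 0 ∨ ℓ ι = cand ι 1) then
    some fun ι => if ℓ ι = cand ι 0 then 0 else 1
  else none

open Classical in
/-- The output of `QObf` on `ψ` when the classical random choices are the authentication key `k`,
the verification keys `vk` and the function `hash`. -/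
def qobf (tok : TokenScheme) (κ : ℕ) (P : LMPublic n m m' t) (ψ : QState (Fin n))
    (k : QASKey κ n) (vk : Fin m → BitStr (tok.vkLen κ)) (hash : List Bit → BitStr κ) :
    Obfuscated tok κ P where
  state := k.enc ψ
  sk := fun i => tok.sk κ (vk i)
  F := fun i x σ c ℓ =>
    if ∀ q, tok.ver κ (vk q) (x q) (σ q) then
      (readLabels P hash x σ (extendBlocks _ c) i ℓ).bind fun r =>
        (k.dec (P.cumL i.castSucc) (P.θ i.castSucc) c).map fun s =>
          (fun w => extendBlocks _ c w.1,
            hash (hashInput P x σ (extendBlocks _ c) i ℓ (P.f i x r s)))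
    else none
  G := fun x σ c ℓ =>
    if ∀ q, tok.ver κ (vk q) (x q) (σ q) then
      (readLabels P hash x σ (extendBlocks _ c) t ℓ).bind fun r =>
        (k.dec (P.cumL (Fin.last t)) (P.θ (Fin.last t)) c).map fun s => P.g x r s
    else none

/-- The steps of `QEval` after the token has been signed: elementary gates on the register of the
encoded state, and oracle calls. -/
inductive Instr (ι : Type) (t : ℕ) : Type
  | gate (g : Gate ι) : Instr ι t
  | callF (i : Fin t) : Instr ι t
  | callG : Instr ι t

/-- The program of `QEval`. -/
def qevalProgram (κ : ℕ) (P : LMPublic n m m' t) :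
    List (Instr (Fin n × Fin (2 * κ + 1)) t) :=
  (List.finRange t).flatMap (fun i =>
    (linEvalGates κ (P.L i.castSucc) ++ encHadGates κ (P.θ i.castSucc)).map Instr.gate ++
      [Instr.callF i] ++ (encHadGates κ (P.θ i.castSucc)).map Instr.gate) ++
  (linEvalGates κ (P.L (Fin.last t)) ++ encHadGates κ (P.θ (Fin.last t))).map Instr.gate ++
  [Instr.callG]

/-- One step of `QEval` on the (unnormalised) state of the register when the oracle calls have the
outcomes `(ṽ_i, ℓ_i)` and `y`: an oracle call is a measurement of the value of the oracle at the
content of the register. -/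
def qevalStep {tok : TokenScheme} {κ : ℕ} {P : LMPublic n m m' t} (ob : Obfuscated tok κ P)
    (x : BitStr m) (σ : Fin m → BitStr (tok.sigLen κ))
    (ℓ : Fin t → BitStr κ) (v : (i : Fin t) → {w // w ∈ P.V i.castSucc} → Block κ)
    (y : BitStr m') (φ : QState (Fin n × Fin (2 * κ + 1))) :
    Instr (Fin n × Fin (2 * κ + 1)) t → QState (Fin n × Fin (2 * κ + 1))
  | .gate g => g.apply φ
  | .callF i => project (fun s =>
      ob.F i x σ (fun w a => s (w.1, a)) (fun j => ℓ (Fin.castLE i.isLt.le j)) =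
        some (v i, ℓ i)) φ
  | .callG => project (fun s => ob.G x σ (fun w a => s (w.1, a)) ℓ = some y) φ

/-- `Pr[QEval(x, ob) → y]` for a proper output `y` (an oracle answer `⊥` leads to no such output):
the sum over all signatures `σ` of `x` and all outcomes `(ṽ_i, ℓ_i)_{i<t}`. -/
def qevalProb {tok : TokenScheme} {κ : ℕ} {P : LMPublic n m m' t} (ob : Obfuscated tok κ P)
    (x : BitStr m) (y : BitStr m') : ℝ :=
  ∑ σ : (Fin m → BitStr (tok.sigLen κ)), (∏ q, tok.signProb κ (ob.sk q) (x q) (σ q)) *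
    ∑ ℓ : (Fin t → BitStr κ), ∑ v : ((i : Fin t) → {w // w ∈ P.V i.castSucc} → Block κ),
      weight ((qevalProgram κ P).foldl (qevalStep ob x σ ℓ v y) ob.state)

/-- `Pr[QEval(x, ψ̃) → y : ψ̃ ← QObf(1^λ, ψ)]`, over uniform authentication and PRF keys and
independently generated tokens. -/
def obfEvalProb (tok : TokenScheme) (lam : ℕ) (P : LMPublic n m m' t)
    (F : BitStr lam → List Bit → BitStr (kappa lam n)) (ψ : QState (Fin n))
    (x : BitStr m) (y : BitStr m') : ℝ :=
  avg fun k : QASKey (kappa lam n) n =>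
    avg fun k' : BitStr lam =>
      ∑ vk : (Fin m → BitStr (tok.vkLen (kappa lam n))),
        (∏ q, tok.vkProb (kappa lam n) (vk q)) *
          qevalProb (qobf tok (kappa lam n) P ψ k vk (F k')) x y

/-- The `n`-qubit state `ψ` on the first qubits of the `n` blocks, all other qubits being
`|0⟩`. -/
def padBlocks {κ : ℕ} (ψ : QState (Fin n)) : QState (Fin n × Fin (2 * κ + 1)) := fun c =>
  if ∀ i, ∀ a, a ≠ 0 → c (i, a) = 0 then ψ (fun i => c (i, 0)) else 0

end Scheme

/-! ### Families -/

/-- A family of (classical parts of) LM quantum programs, with `n` qubits and `t + 1` layers. -/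
structure LMFamily (m m' : ℕ → ℕ) where
  n : ℕ → ℕ
  t : ℕ → ℕ
  prog : ∀ lam : ℕ, LMPublic (n lam) (m lam) (m' lam) (t lam)

/-- The numbers of input and output bits, qubits, layers and CNOT gates are polynomial. -/
def LMFamily.PolySize {m m' : ℕ → ℕ} (A : LMFamily m m') : Prop :=
  PolyBounded m ∧ PolyBounded m' ∧ PolyBounded A.n ∧ PolyBounded A.t ∧
    PolyBounded fun lam => (A.prog lam).linSize

/-- The derived security parameter of a family. -/
def LMFamily.kap {m m' : ℕ → ℕ} (A : LMFamily m m') (lam : ℕ) : ℕ := kappa lam (A.n lam)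

/-- Polynomial running time of the scheme, up to the generation of classical keys and the
algorithms of the token scheme: the obfuscated state has polynomially many qubits; for every
authentication key the encoding is carried out by a circuit with polynomially many gates; and the
evaluation makes polynomially many steps (gates and oracle calls). -/
def SchemePolyTime {m m' : ℕ → ℕ} (tok : TokenScheme) (A : LMFamily m m') : Prop :=
  PolyBounded (fun lam =>
    A.n lam * (2 * A.kap lam + 1) + m lam * tok.skQubits (A.kap lam)) ∧
  (∃ s : ℕ → ℕ, PolyBounded s ∧ ∀ (lam : ℕ) (k : QASKey (A.kap lam) (A.n lam)),
    ∃ gs : List (Gate (Fin (A.n lam) × Fin (2 * A.kap lam + 1))), gs.length ≤ s lam ∧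
      ∀ ψ, runGates gs (padBlocks ψ) = k.enc ψ) ∧
  PolyBounded fun lam => (qevalProgram (A.kap lam) (A.prog lam)).length

/-- The scheme evaluates correctly on the input states `ψ` with induced maps `Q`: for every
input `x`, the obfuscated program yields `Q(x)` with probability `1 - negl(λ)`. -/
def SchemeCorrectOn {m m' : ℕ → ℕ} (tok : TokenScheme) (A : LMFamily m m') (F : KeyedFn A.kap)
    (ψ : ∀ lam : ℕ, QState (Fin (A.n lam)))
    (Q : ∀ lam : ℕ, BitStr (m lam) → BitStr (m' lam)) : Prop :=
  ∃ ν : ℕ → ℝ, Negligible ν ∧ ∀ lam x,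
    1 - ν lam ≤ obfEvalProb tok lam (A.prog lam) (F lam) (ψ lam) x (Q lam x)

/-- Data of a universal family of LM quantum programs for quantum programs with `n` qubits, `m`
input bits and `m'` output bits: a family of LM programs on `n + d + a` qubits, an encoding of
circuits by `d` bits, and circuits that prepare the `a` ancilla qubits from `|0…0⟩`. Only the
input state depends on the program to be run. -/
structure UniversalLM (n m m' : ℕ → ℕ) where
  d : ℕ → ℕ
  a : ℕ → ℕ
  t : ℕ → ℕ
  prog : ∀ lam : ℕ, LMPublic (n lam + d lam + a lam) (m lam) (m' lam) (t lam)
  desc : ∀ lam : ℕ, QCircuit (m lam) (n lam) (m' lam) → BitStr (d lam)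
  anc : ∀ lam : ℕ, List (Gate (Fin (a lam)))

namespace UniversalLM

variable {n m m' : ℕ → ℕ} (U : UniversalLM n m m')

/-- The underlying family of LM programs. -/
def fam : LMFamily m m' where
  n := fun lam => n lam + U.d lam + U.a lam
  t := U.t
  prog := U.prog

/-- The input state `|φ⟩|C⟩|anc⟩` for the program `(φ, C)`. -/
def input (lam : ℕ) (C : QCircuit (m lam) (n lam) (m' lam)) (φ : QState (Fin (n lam))) :
    QState (Fin (n lam + U.d lam + U.a lam)) := fun s =>
  φ (fun i => s (Fin.castAdd _ (Fin.castAdd _ i))) *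
    basisState (U.desc lam C) (fun i => s (Fin.castAdd _ (Fin.natAdd _ i))) *
    runGates (U.anc lam) (basisState 0) (fun i => s (Fin.natAdd _ i))

/-- `U` is an efficient universal family with standard-basis-collapsible `W` wires: on every
program with at most `n` gates it has exactly the output distribution of that program. -/
def IsUniversal : Prop :=
  U.fam.PolySize ∧ (PolyBounded fun lam => (U.anc lam).length) ∧
  (∀ lam, (U.prog lam).Collapsible) ∧
  ∀ (lam : ℕ) (C : QCircuit (m lam) (n lam) (m' lam)) (φ : QState (Fin (n lam))),
    C.gates.length ≤ n lam → IsPure φ →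
      ∀ x y, (U.prog lam).evalProb (U.input lam C φ) x y = C.outProb φ x y

end UniversalLM

end QObf

end

open scoped ComplexOrder

noncomputable section

set_option linter.unusedSectionVars false

namespace QObf

/-! ### Signs -/

/-! Part 1 combines three facts.

The code. A transversal CNOT acts on `X^x Z^z E^{⊗n}` as the logical CNOT with updated Pauli
exponents (`QASKey.linEval_encPauli`). Hadamard gates on a block turn the code of `S`, `Δ` into that
of `S^⊥`, whose two cosets of `S_Δ^⊥` carry the logical Hadamard basis (`QASKey.hadDual`). Different
logical strings have disjoint supports, which the decoder separates, so a projection on decoded bits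
of an encoded state is the encoding of the projected state (`project_encWith`,
`QASKey.measureStep_encPauli`).

Deferral. An oracle answer reveals the whole blocks on `V_i`, not only logical bits. But those wires
keep their basis and are never computed on again, so their collapse commutes with all that follows
(`measureStep_collapse`) and can be moved to the end, where the sum over its outcomes removes it. On
the plain and on the encoded side there remains the same state, in which only the bits `r_i` have
been measured (`LMPublic.evalProb_eq`, `weight_qeval_labels`).

Labels. As long as the two candidate labels of every layer differ, labels and bits determine each
other, and the weight of a transcript does not depend on the hash function. Hence the obfuscated
program returns `y` with probability at least `(1 - δ)` times that of the LM program, where `δ`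
bounds the probability over the PRF key that candidates coincide for fixed `x, σ, c, r`
(`obfEvalProb_ge`). Pseudorandomness makes `δ` negligible: a circuit with these data hard-wired
computes the labels, adds the two candidates into one register and outputs the parity of the sum
against a fixed vector `u`. For a random function and `u ≠ 0` this bit is exactly uniform; a
coincidence makes it `0` for all `u`, so some `u ≠ 0` turns coincidences into an advantage
(`exists_distinguisher`).

The encoding circuit applies `κ` Hadamard gates to a block, then CNOT gates for a linear map that
sends unit vectors to `Δ` and a basis of `S`, then Pauli gates (`exists_enc_circuit`).

For part 2 the universal program has no linear operations at all; it computes by measurements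
(`MeasProgram`). A slot measures parities between an incoming register and ancillas. This teleports
the register through a linear map, a `T` phase with adaptive correction by an `S` phase, and a
Hadamard gate on a junk qubit, up to Pauli corrections that are functions of the outcomes
(`exists_slot_transfer`). A circuit gate fits into a slot: for a Hadamard gate its wire is swapped
with the junk qubit and swapped back in the next slot. A wire may be read only once before it is
collapsed, so each slot variable has one copy per layer; the Hadamard outcomes of the copies matter
only through their parity. The bit flips needed in a slot depend only on outcomes that are already
collapsed (`frameAt_a_congr`). All result strings turn out equally likely, and the corrected final
register has the distribution of the circuit (`evalProb_uprog`). Part 1 then applies to this family.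
-/

lemma bit_cases (b : Bit) : b = 0 ∨ b = 1 := by
  revert b; decide

lemma bit_add_self (b : Bit) : b + b = 0 := CharTwo.add_self_eq_zero b

lemma one_add_one_bit : (1 + 1 : Bit) = 0 := bit_add_self 1

/-- The sign `(-1)^b`. -/
def sgn (b : Bit) : ℂ := if b = 0 then 1 else -1

@[simp] lemma sgn_zero : sgn 0 = 1 := by simp [sgn]

@[simp] lemma sgn_one : sgn 1 = -1 := by simp [sgn]

lemma sgn_add (a b : Bit) : sgn (a + b) = sgn a * sgn b := by
  rcases bit_cases a with rfl | rfl <;> rcases bit_cases b with rfl | rfl <;>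
    simp [one_add_one_bit]

lemma sgn_sum {α : Type*} (s : Finset α) (f : α → Bit) :
    sgn (∑ i ∈ s, f i) = ∏ i ∈ s, sgn (f i) := by
  classical
  induction s using Finset.induction_on with
  | empty => simp
  | insert a s ha ih => rw [Finset.sum_insert ha, Finset.prod_insert ha, sgn_add, ih]

@[simp] lemma norm_sgn (a : Bit) : ‖sgn a‖ = 1 := by
  rcases bit_cases a with rfl | rfl <;> simp

/-- The normalisation `1/√2` of the Hadamard gate. -/
def rt : ℂ := 1 / (Real.sqrt 2 : ℂ)

lemma rt_mul_rt : rt * rt = 1 / 2 := by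
  have h : (Real.sqrt 2 : ℂ) * (Real.sqrt 2 : ℂ) = 2 := by
    rw [← Complex.ofReal_mul, Real.mul_self_sqrt (by norm_num)]; norm_num
  rw [rt, div_mul_div_comm, h, one_mul]

lemma norm_rt_sq : ‖rt‖ ^ 2 = 1 / 2 := by
  rw [← norm_pow, pow_two, rt_mul_rt]; norm_num

section Circuits

variable {ι : Type} [Fintype ι] [DecidableEq ι]

/-! ### Gates -/

lemma had_apply (i : ι) (ψ : QState ι) (s : ι → Bit) :
    (Gate.had i).apply ψ s =
      rt * (ψ (Function.update s i 0) + sgn (s i) * ψ (Function.update s i 1)) := rfl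

lemma cnot_apply (i j : ι) (h : i ≠ j) (ψ : QState ι) (s : ι → Bit) :
    (Gate.cnot i j h).apply ψ s = ψ (Function.update s j (s j + s i)) := rfl

lemma project_apply (p : (ι → Bit) → Prop) [DecidablePred p] (ψ : QState ι) (s : ι → Bit) :
    project p ψ s = if p s then ψ s else 0 := by
  unfold project; split_ifs <;> rfl

lemma project_project (p q : (ι → Bit) → Prop) (ψ : QState ι) :
    project p (project q ψ) = project (fun s => p s ∧ q s) ψ := by
  classical
  funext s
  simp only [project_apply]
  by_cases hp : p s <;> by_cases hq : q s <;> simp [hp, hq]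

lemma project_congr {p q : (ι → Bit) → Prop} (h : ∀ s, p s ↔ q s) (ψ : QState ι) :
    project p ψ = project q ψ := by
  rw [funext fun s => propext (h s)]

lemma project_true (ψ : QState ι) : project (fun _ => True) ψ = ψ := by
  classical
  funext s
  simp [project_apply]

@[simp] lemma runGates_nil (ψ : QState ι) : runGates [] ψ = ψ := rfl

lemma runGates_cons (g : Gate ι) (gs : List (Gate ι)) (ψ : QState ι) :
    runGates (g :: gs) ψ = runGates gs (g.apply ψ) := rfl

lemma runGates_append (a b : List (Gate ι)) (ψ : QState ι) :
    runGates (a ++ b) ψ = runGates b (runGates a ψ) := by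
  simp [runGates, List.foldl_append]

/-- The gate does not act on the wires of `T`. -/
def Gate.Avoids (T : Set ι) : Gate ι → Prop
  | .cnot i j _ => i ∉ T ∧ j ∉ T
  | .had i => i ∉ T
  | .tgate i => i ∉ T

/-- The predicate only reads the wires of `T`. -/
def ReadsOnly (T : Set ι) (p : (ι → Bit) → Prop) : Prop :=
  ∀ s s' : ι → Bit, (∀ w ∈ T, s w = s' w) → (p s ↔ p s')

lemma ReadsOnly.update {T : Set ι} {p : (ι → Bit) → Prop} (hp : ReadsOnly T p) {j : ι}
    (hj : j ∉ T) (s : ι → Bit) (b : Bit) : p (Function.update s j b) ↔ p s := by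
  apply hp
  intro w hw
  rw [Function.update_of_ne]
  rintro rfl
  exact hj hw

/-- A gate only mixes amplitudes of strings that differ on its own wires, and there `p` is blind. -/
lemma Gate.apply_project {T : Set ι} {p : (ι → Bit) → Prop} (hp : ReadsOnly T p)
    (g : Gate ι) (hg : g.Avoids T) (ψ : QState ι) :
    g.apply (project p ψ) = project p (g.apply ψ) := by
  classical
  funext s
  cases g with
  | cnot i j h =>
    simp only [cnot_apply, project_apply, hp.update hg.2]
  | had i =>
    simp only [had_apply, project_apply, hp.update hg]
    split_ifs <;> simp
  | tgate i =>
    simp only [Gate.apply, project_apply]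
    by_cases h : p s <;> simp [h]

lemma had_comm (i j : ι) (ψ : QState ι) :
    (Gate.had i).apply ((Gate.had j).apply ψ) = (Gate.had j).apply ((Gate.had i).apply ψ) := by
  by_cases h : i = j
  · rw [h]
  · funext s
    simp only [had_apply, Function.update_of_ne h, Function.update_of_ne (Ne.symm h),
      Function.update_comm h]
    ring

lemma had_had (i : ι) (ψ : QState ι) : (Gate.had i).apply ((Gate.had i).apply ψ) = ψ := by
  funext s
  simp only [had_apply, Function.update_idem, Function.update_self, sgn_zero, sgn_one]
  have key : ∀ a b c : ℂ, rt * (rt * (a + 1 * b) + c * (rt * (a + -1 * b))) =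
      (1 / 2) * ((1 + c) * a + (1 - c) * b) := by
    intro a b c
    rw [← rt_mul_rt]; ring
  rw [key]
  rcases bit_cases (s i) with h | h
  · have : Function.update s i 0 = s := by rw [← h, Function.update_eq_self]
    rw [this, h, sgn_zero]; ring
  · have : Function.update s i 1 = s := by rw [← h, Function.update_eq_self]
    rw [this, h, sgn_one]; ring

lemma Gate.had_comm_of_avoids (w : ι) (g : Gate ι) (hg : g.Avoids {w}) (ψ : QState ι) :
    g.apply ((Gate.had w).apply ψ) = (Gate.had w).apply (g.apply ψ) := by
  cases g with
  | cnot i j h =>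
    have hi : i ≠ w := hg.1
    have hj : j ≠ w := hg.2
    funext s
    simp only [had_apply, cnot_apply, Function.update_of_ne hi, Function.update_of_ne hj,
      Function.update_of_ne hj.symm, Function.update_comm hj]
  | had i => exact had_comm i w ψ
  | tgate i =>
    have hi : i ≠ w := hg
    funext s
    simp only [Gate.apply, Function.update_of_ne hi]
    ring

/-! ### Layers of Hadamard gates -/

/-- Hadamard gates on the wires of a list. -/
def hadList (l : List ι) (ψ : QState ι) : QState ι := runGates (l.map Gate.had) ψ

@[simp] lemma hadList_nil (ψ : QState ι) : hadList [] ψ = ψ := rfl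

lemma hadList_cons (i : ι) (l : List ι) (ψ : QState ι) :
    hadList (i :: l) ψ = hadList l ((Gate.had i).apply ψ) := rfl

lemma hadList_append (a b : List ι) (ψ : QState ι) :
    hadList (a ++ b) ψ = hadList b (hadList a ψ) := by
  simp [hadList, runGates_append]

lemma hadList_perm {l l' : List ι} (h : l.Perm l') (ψ : QState ι) :
    hadList l ψ = hadList l' ψ := by
  induction h generalizing ψ with
  | nil => rfl
  | cons x _ ih => simp only [hadList_cons, ih]
  | swap x y l => simp only [hadList_cons, had_comm]
  | trans _ _ ih1 ih2 => rw [ih1, ih2]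

lemma had_hadList (i : ι) (l : List ι) (ψ : QState ι) :
    hadList l ((Gate.had i).apply ψ) = (Gate.had i).apply (hadList l ψ) := by
  induction l generalizing ψ with
  | nil => rfl
  | cons j l ih => rw [hadList_cons, had_comm, ih, hadList_cons]

lemma hadList_hadList (l : List ι) (ψ : QState ι) : hadList l (hadList l ψ) = ψ := by
  induction l generalizing ψ with
  | nil => rfl
  | cons j l ih => rw [hadList_cons, hadList_cons, ← had_hadList, ih, had_had]

lemma hadList_project {T : Set ι} {p : (ι → Bit) → Prop} (hp : ReadsOnly T p)
    (l : List ι) (hl : ∀ w ∈ l, w ∉ T) (ψ : QState ι) :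
    hadList l (project p ψ) = project p (hadList l ψ) := by
  induction l generalizing ψ with
  | nil => rfl
  | cons j l ih =>
    rw [hadList_cons, hadList_cons,
      Gate.apply_project hp (Gate.had j) (hl j (by simp)),
      ih (fun w hw => hl w (by simp [hw]))]

lemma Gate.apply_hadList (g : Gate ι) (l : List ι) (hl : ∀ w ∈ l, g.Avoids {w}) (ψ : QState ι) :
    g.apply (hadList l ψ) = hadList l (g.apply ψ) := by
  induction l generalizing ψ with
  | nil => rfl
  | cons j l ih =>
    rw [hadList_cons, hadList_cons, ih (fun w hw => hl w (by simp [hw])),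
      Gate.had_comm_of_avoids j g (hl j (by simp))]

/-- The Walsh transform on the wires of `l`. The sum runs over all strings, with an indicator
outside `l`, so that it can later be reindexed as a whole. -/
lemma hadList_apply (l : List ι) (hl : l.Nodup) (ψ : QState ι) (s : ι → Bit) :
    hadList l ψ s = rt ^ l.length * ∑ u : ι → Bit,
      (if ∀ w, w ∉ l → u w = s w then sgn (∑ w ∈ l.toFinset, s w * u w) * ψ u else 0) := by
  induction l generalizing s with
  | nil =>
    have h : ∀ u : ι → Bit, (∀ w, w ∉ ([] : List ι) → u w = s w) ↔ u = s := by
      intro u; simp [funext_iff]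
    simp only [h]
    simp
  | cons i l ih =>
    obtain ⟨hi, hl⟩ := List.nodup_cons.mp hl
    have hi' : i ∉ l.toFinset := by simpa using hi
    rw [hadList_cons, had_hadList, had_apply, ih hl, ih hl, List.length_cons, pow_succ',
      mul_left_comm (sgn _), ← mul_add, ← mul_assoc, Finset.mul_sum, ← Finset.sum_add_distrib]
    congr 1
    refine Finset.sum_congr rfl fun u _ => ?_
    have h1 : ∀ b, ∑ w ∈ l.toFinset, Function.update s i b w * u w =
        ∑ w ∈ l.toFinset, s w * u w := by
      intro b
      refine Finset.sum_congr rfl fun w hw => ?_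
      rw [Function.update_of_ne]
      rintro rfl; exact hi' hw
    have h2 : ∀ b, (∀ w, w ∉ l → u w = Function.update s i b w) ↔
        (u i = b ∧ ∀ w, w ∉ i :: l → u w = s w) := by
      intro b
      constructor
      · intro h
        refine ⟨by simpa using h i hi, fun w hw => ?_⟩
        rw [List.mem_cons, not_or] at hw
        simpa [Function.update_of_ne hw.1] using h w hw.2
      · rintro ⟨ha, hb⟩ w hw
        by_cases hwi : w = i
        · rw [hwi, Function.update_self, ha]
        · rw [Function.update_of_ne hwi]
          exact hb w (by simp [hwi, hw])
    simp only [h1, h2, List.toFinset_cons, Finset.sum_insert hi', sgn_add]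
    by_cases hc : ∀ w, w ∉ i :: l → u w = s w
    · rcases bit_cases (u i) with h | h <;> simp [h, mul_assoc]
    · simp only [hc, and_false, if_false, mul_zero, add_zero]

/-! ### Weights -/

lemma weight_nonneg (ψ : QState ι) : 0 ≤ weight ψ := Finset.sum_nonneg fun _ _ => by positivity

/-- Each string is paired with its flip at `i`. Doubling the sum avoids splitting a string into the
wire `i` and the rest. -/
lemma sum_update_eq {R : Type*} [CommRing R] (i : ι) (f : (ι → Bit) → R) :
    ∑ s, (f (Function.update s i 0) + f (Function.update s i 1)) = 2 * ∑ s, f s := by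
  have hflip : ∑ s : ι → Bit, f (Function.update s i (s i + 1)) = ∑ s, f s := by
    refine Fintype.sum_bijective (fun s : ι → Bit => Function.update s i (s i + 1))
      (Function.Involutive.bijective fun s => ?_) _ _ fun _ => rfl
    simp [add_assoc, one_add_one_bit]
  rw [two_mul, ← hflip]
  conv_rhs => rw [add_comm]; arg 1; rw [hflip]
  rw [← Finset.sum_add_distrib]
  refine Finset.sum_congr rfl fun s _ => ?_
  rcases bit_cases (s i) with h | h
  · have : Function.update s i 0 = s := by rw [← h, Function.update_eq_self]
    rw [this, h, zero_add]
  · have : Function.update s i 1 = s := by rw [← h, Function.update_eq_self]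
    rw [this, h, one_add_one_bit, add_comm]

lemma weight_gate (g : Gate ι) (ψ : QState ι) : weight (g.apply ψ) = weight ψ := by
  cases g with
  | cnot i j h =>
    refine Fintype.sum_bijective (fun s : ι → Bit => Function.update s j (s j + s i))
      (Function.Involutive.bijective fun s => ?_) _ _ fun _ => rfl
    simp [Function.update_of_ne h, add_assoc, bit_add_self]
  | had i =>
    -- After pairing the two values of wire `i`, unitarity is the parallelogram law.
    have h2 : (2 : ℝ) * weight ((Gate.had i).apply ψ) = 2 * weight ψ := by
      unfold weight
      rw [← sum_update_eq i, ← sum_update_eq i]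
      refine Finset.sum_congr rfl fun s _ => ?_
      simp only [had_apply, Function.update_idem, Function.update_self, sgn_zero, sgn_one, one_mul,
        norm_mul, mul_pow, norm_rt_sq, neg_mul, ← sub_eq_add_neg]
      have := parallelogram_law_with_norm ℝ (ψ (Function.update s i 0))
        (ψ (Function.update s i 1))
      nlinarith
    linarith
  | tgate i =>
    refine Finset.sum_congr rfl fun s _ => ?_
    simp only [Gate.apply, norm_mul]
    split_ifs
    · simp
    · rw [mul_comm Complex.I, Complex.norm_exp_ofReal_mul_I, one_mul]

lemma weight_runGates (gs : List (Gate ι)) (ψ : QState ι) :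
    weight (runGates gs ψ) = weight ψ := by
  induction gs generalizing ψ with
  | nil => rfl
  | cons g gs ih => rw [runGates_cons, ih, weight_gate]

lemma weight_hadList (l : List ι) (ψ : QState ι) : weight (hadList l ψ) = weight ψ :=
  weight_runGates _ _

/-! ### Collapsed wires -/

/-- The string agrees with `v` on `T`. -/
def Agree (T : Set ι) (v s : ι → Bit) : Prop := ∀ w ∈ T, s w = v w

lemma agree_readsOnly (T : Set ι) (v : ι → Bit) : ReadsOnly T (Agree T v) := by
  intro s s' h
  refine forall₂_congr fun w hw => ?_
  rw [h w hw]

open Classical in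
/-- The projection that collapses the wires of `T` to `v`, in the Hadamard basis on the wires
of `l`. -/
def collapse (T : Set ι) (l : List ι) (v : ι → Bit) (ψ : QState ι) : QState ι :=
  hadList (l.filter (· ∈ T)) (project (Agree T v) (hadList (l.filter (· ∈ T)) ψ))

/-- The Hadamard gates of `l` outside `T` commute with the projection, and those inside `T` cancel
the outer gates of the collapse. -/
lemma hadList_collapse (T : Set ι) (l : List ι) (v : ι → Bit) (ψ : QState ι) :
    hadList l (collapse T l v ψ) = project (Agree T v) (hadList l ψ) := by
  classical
  have hp : (l.filter (· ∈ T) ++ l.filter (fun w => !decide (w ∈ T))).Perm l :=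
    List.filter_append_perm _ l
  rw [← hadList_perm hp, ← hadList_perm hp, hadList_append, hadList_append, collapse,
    hadList_hadList, hadList_project (agree_readsOnly T v)]
  intro w hw
  simpa using (List.mem_filter.mp hw).2

lemma hadList_project_agree (T : Set ι) (l : List ι) (v : ι → Bit) (ψ : QState ι) :
    hadList l (project (Agree T v) ψ) = collapse T l v (hadList l ψ) := by
  rw [← hadList_hadList l (collapse T l v (hadList l ψ)), hadList_collapse, hadList_hadList]

/-- Layers measure different sets of wires; since only the part of the list in `T` matters, the list
of the last layer can serve for all of them. -/
lemma collapse_congr {T : Set ι} {l l' : List ι} (hl : l.Nodup) (hl' : l'.Nodup)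
    (h : ∀ w ∈ T, w ∈ l ↔ w ∈ l') (v : ι → Bit) (ψ : QState ι) :
    collapse T l v ψ = collapse T l' v ψ := by
  classical
  have hp : (l.filter (· ∈ T)).Perm (l'.filter (· ∈ T)) := by
    rw [List.perm_ext_iff_of_nodup (hl.filter _) (hl'.filter _)]
    intro w
    simp only [List.mem_filter, decide_eq_true_eq]
    constructor
    · rintro ⟨a, b⟩; exact ⟨(h w b).mp a, b⟩
    · rintro ⟨a, b⟩; exact ⟨(h w b).mpr a, b⟩
  unfold collapse
  rw [hadList_perm hp, hadList_perm hp]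

lemma Gate.Avoids.mono {T T' : Set ι} (h : T ⊆ T') {g : Gate ι} (hg : g.Avoids T') :
    g.Avoids T := by
  cases g with
  | cnot i j _ => exact ⟨fun hi => hg.1 (h hi), fun hj => hg.2 (h hj)⟩
  | had i => exact fun hi => hg (h hi)
  | tgate i => exact fun hi => hg (h hi)

lemma runGates_collapse (T : Set ι) (l : List ι) (v : ι → Bit) (gs : List (Gate ι))
    (hgs : ∀ g ∈ gs, g.Avoids T) (ψ : QState ι) :
    runGates gs (collapse T l v ψ) = collapse T l v (runGates gs ψ) := by
  classical
  induction gs generalizing ψ with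
  | nil => rfl
  | cons g gs ih =>
    have hg : g.Avoids T := hgs g (by simp)
    have hw : ∀ w ∈ l.filter (· ∈ T), g.Avoids {w} := by
      intro w hw
      refine hg.mono (Set.singleton_subset_iff.mpr ?_)
      simpa using (List.mem_filter.mp hw).2
    rw [runGates_cons, runGates_cons, ← ih (fun g hg => hgs g (by simp [hg]))]
    congr 1
    unfold collapse
    rw [Gate.apply_hadList g _ hw, Gate.apply_project (agree_readsOnly T v) g hg,
      Gate.apply_hadList g _ hw]

lemma collapse_empty (l : List ι) (v : ι → Bit) (ψ : QState ι) : collapse ∅ l v ψ = ψ := by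
  classical
  have h : ∀ s : ι → Bit, Agree ∅ v s ↔ True := by simp [Agree]
  rw [collapse, project_congr h, project_true, hadList_hadList]

/-- Gates, then a projection in the Hadamard basis on the wires of `l`. -/
def measureStep (gs : List (Gate ι)) (l : List ι) (p : (ι → Bit) → Prop) (ψ : QState ι) :
    QState ι :=
  hadList l (project p (hadList l (runGates gs ψ)))

/-- A layer of measurements that collapses further wires acts, on a state with some wires
collapsed, as the collapse of those wires after the residual measurement. -/
lemma measureStep_collapse {gs : List (Gate ι)} {l l' : List ι} {q p : (ι → Bit) → Prop}
    {T T' : Set ι} {v : ι → Bit} (hT : T ⊆ T') (hl : l.Nodup) (hl' : l'.Nodup)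
    (hll : ∀ w ∈ T', w ∈ l ↔ w ∈ l') (hgs : ∀ g ∈ gs, g.Avoids T)
    (hq : ∀ s, Agree T v s → (q s ↔ Agree T' v s ∧ p s)) (ψ : QState ι) :
    measureStep gs l q (collapse T l' v ψ) = collapse T' l' v (measureStep gs l p ψ) := by
  have h : ∀ s, (q s ∧ Agree T v s) ↔ (Agree T' v s ∧ p s) := by
    intro s
    constructor
    · rintro ⟨a, b⟩; exact (hq s b).mp a
    · rintro ⟨a, b⟩
      have hs : Agree T v s := fun w hw => a w (hT hw)
      exact ⟨(hq s hs).mpr ⟨a, b⟩, hs⟩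
  unfold measureStep
  rw [runGates_collapse _ _ _ _ hgs, ← collapse_congr hl hl' (fun w hw => hll w (hT hw)),
    hadList_collapse, project_project, project_congr h, ← project_project, hadList_project_agree,
    collapse_congr hl hl' hll]

end Circuits

/-! ### Folds over the layers -/

/-- An invariant for two runs through the layers in parallel; the index of `R` counts the layers
completed. -/
lemma foldl_finRange_rel {α β : Type*} {t : ℕ} (f : α → Fin t → α) (g : β → Fin t → β)
    (R : ℕ → α → β → Prop) (a : α) (b : β) (h0 : R 0 a b)
    (hs : ∀ (i : Fin t) a b, R i a b → R (i + 1) (f a i) (g b i)) :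
    R t ((List.finRange t).foldl f a) ((List.finRange t).foldl g b) := by
  induction t with
  | zero => simpa using h0
  | succ t ih =>
    rw [List.finRange_succ_last, List.foldl_append, List.foldl_append, List.foldl_map,
      List.foldl_map]
    have := ih (fun a i => f a i.castSucc) (fun b i => g b i.castSucc)
      (fun i a b h => hs i.castSucc a b h)
    exact hs (Fin.last t) _ _ this

/-! ### Blockwise encodings -/

section Blocks

variable {ν β : Type} [Fintype ν] [DecidableEq ν] [Fintype β] [DecidableEq β]

/-- The encoding of wire `w` by the block states `A w 0` and `A w 1`. -/
def encWith (A : ν → Bit → QState β) (ψ : QState ν) : QState (ν × β) := fun c =>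
  ∑ b : ν → Bit, ψ b * ∏ w, A w (b w) (fun a => c (w, a))

lemma encWith_split (A : ν → Bit → QState β) (ψ : QState ν) (w : ν) (c : ν × β → Bit) :
    encWith A ψ c = ∑ b : ν → Bit,
      (ψ b * ∏ w' ∈ Finset.univ.erase w, A w' (b w') (fun a => c (w', a))) *
        A w (b w) (fun a => c (w, a)) := by
  refine Finset.sum_congr rfl fun b _ => ?_
  rw [mul_assoc, Finset.prod_erase_mul _ _ (Finset.mem_univ w)]

/-- A gate on the wires of the block `w`. -/
def Gate.onBlock (w : ν) : Gate β → Gate (ν × β)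
  | .cnot i j h => .cnot (w, i) (w, j) (fun e => h (Prod.ext_iff.mp e).2)
  | .had i => .had (w, i)
  | .tgate i => .tgate (w, i)

lemma block_update_self (c : ν × β → Bit) (w : ν) (a : β) (v : Bit) :
    (fun a' => Function.update c (w, a) v (w, a')) = Function.update (fun a' => c (w, a')) a v := by
  funext a'
  by_cases h : a' = a
  · subst h; simp
  · rw [Function.update_of_ne h, Function.update_of_ne]
    simpa using h

lemma block_update_ne (c : ν × β → Bit) {w w' : ν} (hw : w' ≠ w) (a : β) (v : Bit) :
    (fun a' => Function.update c (w, a) v (w', a')) = fun a' => c (w', a') := by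
  funext a'
  rw [Function.update_of_ne]
  simp [hw]

lemma prod_erase_block_update (A : ν → Bit → QState β) (b : ν → Bit) (c : ν × β → Bit) (w : ν)
    (a : β) (v : Bit) :
    ∏ w' ∈ Finset.univ.erase w, A w' (b w') (fun a' => Function.update c (w, a) v (w', a')) =
      ∏ w' ∈ Finset.univ.erase w, A w' (b w') (fun a' => c (w', a')) := by
  refine Finset.prod_congr rfl fun w' hw' => ?_
  rw [block_update_ne c (Finset.ne_of_mem_erase hw')]

lemma prod_erase_amp_update (A : ν → Bit → QState β) (b : ν → Bit) (c : ν × β → Bit) (w : ν)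
    (D : Bit → QState β) :
    ∏ w' ∈ Finset.univ.erase w, Function.update A w D w' (b w') (fun a' => c (w', a')) =
      ∏ w' ∈ Finset.univ.erase w, A w' (b w') (fun a' => c (w', a')) := by
  refine Finset.prod_congr rfl fun w' hw' => ?_
  rw [Function.update_of_ne (Finset.ne_of_mem_erase hw')]

/-- The encoding is linear in the block state of `w`, and a gate inside that block leaves the other
factors alone. -/
lemma apply_onBlock_encWith (w : ν) (g : Gate β) (A : ν → Bit → QState β) (ψ : QState ν) :
    (g.onBlock w).apply (encWith A ψ) =
      encWith (Function.update A w fun b => g.apply (A w b)) ψ := by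
  funext c
  rw [encWith_split _ _ w]
  simp only [prod_erase_amp_update, Function.update_self]
  cases g with
  | cnot i j h =>
    simp only [Gate.onBlock, cnot_apply]
    rw [encWith_split _ _ w]
    simp only [prod_erase_block_update, block_update_self]
  | had i =>
    simp only [Gate.onBlock, had_apply]
    rw [encWith_split _ _ w, encWith_split _ _ w]
    simp only [prod_erase_block_update, block_update_self]
    rw [Finset.mul_sum, ← Finset.sum_add_distrib, Finset.mul_sum]
    refine Finset.sum_congr rfl fun b _ => ?_
    ring
  | tgate i =>
    simp only [Gate.onBlock, Gate.apply]
    rw [encWith_split _ _ w, Finset.mul_sum]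
    refine Finset.sum_congr rfl fun b _ => ?_
    ring

lemma runGates_onBlock_encWith (w : ν) (gs : List (Gate β)) (A : ν → Bit → QState β)
    (ψ : QState ν) :
    runGates (gs.map (Gate.onBlock w)) (encWith A ψ) =
      encWith (Function.update A w fun b => runGates gs (A w b)) ψ := by
  induction gs generalizing A with
  | nil => simp
  | cons g gs ih =>
    rw [List.map_cons, runGates_cons, apply_onBlock_encWith, ih]
    simp [runGates_cons]

/-- The blocks of `D` are those of `A` with the logical Hadamard gate moved to the code. -/
def HadDual (A D : Bit → QState β) (l : List β) : Prop :=
  ∀ b c, hadList l (A b) c = rt * (D 0 c + sgn b * D 1 c)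

lemma hadList_block_encWith (w : ν) (l : List β) (A : ν → Bit → QState β) (D : Bit → QState β)
    (hD : HadDual (A w) D l) (ψ : QState ν) :
    hadList (l.map fun a => (w, a)) (encWith A ψ) =
      encWith (Function.update A w D) ((Gate.had w).apply ψ) := by
  have h1 : hadList (l.map fun a => (w, a)) (encWith A ψ) =
      runGates ((l.map Gate.had).map (Gate.onBlock w)) (encWith A ψ) := by
    rw [hadList, List.map_map, List.map_map]; rfl
  rw [h1, runGates_onBlock_encWith]
  funext c
  rw [encWith_split _ _ w, encWith_split _ _ w]
  simp only [prod_erase_amp_update, Function.update_self]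
  have h2 : ∀ b, runGates (l.map Gate.had) (A w b) = fun c => rt * (D 0 c + sgn b * D 1 c) :=
    fun b => funext (hD b)
  simp only [h2]
  -- Doubling both sides pairs each logical string with its flip at `w`; the two terms then realise
  -- the logical Hadamard gate.
  refine mul_left_cancel₀ (two_ne_zero (α := ℂ)) ?_
  rw [← sum_update_eq w, ← sum_update_eq w]
  refine Finset.sum_congr rfl fun b _ => ?_
  have h3 : ∀ v, ∏ w' ∈ Finset.univ.erase w,
      A w' (Function.update b w v w') (fun a' => c (w', a')) =
      ∏ w' ∈ Finset.univ.erase w, A w' (b w') (fun a' => c (w', a')) := by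
    intro v
    refine Finset.prod_congr rfl fun w' hw' => ?_
    rw [Function.update_of_ne (Finset.ne_of_mem_erase hw')]
  simp only [h3, Function.update_self, had_apply, Function.update_idem, sgn_zero, sgn_one]
  ring

lemma hadList_blocks_encWith (lw : List ν) (hlw : lw.Nodup) (l : List β)
    (A D : ν → Bit → QState β) (hD : ∀ w ∈ lw, HadDual (A w) (D w) l) (ψ : QState ν) :
    hadList (lw.flatMap fun w => l.map fun a => (w, a)) (encWith A ψ) =
      encWith (fun w => if w ∈ lw then D w else A w) (hadList lw ψ) := by
  induction lw generalizing A ψ with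
  | nil => simp
  | cons w lw ih =>
    obtain ⟨hw, hlw⟩ := List.nodup_cons.mp hlw
    rw [List.flatMap_cons, hadList_append, hadList_block_encWith w l A (D w) (hD w (by simp)),
      hadList_cons, ih hlw]
    · congr 1
      funext w'
      by_cases h : w' = w
      · subst h; simp [hw]
      · simp [h]
    · intro w' hw'
      rw [Function.update_of_ne (ne_of_mem_of_not_mem hw' hw)]
      exact hD w' (by simp [hw'])

lemma encWith_eq_zero {A : ν → Bit → QState β} {dec : ν → (β → Bit) → Option Bit}
    (hdec : ∀ w b c, A w b c ≠ 0 → dec w c = some b) {b : ν → Bit} {c : ν × β → Bit}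
    (h : ¬∀ w, dec w (fun a => c (w, a)) = some (b w)) :
    ∏ w, A w (b w) (fun a => c (w, a)) = 0 := by
  obtain ⟨w, hw⟩ := not_forall.mp h
  exact Finset.prod_eq_zero (Finset.mem_univ w) (not_not.mp fun hne => hw (hdec _ _ _ hne))

/-- On a physical string `c`, only the logical string decoded from `c` contributes to the amplitude,
so a condition on decoded values can be tested before encoding. -/
lemma project_encWith {A : ν → Bit → QState β} {dec : ν → (β → Bit) → Option Bit}
    (hdec : ∀ w b c, A w b c ≠ 0 → dec w c = some b)
    {Q : (ν × β → Bit) → Prop} {P : (ν → Bit) → Prop}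
    (hQ : ∀ c b, (∀ w, dec w (fun a => c (w, a)) = some (b w)) → (Q c ↔ P b)) (ψ : QState ν) :
    project Q (encWith A ψ) = encWith A (project P ψ) := by
  classical
  funext c
  have h : ∀ b : ν → Bit, project P ψ b * ∏ w, A w (b w) (fun a => c (w, a)) =
      if Q c then ψ b * ∏ w, A w (b w) (fun a => c (w, a)) else 0 := by
    intro b
    by_cases hb : ∀ w, dec w (fun a => c (w, a)) = some (b w)
    · simp only [project_apply, hQ c b hb, ite_mul, zero_mul]
    · rw [encWith_eq_zero hdec hb, mul_zero, mul_zero, ite_self]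
  rw [project_apply]
  simp only [encWith, h]
  split_ifs <;> simp

/-- Decodability leaves at most one nonzero term in each amplitude, so squared norms add without
interference and factor over the blocks. -/
lemma weight_encWith {A : ν → Bit → QState β} {dec : ν → (β → Bit) → Option Bit}
    (hdec : ∀ w b c, A w b c ≠ 0 → dec w c = some b)
    (hn : ∀ w b, weight (A w b) = 1) (ψ : QState ν) :
    weight (encWith A ψ) = weight ψ := by
  classical
  have h1 : ∀ c, ‖encWith A ψ c‖ ^ 2 =
      ∑ b : ν → Bit, ‖ψ b‖ ^ 2 * ∏ w, ‖A w (b w) (fun a => c (w, a))‖ ^ 2 := by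
    intro c
    by_cases h : ∃ b : ν → Bit, ∀ w, dec w (fun a => c (w, a)) = some (b w)
    · obtain ⟨b, hb⟩ := h
      have hne : ∀ b' : ν → Bit, b' ≠ b → ∏ w, A w (b' w) (fun a => c (w, a)) = 0 := by
        intro b' hb'
        refine encWith_eq_zero hdec fun h' => hb' (funext fun w => ?_)
        have := (h' w).symm.trans (hb w)
        exact Option.some.inj this
      unfold encWith
      rw [Finset.sum_eq_single b, Finset.sum_eq_single b]
      · rw [norm_mul, mul_pow, norm_prod, Finset.prod_pow]
      · intro b' _ hb'
        rw [Finset.prod_pow, ← norm_prod, hne b' hb']; simp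
      · simp
      · intro b' _ hb'
        rw [hne b' hb', mul_zero]
      · simp
    · have hz : ∀ b : ν → Bit, ∏ w, A w (b w) (fun a => c (w, a)) = 0 := fun b =>
        encWith_eq_zero hdec fun h' => h ⟨b, h'⟩
      unfold encWith
      rw [Finset.sum_eq_zero (fun b _ => by rw [hz b, mul_zero]), Finset.sum_eq_zero]
      · simp
      · intro b _
        rw [Finset.prod_pow, ← norm_prod, hz b]; simp
  unfold weight
  simp only [h1]
  rw [Finset.sum_comm]
  refine Finset.sum_congr rfl fun b _ => ?_
  rw [← Finset.mul_sum]
  have h2 : ∑ c : ν × β → Bit, ∏ w, ‖A w (b w) (fun a => c (w, a))‖ ^ 2 =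
      ∏ w, ∑ u : β → Bit, ‖A w (b w) u‖ ^ 2 := by
    rw [Finset.prod_univ_sum, Fintype.piFinset_univ]
    exact Fintype.sum_equiv (Equiv.curry ν β Bit) _ _ fun c => rfl
  rw [h2]
  simp only [weight] at hn
  simp only [hn, Finset.prod_const_one, mul_one]

end Blocks

/-! ### The authentication code -/

open Classical in
-- Orthogonality of characters: if `v` is not orthogonal to some `s₀ ∈ S`, translation by `s₀`
-- preserves `S` and negates the sum.
lemma sum_sgn_submodule {κ : ℕ} (S : Submodule Bit (Block κ)) (v : Block κ) :
    ∑ s : Block κ, (if s ∈ S then sgn (dotProduct v s) else 0) =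
      if v ∈ perp S then (Nat.card S : ℂ) else 0 := by
  by_cases h : v ∈ perp S
  · have h1 : ∀ s : Block κ, (if s ∈ S then sgn (dotProduct v s) else 0) =
        if s ∈ S then (1 : ℂ) else 0 := by
      intro s
      by_cases hs : s ∈ S
      · have : dotProduct v s = 0 := by rw [dotProduct_comm]; exact h s hs
        simp [hs, this]
      · simp [hs]
    rw [if_pos h, Finset.sum_congr rfl fun s _ => h1 s, Finset.sum_boole, Nat.card_eq_fintype_card,
      Fintype.card_subtype]
  · rw [if_neg h]
    have h2 : ∃ s ∈ S, dotProduct s v ≠ 0 := by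
      by_contra hc
      push Not at hc
      exact h hc
    obtain ⟨s₀, hs₀, hv⟩ := h2
    have hv1 : dotProduct v s₀ = 1 := by
      rw [dotProduct_comm]; exact (bit_cases _).resolve_left hv
    have h3 : ∑ s : Block κ, (if s ∈ S then sgn (dotProduct v s) else 0) =
        ∑ s : Block κ, -(if s ∈ S then sgn (dotProduct v s) else 0) := by
      refine Fintype.sum_equiv (Equiv.addRight s₀) _ _ fun s => ?_
      have : s + s₀ ∈ S ↔ s ∈ S := Submodule.add_mem_iff_left S hs₀
      simp only [Equiv.coe_addRight, this, dotProduct_add, hv1, sgn_add, sgn_one]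
      split_ifs <;> simp
    rw [Finset.sum_neg_distrib] at h3
    exact self_eq_neg.mp h3

namespace QASKey

variable {κ n : ℕ} (k : QASKey κ n)

lemma card_S : Nat.card k.S = 2 ^ κ := by
  have h := Module.natCard_eq_pow_finrank (K := Bit) (V := k.S)
  rw [h, Nat.card_zmod]
  congr 1
  exact k.1.2.1

lemma Δ_notMem : k.Δ ∉ k.S := k.1.2.2

/-- Pairs of Pauli exponents. -/
abbrev Pauli (κ n : ℕ) : Type := (Fin n → Block κ) × (Fin n → Block κ)

/-- The block state `X^x Z^z E |b⟩`. -/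
def stdAmp (q : Pauli κ n) (w : Fin n) (b : Bit) : QState (Fin (2 * κ + 1)) := fun c =>
  sgn (dotProduct (q.2 w) (c - q.1 w)) * k.encAmp b (c - q.1 w)

open Classical in
/-- The block states that encode a qubit in the Hadamard basis. -/
def dualAmp (q : Pauli κ n) (w : Fin n) (b : Bit) : QState (Fin (2 * κ + 1)) := fun c =>
  (1 / (Real.sqrt (2 ^ κ) : ℂ)) * sgn (dotProduct c (q.1 w)) *
    if c - q.2 w ∈ perp k.S ∧ dotProduct k.Δ (c - q.2 w) = b then 1 else 0

/-- The encoding with Pauli exponents `q`. -/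
def encPauli (q : Pauli κ n) (ψ : QState (Fin n)) : QState (Fin n × Fin (2 * κ + 1)) :=
  encWith (k.stdAmp q) ψ

lemma enc_eq (ψ : QState (Fin n)) : k.enc ψ = k.encPauli (k.x, k.z) ψ := by
  funext c
  simp only [enc, encPauli, encWith, stdAmp]
  rw [Finset.mul_sum]
  refine Finset.sum_congr rfl fun b _ => ?_
  rw [Finset.prod_mul_distrib, ← sgn_sum]
  have : (if ∑ i, ∑ a, k.z i a * (c (i, a) - k.x i a) = 0 then (1 : ℂ) else -1) =
    sgn (∑ i, dotProduct (k.z i) ((fun a => c (i, a)) - k.x i)) := rfl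
  rw [this, mul_left_comm]
  rfl

lemma weight_stdAmp (q : Pauli κ n) (w : Fin n) (b : Bit) : weight (k.stdAmp q w b) = 1 := by
  classical
  have h1 : ∀ c : Block κ, ‖k.stdAmp q w b c‖ ^ 2 =
      if c - (q.1 w + b • k.Δ) ∈ k.S then ((2 : ℝ) ^ κ)⁻¹ else 0 := by
    intro c
    have e : c - q.1 w - b • k.Δ = c - (q.1 w + b • k.Δ) := by abel
    simp only [stdAmp, norm_mul, norm_sgn, one_mul, encAmp, e]
    split_ifs
    · rw [norm_div, norm_one, Complex.norm_real, Real.norm_of_nonneg (Real.sqrt_nonneg _), div_pow,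
        Real.sq_sqrt (by positivity), one_pow, one_div]
    · simp
  unfold weight
  simp only [h1]
  rw [← Fintype.sum_equiv (Equiv.addRight (q.1 w + b • k.Δ))
    (fun c : Block κ => if c ∈ k.S then ((2 : ℝ) ^ κ)⁻¹ else 0) _ (fun c => by simp)]
  rw [← Finset.sum_filter, Finset.sum_const, ← Fintype.card_subtype, ← Nat.card_eq_fintype_card]
  have h2 : Nat.card {c // c ∈ k.S} = 2 ^ κ := k.card_S
  rw [h2, nsmul_eq_mul]
  push_cast
  exact mul_inv_cancel₀ (by positivity)

lemma decZ_of_encAmp {b : Bit} {c : Block κ} (h : k.encAmp b c ≠ 0) : k.decZ c = some b := by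
  have hc : c - b • k.Δ ∈ k.S := by
    by_contra hc
    exact h (by simp [encAmp, hc])
  rcases bit_cases b with rfl | rfl
  · rw [zero_smul, sub_zero] at hc
    simp [decZ, hc]
  · rw [one_smul] at hc
    -- The two cosets are disjoint because `Δ ∉ S`, so the test for `S` that `decZ` makes first
    -- fails here.
    have h0 : c ∉ k.S := fun h0 => k.Δ_notMem (by simpa using k.S.sub_mem h0 hc)
    simp [decZ, hc, h0]

lemma mem_perp_SΔ (v : Block κ) : v ∈ perp k.SΔ ↔ v ∈ perp k.S ∧ dotProduct k.Δ v = 0 := by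
  constructor
  · intro h
    exact ⟨fun s hs => h s (Submodule.mem_sup_left hs),
      h _ (Submodule.mem_sup_right (Submodule.mem_span_singleton_self _))⟩
  · rintro ⟨h1, h2⟩ s hs
    obtain ⟨a, ha, b, hb, rfl⟩ := Submodule.mem_sup.mp hs
    obtain ⟨r, rfl⟩ := Submodule.mem_span_singleton.mp hb
    rw [add_dotProduct, smul_dotProduct, h1 a ha, h2, smul_zero, add_zero]

lemma decX_of_dualAmp {q : Pauli κ n} {w : Fin n} {b : Bit} {c : Block κ}
    (h : k.dualAmp q w b c ≠ 0) : k.decX (c - q.2 w) = some b := by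
  have hc : c - q.2 w ∈ perp k.S ∧ dotProduct k.Δ (c - q.2 w) = b := by
    by_contra hc
    exact h (by simp only [dualAmp, if_neg hc, mul_zero])
  obtain ⟨h1, h2⟩ := hc
  unfold decX
  rw [mem_perp_SΔ]
  rcases bit_cases b with rfl | rfl
  · simp [h1, h2]
  · simp [h1, h2]

/-- The transform of the indicator of a coset of `S` is supported on `S^⊥`; the shift by `b • Δ`
gives the sign `(-1)^{b (Δ·c)}`, so the coset of `S_Δ^⊥` in which `c` lies plays the part of the
logical bit. The Pauli exponents exchange their roles. -/
lemma hadDual (q : Pauli κ n) (w : Fin n) :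
    HadDual (k.stdAmp q w) (k.dualAmp q w) (List.finRange (2 * κ + 1)) := by
  classical
  intro b c
  rw [hadList_apply _ (List.nodup_finRange _)]
  simp only [List.mem_finRange, not_true_eq_false, false_implies, implies_true, if_true,
    List.length_finRange, List.toFinset_finRange]
  -- The `2κ + 1` Hadamard factors against the `2^κ` elements of `S` leave one factor `1/√2`, that
  -- of the logical gate. This is why blocks have odd length `2κ + 1`.
  have hr : rt ^ (2 * κ + 1) * 2 ^ κ = rt := by
    rw [pow_succ, pow_mul, pow_two, rt_mul_rt, mul_right_comm, ← mul_pow]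
    norm_num
  have h1 : ∑ u : Block κ, sgn (∑ a, c a * u a) * k.stdAmp q w b u =
      (1 / (Real.sqrt (2 ^ κ) : ℂ)) * (sgn (dotProduct c (q.1 w)) *
        sgn (b * dotProduct k.Δ (c - q.2 w))) *
        ∑ s : Block κ, (if s ∈ k.S then sgn (dotProduct (c - q.2 w) s) else 0) := by
    rw [Finset.mul_sum]
    symm
    refine Fintype.sum_equiv (Equiv.addRight (q.1 w + b • k.Δ)) _ _ fun s => ?_
    have e1 : s + (q.1 w + b • k.Δ) - q.1 w = s + b • k.Δ := by abel
    have e2 : s + b • k.Δ - b • k.Δ = s := by abel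
    simp only [Equiv.coe_addRight, stdAmp, encAmp, e1, e2]
    have e3 : (∑ a, c a * (s + (q.1 w + b • k.Δ)) a) =
        dotProduct c s + (dotProduct c (q.1 w) + b * dotProduct k.Δ c) := by
      change dotProduct c (s + (q.1 w + b • k.Δ)) = _
      rw [dotProduct_add, dotProduct_add, dotProduct_smul, smul_eq_mul, dotProduct_comm c k.Δ]
    rw [e3, dotProduct_add, dotProduct_smul, smul_eq_mul, sub_dotProduct, dotProduct_sub,
      CharTwo.sub_eq_add, CharTwo.sub_eq_add, dotProduct_comm (q.2 w) k.Δ, mul_add]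
    simp only [sgn_add]
    split_ifs <;> ring
  have h2 : ∑ u : Block κ, sgn (∑ a, c a * u a) * k.stdAmp q w b u =
      (1 / (Real.sqrt (2 ^ κ) : ℂ)) * (sgn (dotProduct c (q.1 w)) *
        sgn (b * dotProduct k.Δ (c - q.2 w))) * if c - q.2 w ∈ perp k.S then 2 ^ κ else 0 := by
    rw [h1, sum_sgn_submodule, k.card_S]; push_cast; rfl
  rw [h2]
  unfold dualAmp
  by_cases hp : c - q.2 w ∈ perp k.S
  · rw [if_pos hp]
    rcases bit_cases (dotProduct k.Δ (c - q.2 w)) with hd | hd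
    · simp only [hd, hp, true_and, mul_zero, mul_one, sgn_zero, if_true, zero_ne_one,
        if_false, add_zero]
      linear_combination ((1 / (Real.sqrt (2 ^ κ) : ℂ)) * sgn (dotProduct c (q.1 w))) * hr
    · simp only [hd, hp, true_and, mul_zero, mul_one, if_true, one_ne_zero, if_false, zero_add]
      linear_combination ((1 / (Real.sqrt (2 ^ κ) : ℂ)) * sgn (dotProduct c (q.1 w)) * sgn b) * hr
  · simp [hp]

end QASKey

/-! ### Transversal linear operations -/

lemma runGates_transversal {ν β : Type} [Fintype ν] [DecidableEq ν] [Fintype β] [DecidableEq β]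
    (i j : ν) (h : i ≠ j) (h' : ∀ a : β, (i, a) ≠ (j, a)) (l : List β) (hl : l.Nodup)
    (φ : QState (ν × β)) (s : ν × β → Bit) :
    runGates (l.map fun a => Gate.cnot (i, a) (j, a) (h' a)) φ s =
      φ (fun p => if p.1 = j ∧ p.2 ∈ l then s p + s (i, p.2) else s p) := by
  induction l generalizing φ with
  | nil => simp
  | cons a l ih =>
    obtain ⟨ha, hl⟩ := List.nodup_cons.mp hl
    rw [List.map_cons, runGates_cons, ih hl, cnot_apply]
    congr 1
    funext ⟨w, b⟩
    by_cases hw : w = j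
    · subst hw
      by_cases hb : b = a
      · subst hb
        simp [ha, h]
      · rw [Function.update_of_ne (by simp [hb])]
        simp [hb]
    · rw [Function.update_of_ne (by simp [hw])]
      simp [hw]

/-- The update of the Pauli exponents by one CNOT gate. -/
def pauliStep {κ n : ℕ} (q : QASKey.Pauli κ n) (c : CnotPair n) : QASKey.Pauli κ n :=
  (Function.update q.1 c.1.2 (q.1 c.1.2 + q.1 c.1.1),
    Function.update q.2 c.1.1 (q.2 c.1.1 + q.2 c.1.2))

namespace QASKey

variable {κ n : ℕ} (k : QASKey κ n)

lemma update_eq (L : LinOp n) : k.update L = L.foldl pauliStep (k.x, k.z) := rfl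

lemma encAmp_add {b b' : Bit} {u u' : Block κ} (h : k.encAmp b u ≠ 0) :
    k.encAmp (b' + b) (u' + u) = k.encAmp b' u' := by
  classical
  have hc : u - b • k.Δ ∈ k.S := by
    by_contra hc
    exact h (by simp [encAmp, hc])
  have e : u' + u - (b' + b) • k.Δ = (u' - b' • k.Δ) + (u - b • k.Δ) := by
    rw [add_smul]; abel
  unfold encAmp
  rw [e]
  simp only [Submodule.add_mem_iff_left k.S hc]

lemma prod_stdAmp (q : Pauli κ n) (b : Fin n → Bit) (c : Fin n → Block κ) :
    ∏ w, k.stdAmp q w (b w) (c w) = sgn (∑ w, dotProduct (q.2 w) (c w - q.1 w)) *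
      ∏ w, k.encAmp (b w) (c w - q.1 w) := by
  simp only [stdAmp]
  rw [Finset.prod_mul_distrib, sgn_sum]

/-- Adding the control block to the target block moves cosets as the logical CNOT does, and the
changes of the signs at control and target are both `z_j · (c_i - x_i)`, hence cancel. -/
lemma prod_stdAmp_cnot (q : Pauli κ n) (p : CnotPair n) (b : Fin n → Bit) (c : Fin n → Block κ) :
    ∏ w, k.stdAmp q w (Function.update b p.1.2 (b p.1.2 + b p.1.1) w)
        (Function.update c p.1.2 (c p.1.2 + c p.1.1) w) =
      ∏ w, k.stdAmp (pauliStep q p) w (b w) (c w) := by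
  obtain ⟨⟨i, j⟩, hij⟩ := p
  replace hij : i ≠ j := hij
  simp only
  rw [prod_stdAmp, prod_stdAmp]
  simp only [pauliStep]
  have hbs : ∀ u v : Block κ, u - v = u + v := fun u v => CharTwo.sub_eq_add u v
  have hself : ∀ u : Block κ, u + u = 0 := fun u => CharTwo.add_self_eq_zero u
  -- If the control block is outside its coset, both products vanish; otherwise it is a codeword
  -- whose addition shifts the target by `b i • Δ` modulo `S`.
  by_cases h0 : k.encAmp (b i) (c i - q.1 i) = 0
  · rw [Finset.prod_eq_zero (Finset.mem_univ i), Finset.prod_eq_zero (Finset.mem_univ i)]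
    · simp
    · simpa [hij] using h0
    · simpa [hij] using h0
  · congr 1
    · congr 1
      have h1 : ∀ w, dotProduct (q.2 w) (Function.update c j (c j + c i) w - q.1 w) =
          dotProduct (Function.update q.2 i (q.2 i + q.2 j) w)
            (c w - Function.update q.1 j (q.1 j + q.1 i) w) +
          ((if w = i then dotProduct (q.2 j) (c i - q.1 i) else 0) +
            (if w = j then dotProduct (q.2 j) (c i - q.1 i) else 0)) := by
        intro w
        by_cases hi : w = i
        · subst hi
          simp only [Function.update_self, Function.update_of_ne hij, if_true, if_neg hij,
            add_zero, add_dotProduct]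
          rw [add_assoc, bit_add_self, add_zero]
        · by_cases hj : w = j
          · subst hj
            simp only [Function.update_self, Function.update_of_ne hi, if_true, if_neg hi,
              zero_add]
            rw [← dotProduct_add]
            congr 1
            simp only [hbs]
            have : c w + (q.1 w + q.1 i) + (c i + q.1 i) = c w + c i + q.1 w + (q.1 i + q.1 i) := by
              abel
            rw [this, hself, add_zero]
          · simp [hi, hj]
      simp only [h1]
      rw [Finset.sum_add_distrib, Finset.sum_add_distrib]
      simp [bit_add_self]
    · refine Finset.prod_congr rfl fun w _ => ?_
      by_cases hj : w = j
      · subst hj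
        simp only [Function.update_self]
        have e : c w + c i - q.1 w = (c w - (q.1 w + q.1 i)) + (c i - q.1 i) := by
          simp only [hbs]
          have : c w + (q.1 w + q.1 i) + (c i + q.1 i) = c w + c i + q.1 w + (q.1 i + q.1 i) := by
            abel
          rw [this, hself, add_zero]
        rw [e, k.encAmp_add h0]
      · simp [hj]

lemma cnot_encPauli (q : Pauli κ n) (c : CnotPair n) (ψ : QState (Fin n)) :
    runGates ((List.finRange (2 * κ + 1)).map fun a =>
      Gate.cnot (c.1.1, a) (c.1.2, a) (fun h => c.2 (Prod.ext_iff.mp h).1)) (k.encPauli q ψ) =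
      k.encPauli (pauliStep q c) ((Gate.cnot c.1.1 c.1.2 c.2).apply ψ) := by
  funext s
  rw [runGates_transversal _ _ c.2 _ _ (List.nodup_finRange _)]
  simp only [encPauli, encWith, List.mem_finRange, and_true, cnot_apply]
  refine Fintype.sum_bijective
    (fun b : Fin n → Bit => Function.update b c.1.2 (b c.1.2 + b c.1.1))
    (Function.Involutive.bijective fun b => ?_) _ _ fun b => ?_
  · simp [Function.update_of_ne c.2, add_assoc, bit_add_self]
  · have hb : Function.update (Function.update b c.1.2 (b c.1.2 + b c.1.1)) c.1.2
        (Function.update b c.1.2 (b c.1.2 + b c.1.1) c.1.2 +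
          Function.update b c.1.2 (b c.1.2 + b c.1.1) c.1.1) = b := by
      simp [Function.update_of_ne c.2, add_assoc, bit_add_self]
    rw [hb]
    congr 1
    have h := k.prod_stdAmp_cnot q c (Function.update b c.1.2 (b c.1.2 + b c.1.1))
      (fun w a => s (w, a))
    rw [hb] at h
    rw [← h]
    refine Finset.prod_congr rfl fun w _ => ?_
    congr 1
    funext a
    by_cases hw : w = c.1.2
    · subst hw; simp
    · simp [hw]

lemma linEval_encPauli (q : Pauli κ n) (L : LinOp n) (ψ : QState (Fin n)) :
    runGates (linEvalGates κ L) (k.encPauli q ψ) =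
      k.encPauli (L.foldl pauliStep q) (runGates L.gates ψ) := by
  induction L generalizing q ψ with
  | nil => rfl
  | cons c L ih =>
    have h : linEvalGates κ (c :: L) = ((List.finRange (2 * κ + 1)).map fun a =>
      Gate.cnot (c.1.1, a) (c.1.2, a) (fun h => c.2 (Prod.ext_iff.mp h).1)) ++
        linEvalGates κ L := rfl
    rw [h, runGates_append, cnot_encPauli, ih]
    rfl

end QASKey

/-! ### Measurements of encoded states -/

lemma Bases.nodup_hadWires {n : ℕ} (θ : Bases n) : θ.hadWires.Nodup :=
  (List.nodup_finRange n).filter _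

lemma Bases.mem_hadWires {n : ℕ} (θ : Bases n) (w : Fin n) : w ∈ θ.hadWires ↔ θ w = some 1 := by
  simp [Bases.hadWires]

lemma Bases.mem_Phi {n : ℕ} (θ : Bases n) (w : Fin n) : w ∈ θ.Phi ↔ θ w ≠ none := by
  simp [Bases.Phi]

/-- The wires of the blocks in the Hadamard basis. -/
def encHadWires {n : ℕ} (κ : ℕ) (θ : Bases n) : List (Fin n × Fin (2 * κ + 1)) :=
  θ.hadWires.flatMap fun w => (List.finRange (2 * κ + 1)).map fun a => (w, a)

lemma encHadGates_eq {n : ℕ} (κ : ℕ) (θ : Bases n) :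
    encHadGates κ θ = (encHadWires κ θ).map Gate.had := by
  simp [encHadGates, encHadWires, List.map_flatMap, Function.comp_def]

lemma nodup_encHadWires {n : ℕ} (κ : ℕ) (θ : Bases n) : (encHadWires κ θ).Nodup := by
  have : encHadWires κ θ = θ.hadWires.product (List.finRange (2 * κ + 1)) := rfl
  rw [this]
  exact θ.nodup_hadWires.product (List.nodup_finRange _)

lemma mem_encHadWires {n : ℕ} (κ : ℕ) (θ : Bases n) (p : Fin n × Fin (2 * κ + 1)) :
    p ∈ encHadWires κ θ ↔ θ p.1 = some 1 := by
  rw [← θ.mem_hadWires]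
  obtain ⟨w, a⟩ := p
  simp [encHadWires]

namespace QASKey

variable {κ n : ℕ} (k : QASKey κ n)

/-- The encoding in the measured bases. -/
def encBases (q : Pauli κ n) (θ : Bases n) (ψ : QState (Fin n)) :
    QState (Fin n × Fin (2 * κ + 1)) :=
  encWith (fun w => if w ∈ θ.hadWires then k.dualAmp q w else k.stdAmp q w) ψ

lemma hadList_encPauli (q : Pauli κ n) (θ : Bases n) (ψ : QState (Fin n)) :
    hadList (encHadWires κ θ) (k.encPauli q ψ) = k.encBases q θ (hadList θ.hadWires ψ) :=
  hadList_blocks_encWith _ θ.nodup_hadWires _ _ _ (fun w _ => k.hadDual q w) ψ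

lemma hadList_encBases (q : Pauli κ n) (θ : Bases n) (ψ : QState (Fin n)) :
    hadList (encHadWires κ θ) (k.encBases q θ ψ) = k.encPauli q (hadList θ.hadWires ψ) := by
  rw [← hadList_hadList (encHadWires κ θ) (k.encPauli q _), hadList_encPauli, hadList_hadList]

/-- Decoding of the block of wire `w` in the measured basis. -/
def decBasis (q : Pauli κ n) (θ : Bases n) (w : Fin n) (c : Block κ) : Option Bit :=
  if w ∈ θ.hadWires then k.decX (c - q.2 w) else k.decZ (c - q.1 w)

lemma decBasis_of_amp (q : Pauli κ n) (θ : Bases n) (w : Fin n) (b : Bit) (c : Block κ)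
    (h : (if w ∈ θ.hadWires then k.dualAmp q w else k.stdAmp q w) b c ≠ 0) :
    k.decBasis q θ w c = some b := by
  unfold decBasis
  by_cases hw : w ∈ θ.hadWires
  · rw [if_pos hw] at h ⊢
    exact k.decX_of_dualAmp h
  · rw [if_neg hw] at h ⊢
    exact k.decZ_of_encAmp (right_ne_zero_of_mul h)

lemma dec_of_decBasis (L : LinOp n) (θ : Bases n) (c : Fin n × Fin (2 * κ + 1) → Bit)
    (b : Fin n → Bit) (h : ∀ w, k.decBasis (k.update L) θ w (fun a => c (w, a)) = some (b w)) :
    k.dec L θ (fun w a => c (w.1, a)) = some fun w => b w.1 := by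
  have h1 : ∀ w : {w // w ∈ θ.Phi},
      k.decWire L θ w.1 (fun a => c (w.1, a)) = some (b w.1) := by
    intro w
    rw [← h w.1, decWire, decBasis]
    have hw := (θ.mem_Phi w.1).mp w.2
    rcases hb : θ w.1 with _ | v
    · exact absurd hb hw
    · rcases bit_cases v with rfl | rfl
      · have : w.1 ∉ θ.hadWires := by rw [θ.mem_hadWires, hb]; decide
        rw [if_pos rfl, if_neg this]
      · have : w.1 ∈ θ.hadWires := by rw [θ.mem_hadWires, hb]
        rw [if_neg (by decide), if_pos this]
  unfold dec
  rw [dif_pos (fun w => by rw [h1 w]; rfl)]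
  simp only [h1, Option.get_some]

lemma project_encBases (L : LinOp n) (θ : Bases n) (P : ({w // w ∈ θ.Phi} → Bit) → Prop)
    (ψ : QState (Fin n)) :
    project (fun c => ∃ s, k.dec L θ (fun w a => c (w.1, a)) = some s ∧ P s)
      (k.encBases (k.update L) θ ψ) =
      k.encBases (k.update L) θ (project (fun s => P fun w => s w.1) ψ) := by
  refine project_encWith (k.decBasis_of_amp _ θ) (fun c b hb => ?_) ψ
  rw [k.dec_of_decBasis L θ c b hb]
  simp

lemma weight_encPauli (q : Pauli κ n) (ψ : QState (Fin n)) :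
    weight (k.encPauli q ψ) = weight ψ :=
  weight_encWith (dec := fun w c => k.decZ (c - q.1 w))
    (fun _ _ _ h => k.decZ_of_encAmp (right_ne_zero_of_mul h)) (k.weight_stdAmp q) ψ

lemma weight_encBases (q : Pauli κ n) (θ : Bases n) (ψ : QState (Fin n)) :
    weight (k.encBases q θ ψ) = weight ψ := by
  rw [← weight_hadList (encHadWires κ θ), hadList_encBases, weight_encPauli, weight_hadList]

/-- One encoded layer is the encoding of the plain layer. Here `L₀` collects the linear operations
of the earlier layers, which fix the current Pauli exponents. -/
lemma measureStep_encPauli (L₀ L : LinOp n) (θ : Bases n) (P : ({w // w ∈ θ.Phi} → Bit) → Prop)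
    (ψ : QState (Fin n)) :
    measureStep (linEvalGates κ L) (encHadWires κ θ)
      (fun c => ∃ s, k.dec (L₀ ++ L) θ (fun w a => c (w.1, a)) = some s ∧ P s)
      (k.encPauli (k.update L₀) ψ) =
      k.encPauli (k.update (L₀ ++ L))
        (measureStep L.gates θ.hadWires (fun s => P fun w => s w.1) ψ) := by
  have h : L.foldl pauliStep (k.update L₀) = k.update (L₀ ++ L) := by
    rw [update_eq, update_eq, List.foldl_append]
  rw [measureStep, linEval_encPauli, h, hadList_encPauli, project_encBases, hadList_encBases]
  rfl

end QASKey

/-! ### Deferring the collapsed strings of an LM program to its end. -/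

lemma filter_lt_range {N i : ℕ} (h : i ≤ N) :
    (List.range N).filter (fun j => decide (j < i)) = List.range i := by
  induction N, h using Nat.le_induction with
  | base => exact List.filter_eq_self.mpr fun j hj => by simpa using hj
  | succ N hN ih =>
    rw [List.range_succ, List.filter_append, ih]
    simp [hN]

lemma filter_lt_succ_finRange {N : ℕ} (i : Fin N) :
    (List.finRange N).filter (fun j => decide (j.val < i.val + 1)) =
      (List.finRange N).filter (fun j => decide (j.val < i.val)) ++ [i] := by
  have hmap : ∀ k, k ≤ N →
      ((List.finRange N).filter (fun j => decide (j.val < k))).map Fin.val = List.range k := by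
    intro k hk
    have := List.filter_map (f := (Fin.val : Fin N → ℕ)) (p := fun j => decide (j < k))
      (l := List.finRange N)
    rw [List.map_coe_finRange_eq_range, filter_lt_range hk] at this
    rw [this]; rfl
  refine List.map_injective_iff.mpr Fin.val_injective ?_
  rw [List.map_append, hmap _ i.isLt, hmap _ i.isLt.le, List.range_succ]
  rfl

/-- The outcomes of a complete measurement have probabilities that add up; this removes deferred
collapses. -/
lemma sum_weight_project {ι : Type} [Fintype ι] [DecidableEq ι] {V : Type*} [Fintype V]
    (F : (ι → Bit) → V) (ψ : QState ι) :
    ∑ v, weight (project (fun s => F s = v) ψ) = weight ψ := by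
  classical
  unfold weight
  rw [Finset.sum_comm]
  refine Finset.sum_congr rfl fun s _ => ?_
  rw [Finset.sum_eq_single (F s)]
  · simp [project_apply]
  · intro v _ hv
    simp [project_apply, hv.symm]
  · simp

namespace LMPublic

variable {n m m' t : ℕ} (P : LMPublic n m m' t)

/-- The wires collapsed before layer `i`. -/
def below (i : ℕ) : Set (Fin n) := {w | ∃ j : Fin (t + 1), j.val < i ∧ w ∈ P.V j}

lemma mem_below_succ (i : Fin (t + 1)) (w : Fin n) :
    w ∈ P.below (i + 1) ↔ w ∈ P.below i ∨ w ∈ P.V i := by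
  constructor
  · rintro ⟨j, hj, hw⟩
    rcases Nat.lt_succ_iff_lt_or_eq.mp hj with h | h
    · exact Or.inl ⟨j, h, hw⟩
    · rw [Fin.ext h] at hw; exact Or.inr hw
  · rintro (⟨j, hj, hw⟩ | hw)
    · exact ⟨j, hj.trans (Nat.lt_succ_self _), hw⟩
    · exact ⟨i, Nat.lt_succ_self _, hw⟩

/-- The strings collapsed in the layers, as one string of all wires. -/
def join {α : Type} [Zero α] (v : (i : Fin t) → {w // w ∈ P.V i.castSucc} → α) (w : Fin n) : α :=
  open Classical in
  if h : ∃ i : Fin t, w ∈ P.V i.castSucc then v h.choose ⟨w, h.choose_spec⟩ else 0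

lemma join_apply {α : Type} [Zero α] (v : (i : Fin t) → {w // w ∈ P.V i.castSucc} → α)
    (i : Fin t) (w : Fin n) (hw : w ∈ P.V i.castSucc) : P.join v w = v i ⟨w, hw⟩ := by
  have h : ∃ i : Fin t, w ∈ P.V i.castSucc := ⟨i, hw⟩
  have key : ∀ (j : Fin t) (hj : w ∈ P.V j.castSucc), v j ⟨w, hj⟩ = v i ⟨w, hw⟩ := by
    intro j hj
    have : j = i := by
      by_contra hne
      have hd := P.V_disjoint j.castSucc i.castSucc (fun h => hne (Fin.castSucc_injective _ h))
      exact Finset.disjoint_left.mp hd hj hw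
    subst this; rfl
  unfold join
  rw [dif_pos h]
  exact key _ _

lemma eq_join_iff {α : Type} [Zero α] (v : (i : Fin t) → {w // w ∈ P.V i.castSucc} → α)
    (S : Fin n → α) :
    (∀ w ∈ P.below t, S w = P.join v w) ↔
      (fun (i : Fin t) (w : {w // w ∈ P.V i.castSucc}) => S w.1) = v := by
  constructor
  · intro h
    funext i w
    rw [h w.1 ⟨i.castSucc, i.isLt, w.2⟩, P.join_apply v i w.1 w.2]
  · rintro rfl w ⟨j, hj, hw⟩
    rw [P.join_apply _ ⟨j, hj⟩ w hw]

lemma eq_join_succ_iff {α : Type} [Zero α] (v : (i : Fin t) → {w // w ∈ P.V i.castSucc} → α)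
    (i : Fin t) (S : Fin n → α) (hS : ∀ w ∈ P.below i, S w = P.join v w) :
    (∀ w : {w // w ∈ P.V i.castSucc}, S w.1 = v i w) ↔
      ∀ w ∈ P.below (i + 1), S w = P.join v w := by
  constructor
  · intro h w hw
    rcases (P.mem_below_succ i.castSucc w).mp hw with hw | hw
    · exact hS w hw
    · rw [P.join_apply v i w hw]; exact h ⟨w, hw⟩
  · intro h w
    rw [h w.1 ((P.mem_below_succ i.castSucc w.1).mpr (Or.inr w.2)), P.join_apply v i w.1 w.2]

lemma below_basis (i : Fin (t + 1)) {w : Fin n} (hw : w ∈ P.below (i + 1)) :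
    P.θ i w = P.θ (Fin.last t) w := by
  obtain ⟨j, hj, hw⟩ := hw
  rw [P.θ_stable i j (Nat.lt_succ_iff.mp hj) w hw,
    P.θ_stable (Fin.last t) j (Fin.le_last j) w hw]

lemma below_subset_Phi (i : Fin (t + 1)) {w : Fin n} (hw : w ∈ P.below (i + 1)) :
    w ∈ (P.θ i).Phi := by
  obtain ⟨j, hj, hw⟩ := hw
  exact P.V_subset i j (Nat.lt_succ_iff.mp hj) hw

lemma below_mono {i j : ℕ} (h : i ≤ j) : P.below i ⊆ P.below j :=
  fun _ ⟨a, ha, hw⟩ => ⟨a, lt_of_lt_of_le ha h, hw⟩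

lemma gates_avoid (i : Fin (t + 1)) : ∀ g ∈ (P.L i).gates, g.Avoids (P.below i) := by
  intro g hg
  obtain ⟨c, hc, rfl⟩ := List.mem_map.mp hg
  exact ⟨fun ⟨j, hj, hw⟩ => (P.L_fresh i j hj c hc).1 hw,
    fun ⟨j, hj, hw⟩ => (P.L_fresh i j hj c hc).2 hw⟩

lemma layer_eq (x : BitStr m) (r : BitStr t) (v : (i : Fin t) → {w // w ∈ P.V i.castSucc} → Bit)
    (ψ : QState (Fin n)) (i : Fin t) :
    P.layer x r v ψ i = measureStep (P.L i.castSucc).gates (P.θ i.castSucc).hadWires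
      (fun s => (∀ w : {w // w ∈ P.V i.castSucc}, s w.1 = v i w) ∧
        P.f i x (fun j => r (Fin.castLE i.isLt.le j)) (fun w => s w.1) = r i) ψ := by
  unfold layer
  rw [runGates_append]
  rfl

/-- The layers followed by the last linear operation and basis change, when the bits `r_i` are
replaced by residual conditions `p i`. -/
def residual (p : Fin t → (Fin n → Bit) → Prop) (ψ : QState (Fin n)) : QState (Fin n) :=
  (List.finRange t).foldl (fun φ i =>
    measureStep (P.L i.castSucc).gates (P.θ i.castSucc).hadWires (p i) φ) ψ

/-- The last linear operation and basis change. -/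
def finish (ψ : QState (Fin n)) : QState (Fin n) :=
  hadList (P.θ (Fin.last t)).hadWires (runGates (P.L (Fin.last t)).gates ψ)

/-- All collapses onto `v` are moved behind the last basis change. The residual conditions `p` only
have to agree with the true ones on strings that match `v`; this freedom allows the collapsed wires
to be replaced by their final values. -/
lemma foldl_layer (x : BitStr m) (r : BitStr t)
    (v : (i : Fin t) → {w // w ∈ P.V i.castSucc} → Bit) (p : Fin t → (Fin n → Bit) → Prop)
    (hp : ∀ (i : Fin t) (s : Fin n → Bit), Agree (P.below (i + 1)) (P.join v) s →
      (P.f i x (fun j => r (Fin.castLE i.isLt.le j)) (fun w => s w.1) = r i ↔ p i s))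
    (ψ : QState (Fin n)) :
    P.finish ((List.finRange t).foldl (P.layer x r v) ψ) =
      project (Agree (P.below t) (P.join v)) (P.finish (P.residual p ψ)) := by
  have h := foldl_finRange_rel (P.layer x r v)
    (fun φ i => measureStep (P.L i.castSucc).gates (P.θ i.castSucc).hadWires (p i) φ)
    (fun i φ χ => φ = collapse (P.below i) (P.θ (Fin.last t)).hadWires (P.join v) χ) ψ ψ ?_ ?_
  · rw [h, finish, runGates_collapse (P.below t) _ _ _ (P.gates_avoid (Fin.last t)), hadList_collapse]
    rfl
  · have : P.below 0 = ∅ := by ext w; simp [below]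
    simp only [this, collapse_empty]
  · rintro i φ χ rfl
    rw [layer_eq]
    refine measureStep_collapse (P.below_mono (Nat.le_succ _)) (Bases.nodup_hadWires _)
      (Bases.nodup_hadWires _) (fun w hw => ?_) (P.gates_avoid i.castSucc) (fun s hs => ?_) χ
    · rw [Bases.mem_hadWires, Bases.mem_hadWires, P.below_basis i.castSucc hw]
    · rw [P.eq_join_succ_iff v i s hs]
      exact and_congr_right fun h => hp i s h

/-- The condition that the bit of layer `i` is `r_i`. -/
def bitCond (x : BitStr m) (r : BitStr t) (i : Fin t) (s : {w // w ∈ (P.θ i.castSucc).Phi} → Bit) :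
    Prop :=
  P.f i x (fun j => r (Fin.castLE i.isLt.le j)) s = r i

/-- The state before the last measurement, when only the bits `r_i` have been measured. -/
def coherent (x : BitStr m) (r : BitStr t) (ψ : QState (Fin n)) : QState (Fin n) :=
  P.residual (fun i s => P.bitCond x r i fun w => s w.1) ψ

/-- Once the strings `v` are read at the very end, summing over them loses nothing; only the bits
`r_i` disturb the state. -/
lemma evalProb_eq (ψ : QState (Fin n)) (x : BitStr m) (y : BitStr m') :
    P.evalProb ψ x y = ∑ r : BitStr t,
      weight (project (fun s => P.g x r (fun w => s w.1) = y) (P.finish (P.coherent x r ψ))) := by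
  unfold evalProb
  refine Finset.sum_congr rfl fun r _ => ?_
  rw [← sum_weight_project (fun s (i : Fin t) (w : {w // w ∈ P.V i.castSucc}) => s w.1)
    (project _ (P.finish _))]
  refine Finset.sum_congr rfl fun v _ => ?_
  rw [runGates_append]
  have h := P.foldl_layer x r v (fun i s => P.bitCond x r i fun w => s w.1)
    (fun i s _ => Iff.rfl) ψ
  have h' : ∀ φ, runGates (P.θ (Fin.last t)).hadGates (runGates (P.L (Fin.last t)).gates φ) =
      P.finish φ := fun _ => rfl
  rw [h', h, project_project, project_project]
  congr 1
  refine project_congr (fun s => ?_) _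
  rw [and_comm]
  exact and_congr_left fun _ => P.eq_join_iff v s

/-- The linear operations of the layers before `i`. -/
def cumBelow (i : ℕ) : LinOp n :=
  ((List.finRange (t + 1)).filter fun j => decide (j.val < i)).flatMap P.L

lemma cumBelow_succ (i : Fin (t + 1)) : P.cumBelow (i + 1) = P.cumBelow i ++ P.L i := by
  unfold cumBelow
  rw [filter_lt_succ_finRange, List.flatMap_append]
  simp

lemma cumL_eq (i : Fin (t + 1)) : P.cumL i = P.cumBelow i ++ P.L i := by
  rw [← cumBelow_succ]
  unfold cumL cumBelow
  congr 2
  funext j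
  rw [decide_eq_decide]
  exact Nat.lt_succ_iff.symm

end LMPublic

/-! ### Labels -/

section Labels

variable {n m m' t : ℕ} (P : LMPublic n m m' t) {κ sl : ℕ}

lemma hashInput_congr (x : BitStr m) (σ : Fin m → BitStr sl) {c c' : Fin n → Block κ} (i : ℕ)
    (h : ∀ w ∈ P.below (i + 1), c w = c' w) (ℓ : Fin i → BitStr κ) (b : Bit) :
    hashInput P x σ c i ℓ b = hashInput P x σ c' i ℓ b := by
  unfold hashInput
  congr 3
  refine List.flatMap_congr fun j hj => List.flatMap_congr fun w hw => ?_
  have hj' : j.val ≤ i := by simpa using (List.mem_filter.mp hj).2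
  rw [h w ⟨j, Nat.lt_succ_of_le hj', (Finset.mem_sort _).mp hw⟩]

/-- The labels of the bits `r`. -/
def labels (hash : List Bit → BitStr κ) (x : BitStr m) (σ : Fin m → BitStr sl)
    (c : Fin n → Block κ) (r : BitStr t) : (i : ℕ) → Fin i → BitStr κ
  | 0 => Fin.elim0
  | i + 1 => Fin.snoc (α := fun _ => BitStr κ) (labels hash x σ c r i)
      (hash (hashInput P x σ c i (labels hash x σ c r i) (if h : i < t then r ⟨i, h⟩ else 0)))

/-- The two candidates for the label of layer `i` differ. -/
def Separated (hash : List Bit → BitStr κ) (x : BitStr m) (σ : Fin m → BitStr sl)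
    (c : Fin n → Block κ) (r : BitStr t) (i : ℕ) : Prop :=
  hash (hashInput P x σ c i (labels P hash x σ c r i) 0) ≠
    hash (hashInput P x σ c i (labels P hash x σ c r i) 1)

variable (hash : List Bit → BitStr κ) (x : BitStr m) (σ : Fin m → BitStr sl)
  (c : Fin n → Block κ) (r : BitStr t)

lemma labels_castLE {i j : ℕ} (h : i ≤ j) (a : Fin i) :
    labels P hash x σ c r j (Fin.castLE h a) = labels P hash x σ c r i a := by
  induction j, h using Nat.le_induction with
  | base => rfl
  | succ j hj ih =>
    rw [← ih]
    exact Fin.snoc_castSucc (α := fun _ => BitStr κ) _ _ (Fin.castLE hj a)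

lemma labels_at (i : Fin t) :
    labels P hash x σ c r t i = hash (hashInput P x σ c i (labels P hash x σ c r i) (r i)) := by
  have h : i = Fin.castLE (Nat.succ_le_of_lt i.isLt) (Fin.last i.val) := rfl
  conv_lhs => rw [h]
  rw [labels_castLE]
  refine (Fin.snoc_last (α := fun _ => BitStr κ) _ _).trans ?_
  rw [dif_pos i.isLt]

lemma Separated.eq_iff {hash : List Bit → BitStr κ} {x : BitStr m} {σ : Fin m → BitStr sl}
    {c : Fin n → Block κ} {r : BitStr t} {i : ℕ} (h : Separated P hash x σ c r i) (b b' : Bit) :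
    hash (hashInput P x σ c i (labels P hash x σ c r i) b) =
      hash (hashInput P x σ c i (labels P hash x σ c r i) b') ↔ b = b' := by
  constructor
  · intro e
    by_contra hne
    rcases bit_cases b with rfl | rfl <;> rcases bit_cases b' with rfl | rfl
    · exact hne rfl
    · exact h e
    · exact h e.symm
    · exact hne rfl
  · rintro rfl; rfl

/-- Reading a label inverts its formation exactly because the two candidates differ. The oracle sees
`c'`, which need only agree with `c` on the blocks hashed so far. -/
lemma readLabels_eq {hash : List Bit → BitStr κ} {x : BitStr m} {σ : Fin m → BitStr sl}
    {c : Fin n → Block κ} {r : BitStr t} (h : ∀ i < t, Separated P hash x σ c r i)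
    {c' : Fin n → Block κ} {i : ℕ} (hi : i ≤ t) (hc : ∀ w ∈ P.below i, c' w = c w) :
    readLabels P hash x σ c' i (labels P hash x σ c r i) =
      some fun j => r (Fin.castLE hi j) := by
  classical
  have hcand : ∀ (j : Fin i) (b : Bit),
      hash (hashInput P x σ c' j (fun a => labels P hash x σ c r i (Fin.castLE j.isLt.le a)) b) =
        hash (hashInput P x σ c j (labels P hash x σ c r j) b) := by
    intro j b
    have : (fun a => labels P hash x σ c r i (Fin.castLE j.isLt.le a)) =
        labels P hash x σ c r j := funext fun a => labels_castLE P hash x σ c r _ a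
    rw [this, hashInput_congr P x σ j fun w hw => hc w (P.below_mono (Nat.succ_le_of_lt j.isLt) hw)]
  have hlab : ∀ j : Fin i, labels P hash x σ c r i j =
      hash (hashInput P x σ c j (labels P hash x σ c r j) (r (Fin.castLE hi j))) := by
    intro j
    rw [← labels_castLE P hash x σ c r hi, labels_at]
    rfl
  have hs : ∀ j : Fin i, Separated P hash x σ c r j := fun j => h j (j.isLt.trans_le hi)
  simp only [readLabels, hcand]
  simp only [hlab, (hs _).eq_iff]
  rw [if_pos]
  · congr 1
    funext j
    rcases bit_cases (r (Fin.castLE hi j)) with e | e <;> rw [e] <;> simp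
  · intro j
    exact ⟨hs j, bit_cases _⟩

lemma labels_injective {hash : List Bit → BitStr κ} {x : BitStr m} {σ : Fin m → BitStr sl}
    {c : Fin n → Block κ} {r r' : BitStr t} (h : ∀ i < t, Separated P hash x σ c r i)
    (h' : ∀ i < t, Separated P hash x σ c r' i)
    (e : labels P hash x σ c r t = labels P hash x σ c r' t) : r = r' := by
  have h1 := readLabels_eq P h (c' := c) le_rfl (fun _ _ => rfl)
  have h2 := readLabels_eq P h' (c' := c) le_rfl (fun _ _ => rfl)
  rw [e, h2] at h1
  exact (Option.some.inj h1).symm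

end Labels

/-! ### Evaluation of the obfuscated program -/

section Evaluation

variable {n m m' t : ℕ} (P : LMPublic n m m' t)

lemma foldl_map_gate {tok : TokenScheme} {κ : ℕ} (ob : Obfuscated tok κ P)
    (x : BitStr m) (σ : Fin m → BitStr (tok.sigLen κ))
    (ℓ : Fin t → BitStr κ) (v : (i : Fin t) → {w // w ∈ P.V i.castSucc} → Block κ)
    (y : BitStr m') (gs : List (Gate (Fin n × Fin (2 * κ + 1))))
    (φ : QState (Fin n × Fin (2 * κ + 1))) :
    (gs.map Instr.gate).foldl (qevalStep ob x σ ℓ v y) φ = runGates gs φ := by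
  rw [List.foldl_map]; rfl

lemma foldl_qevalProgram {tok : TokenScheme} {κ : ℕ} (ob : Obfuscated tok κ P)
    (x : BitStr m) (σ : Fin m → BitStr (tok.sigLen κ))
    (ℓ : Fin t → BitStr κ) (v : (i : Fin t) → {w // w ∈ P.V i.castSucc} → Block κ)
    (y : BitStr m') (φ : QState (Fin n × Fin (2 * κ + 1))) :
    (qevalProgram κ P).foldl (qevalStep ob x σ ℓ v y) φ =
      project (fun s => ob.G x σ (fun w a => s (w.1, a)) ℓ = some y)
        (hadList (encHadWires κ (P.θ (Fin.last t))) (runGates (linEvalGates κ (P.L (Fin.last t)))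
          ((List.finRange t).foldl (fun φ i => measureStep (linEvalGates κ (P.L i.castSucc))
            (encHadWires κ (P.θ i.castSucc))
            (fun s => ob.F i x σ (fun w a => s (w.1, a)) (fun j => ℓ (Fin.castLE i.isLt.le j)) =
              some (v i, ℓ i)) φ) φ))) := by
  unfold qevalProgram
  rw [List.foldl_append, List.foldl_append, foldl_map_gate, runGates_append, List.foldl_flatMap]
  have h : ∀ (φ : QState (Fin n × Fin (2 * κ + 1))) (i : Fin t),
      ((linEvalGates κ (P.L i.castSucc) ++ encHadGates κ (P.θ i.castSucc)).map Instr.gate ++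
        [Instr.callF i] ++ (encHadGates κ (P.θ i.castSucc)).map Instr.gate).foldl
          (qevalStep ob x σ ℓ v y) φ = measureStep (linEvalGates κ (P.L i.castSucc))
            (encHadWires κ (P.θ i.castSucc))
            (fun s => ob.F i x σ (fun w a => s (w.1, a)) (fun j => ℓ (Fin.castLE i.isLt.le j)) =
              some (v i, ℓ i)) φ := by
    intro φ i
    rw [List.foldl_append, List.foldl_append, foldl_map_gate, foldl_map_gate, runGates_append,
      encHadGates_eq]
    rfl
  simp only [h]
  rw [encHadGates_eq]
  rfl

/-- The wires of the blocks collapsed before layer `i`. -/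
def encBelow (κ i : ℕ) : Set (Fin n × Fin (2 * κ + 1)) := {p | p.1 ∈ P.below i}

lemma agree_encBelow {κ i : ℕ} (c : Fin n → Block κ) (s : Fin n × Fin (2 * κ + 1) → Bit) :
    Agree (encBelow P κ i) (fun p => c p.1 p.2) s ↔
      ∀ w ∈ P.below i, (fun a => s (w, a)) = c w := by
  constructor
  · intro h w hw
    funext a
    exact h (w, a) hw
  · rintro h ⟨w, a⟩ hw
    exact congrFun (h w hw) a

lemma linEvalGates_avoid {κ : ℕ} (i : Fin (t + 1)) :
    ∀ g ∈ linEvalGates κ (P.L i), g.Avoids (encBelow P κ i) := by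
  intro g hg
  obtain ⟨c, hc, hg⟩ := List.mem_flatMap.mp hg
  obtain ⟨a, _, rfl⟩ := List.mem_map.mp hg
  exact ⟨fun ⟨j, hj, hw⟩ => (P.L_fresh i j hj c hc).1 hw,
    fun ⟨j, hj, hw⟩ => (P.L_fresh i j hj c hc).2 hw⟩

/-- The weight of a transcript `(r, v)` with final output `y`; it does not depend on the labels. -/
def transcriptWeight {κ : ℕ} (k : QASKey κ n) (ψ : QState (Fin n)) (x : BitStr m) (y : BitStr m')
    (r : BitStr t) (v : (i : Fin t) → {w // w ∈ P.V i.castSucc} → Block κ) : ℝ :=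
  weight (project
    (fun s => (fun (i : Fin t) (w : {w // w ∈ P.V i.castSucc}) a => s (w.1, a)) = v)
    (k.encBases (k.update (P.cumL (Fin.last t))) (P.θ (Fin.last t))
      (project (fun s => P.g x r (fun w => s w.1) = y) (P.finish (P.coherent x r ψ)))))

lemma sum_transcriptWeight {κ : ℕ} (k : QASKey κ n) (ψ : QState (Fin n)) (x : BitStr m)
    (y : BitStr m') :
    ∑ r, ∑ v, transcriptWeight P k ψ x y r v = P.evalProb ψ x y := by
  rw [P.evalProb_eq]
  refine Finset.sum_congr rfl fun r _ => ?_
  unfold transcriptWeight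
  rw [sum_weight_project, k.weight_encBases]

/-- The right-hand side mentions neither `hash` nor `σ`: given separated labels, demanding the
answer `(v i, ℓ i)` is the same as demanding the blocks `v i` and the bit `r i`. -/
lemma weight_qeval_labels {tok : TokenScheme} {κ : ℕ} (ψ : QState (Fin n)) (k : QASKey κ n)
    (vk : Fin m → BitStr (tok.vkLen κ)) (hash : List Bit → BitStr κ) (x : BitStr m)
    (σ : Fin m → BitStr (tok.sigLen κ)) (hσ : ∀ q, tok.ver κ (vk q) (x q) (σ q))
    (r : BitStr t) (v : (i : Fin t) → {w // w ∈ P.V i.castSucc} → Block κ) (y : BitStr m')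
    (hs : ∀ i < t, Separated P hash x σ (P.join v) r i) :
    weight ((qevalProgram κ P).foldl (qevalStep (qobf tok κ P ψ k vk hash) x σ
      (labels P hash x σ (P.join v) r t) v y) (k.enc ψ)) = transcriptWeight P k ψ x y r v := by
  set ℓ := labels P hash x σ (P.join v) r t with hℓ
  set V : Fin n × Fin (2 * κ + 1) → Bit := fun p => P.join v p.1 p.2 with hV
  have hlab : ∀ i : Fin t, (fun j => ℓ (Fin.castLE i.isLt.le j)) =
      labels P hash x σ (P.join v) r i := fun i => funext fun a => labels_castLE ..
  have hext : ∀ (i : Fin (t + 1)) (s : Fin n × Fin (2 * κ + 1) → Bit) (w : Fin n),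
      w ∈ P.below (i + 1) →
      extendBlocks (P.θ i).Phi (fun w a => s (w.1, a)) w = fun a => s (w, a) := by
    intro i s w hw
    rw [extendBlocks, dif_pos (P.below_subset_Phi i hw)]
  -- Relative to blocks that already agree with `v`, the oracle answer splits into the collapse of
  -- the next blocks and a residual condition on the decoded string.
  have hF : ∀ (i : Fin t) (s : Fin n × Fin (2 * κ + 1) → Bit), Agree (encBelow P κ i) V s →
      ((qobf tok κ P ψ k vk hash).F i x σ (fun w a => s (w.1, a))
        (fun j => ℓ (Fin.castLE i.isLt.le j)) = some (v i, ℓ i) ↔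
      Agree (encBelow P κ (i + 1)) V s ∧
        ∃ s', k.dec (P.cumBelow i ++ P.L i.castSucc) (P.θ i.castSucc) (fun w a => s (w.1, a)) =
          some s' ∧ P.bitCond x r i s') := by
    intro i s hag
    rw [agree_encBelow] at hag
    have hag' := fun w hw => (hext i.castSucc s w (P.below_mono (Nat.le_succ _) hw)).trans (hag w hw)
    have hcl : P.cumL i.castSucc = P.cumBelow i ++ P.L i.castSucc := P.cumL_eq i.castSucc
    rw [agree_encBelow, ← P.eq_join_succ_iff v i (fun w a => s (w, a)) hag, hlab]
    simp only [qobf, if_pos hσ, readLabels_eq P hs i.isLt.le hag', Option.bind_some, hcl,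
      Option.map_eq_some_iff, Prod.mk.injEq]
    have hv : (fun w : {w // w ∈ P.V i.castSucc} =>
        extendBlocks (P.θ i.castSucc).Phi (fun w a => s (w.1, a)) w.1) = v i ↔
        ∀ w : {w // w ∈ P.V i.castSucc}, (fun a => s (w.1, a)) = v i w := by
      rw [funext_iff]
      refine forall_congr' fun w => ?_
      rw [hext i.castSucc s w.1 ((P.mem_below_succ i.castSucc w.1).mpr (Or.inr w.2))]
    have hbit : (∀ w : {w // w ∈ P.V i.castSucc}, (fun a => s (w.1, a)) = v i w) → ∀ b,
        (hash (hashInput P x σ (extendBlocks (P.θ i.castSucc).Phi (fun w a => s (w.1, a))) i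
          (labels P hash x σ (P.join v) r i) b) = ℓ i ↔ b = r i) := by
      intro h b
      have h2 := (P.eq_join_succ_iff v i (fun w a => s (w, a)) hag).mp h
      rw [hashInput_congr P x σ i fun w hw => (hext i.castSucc s w hw).trans (h2 w hw), hℓ,
        labels_at, (hs i i.isLt).eq_iff]
    rw [hv]
    constructor
    · rintro ⟨s', hd, h1, h2⟩
      exact ⟨h1, s', hd, (hbit h1 _).mp h2⟩
    · rintro ⟨h1, s', hd, h2⟩
      exact ⟨s', hd, h1, (hbit h1 _).mpr h2⟩
  rw [foldl_qevalProgram]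
  -- Invariant: before layer `i` the register is the encoding of the plain coherent state, collapsed
  -- on the blocks of the earlier layers.
  have h := foldl_finRange_rel
    (fun φ (i : Fin t) => measureStep (linEvalGates κ (P.L i.castSucc))
      (encHadWires κ (P.θ i.castSucc))
      (fun s => (qobf tok κ P ψ k vk hash).F i x σ (fun w a => s (w.1, a))
        (fun j => ℓ (Fin.castLE i.isLt.le j)) = some (v i, ℓ i)) φ)
    (fun φ (i : Fin t) => measureStep (P.L i.castSucc).gates (P.θ i.castSucc).hadWires
      (fun s => P.bitCond x r i fun w => s w.1) φ)
    (fun i φ χ => φ = collapse (encBelow P κ i) (encHadWires κ (P.θ (Fin.last t))) V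
      (k.encPauli (k.update (P.cumBelow i)) χ)) (k.enc ψ) ψ ?_ ?_
  · have hdec : P.cumL (Fin.last t) = P.cumBelow t ++ P.L (Fin.last t) := P.cumL_eq (Fin.last t)
    have hupd : (P.L (Fin.last t)).foldl pauliStep (k.update (P.cumBelow t)) =
        k.update (P.cumL (Fin.last t)) := by
      rw [hdec, k.update_eq, k.update_eq, List.foldl_append]
    rw [h, runGates_collapse (encBelow P κ t) _ _ _ (linEvalGates_avoid P (Fin.last t)), hadList_collapse, project_project]
    have hG : ∀ s : Fin n × Fin (2 * κ + 1) → Bit,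
        ((qobf tok κ P ψ k vk hash).G x σ (fun w a => s (w.1, a)) ℓ = some y ∧
          Agree (encBelow P κ t) V s) ↔
        ((fun (i : Fin t) (w : {w // w ∈ P.V i.castSucc}) a => s (w.1, a)) = v ∧
          ∃ s', k.dec (P.cumL (Fin.last t)) (P.θ (Fin.last t)) (fun w a => s (w.1, a)) = some s' ∧
            P.g x r s' = y) := by
      intro s
      rw [agree_encBelow, P.eq_join_iff v (fun w a => s (w, a)), and_comm]
      refine and_congr_right fun hag => ?_
      rw [← P.eq_join_iff v (fun w a => s (w, a))] at hag
      have hag' := fun w hw =>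
        (hext (Fin.last t) s w (P.below_mono (Nat.le_succ _) hw)).trans (hag w hw)
      simp only [qobf, if_pos hσ, hℓ, readLabels_eq P hs le_rfl hag', Option.bind_some,
        Option.map_eq_some_iff]
      rfl
    rw [project_congr hG, ← project_project, k.linEval_encPauli, hupd, k.hadList_encPauli,
      k.project_encBases]
    rfl
  · have h0 : encBelow P κ 0 = ∅ := by
      ext p; simp [encBelow, LMPublic.below]
    have h1 : P.cumBelow 0 = [] := by simp [LMPublic.cumBelow]
    simp only [h0, h1, collapse_empty]
    exact k.enc_eq ψ
  · rintro i φ χ rfl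
    have hc : P.cumBelow (i + 1) = P.cumBelow i ++ P.L i.castSucc := P.cumBelow_succ i.castSucc
    rw [hc, ← k.measureStep_encPauli]
    refine measureStep_collapse (T := encBelow P κ i) (T' := encBelow P κ (i + 1))
      (fun p hp => P.below_mono (Nat.le_succ _) hp)
      (nodup_encHadWires _ _) (nodup_encHadWires _ _) (fun p hp => ?_)
      (linEvalGates_avoid P i.castSucc) (hF i) _
    rw [mem_encHadWires, mem_encHadWires, P.below_basis i.castSucc hp]

open Classical in
-- For fixed `v`, different separated `r` give different label strings, so the good transcripts
-- occupy distinct terms of a sum with nonnegative terms.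
lemma sum_separated_le {tok : TokenScheme} {κ : ℕ} (ψ : QState (Fin n)) (k : QASKey κ n)
    (vk : Fin m → BitStr (tok.vkLen κ)) (hash : List Bit → BitStr κ) (x : BitStr m)
    (σ : Fin m → BitStr (tok.sigLen κ)) (hσ : ∀ q, tok.ver κ (vk q) (x q) (σ q))
    (y : BitStr m') :
    ∑ r, ∑ v, (if ∀ i < t, Separated P hash x σ (P.join v) r i then
        transcriptWeight P k ψ x y r v else 0) ≤
      ∑ ℓ : (Fin t → BitStr κ), ∑ v : ((i : Fin t) → {w // w ∈ P.V i.castSucc} → Block κ),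
        weight ((qevalProgram κ P).foldl (qevalStep (qobf tok κ P ψ k vk hash) x σ ℓ v y)
          (k.enc ψ)) := by
  rw [Finset.sum_comm, Finset.sum_comm (s := (Finset.univ : Finset (Fin t → BitStr κ)))]
  refine Finset.sum_le_sum fun v _ => ?_
  rw [← Finset.sum_filter]
  have h1 : ∀ r ∈ Finset.univ.filter
      (fun r : BitStr t => ∀ i < t, Separated P hash x σ (P.join v) r i),
      transcriptWeight P k ψ x y r v = weight ((qevalProgram κ P).foldl
        (qevalStep (qobf tok κ P ψ k vk hash) x σ (labels P hash x σ (P.join v) r t) v y)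
          (k.enc ψ)) := fun r hr =>
    (weight_qeval_labels P ψ k vk hash x σ hσ r v y (Finset.mem_filter.mp hr).2).symm
  rw [Finset.sum_congr rfl h1]
  rw [← Finset.sum_image (f := fun ℓ => weight ((qevalProgram κ P).foldl
        (qevalStep (qobf tok κ P ψ k vk hash) x σ ℓ v y) (k.enc ψ)))
    (g := fun r => labels P hash x σ (P.join v) r t)]
  · exact Finset.sum_le_univ_sum_of_nonneg fun _ => weight_nonneg _
  · intro r hr r' hr' e
    exact labels_injective P (Finset.mem_filter.mp hr).2 (Finset.mem_filter.mp hr').2 e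

end Evaluation

/-! ### Averages -/

section Avg

variable {α : Type} [Fintype α]

lemma avg_mono {f g : α → ℝ} (h : ∀ a, f a ≤ g a) : avg f ≤ avg g := by
  unfold avg
  gcongr
  exact h _

lemma avg_nonneg {f : α → ℝ} (h : ∀ a, 0 ≤ f a) : 0 ≤ avg f :=
  div_nonneg (Finset.sum_nonneg fun a _ => h a) (Nat.cast_nonneg _)

lemma avg_const [Nonempty α] (c : ℝ) : avg (fun _ : α => c) = c := by
  unfold avg
  rw [Finset.sum_const, Finset.card_univ, nsmul_eq_mul, mul_div_assoc, mul_div_cancel₀]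
  exact Nat.cast_ne_zero.mpr Fintype.card_ne_zero

lemma avg_sum {β : Type*} (s : Finset β) (f : β → α → ℝ) :
    avg (fun a => ∑ b ∈ s, f b a) = ∑ b ∈ s, avg (f b) := by
  unfold avg
  rw [Finset.sum_comm, Finset.sum_div]

lemma avg_mul_left (c : ℝ) (f : α → ℝ) : avg (fun a => c * f a) = c * avg f := by
  unfold avg
  rw [← Finset.mul_sum, mul_div_assoc]

lemma avg_sub (f g : α → ℝ) : avg (fun a => f a - g a) = avg f - avg g := by
  unfold avg
  rw [Finset.sum_sub_distrib, sub_div]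

end Avg

/-! ### Tokens -/

open scoped MatrixOrder in
-- With `A = C* C`, the trace equals that of the positive semidefinite matrix `C B C*`.
lemma posSemidef_trace_mul_re_nonneg {N : Type*} [Fintype N] [DecidableEq N]
    {A B : Matrix N N ℂ} (hA : A.PosSemidef) (hB : B.PosSemidef) : 0 ≤ ((A * B).trace).re := by
  obtain ⟨C, rfl⟩ := CStarAlgebra.nonneg_iff_eq_star_mul_self.mp hA.nonneg
  rw [Matrix.star_eq_conjTranspose, Matrix.mul_assoc, Matrix.trace_mul_comm]
  exact (Complex.le_def.mp (hB.mul_mul_conjTranspose_same C).trace_nonneg).1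

namespace TokenScheme

variable (tok : TokenScheme)

lemma signProb_nonneg (κ : ℕ) (vk : BitStr (tok.vkLen κ)) (b : Bit) (σ : BitStr (tok.sigLen κ)) :
    0 ≤ tok.signProb κ (tok.sk κ vk) b σ :=
  posSemidef_trace_mul_re_nonneg (tok.sign_psd κ b σ) (tok.sk_psd κ vk)

open Classical in
-- Tokens and signatures are independent across the input bits, so the sum factors into one instance
-- of correctness per bit.
lemma sum_valid (hc : tok.Correct) (κ : ℕ) {m : ℕ} (x : BitStr m) :
    ∑ vk : Fin m → BitStr (tok.vkLen κ), (∏ q, tok.vkProb κ (vk q)) *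
      ∑ σ : Fin m → BitStr (tok.sigLen κ),
        (∏ q, tok.signProb κ (tok.sk κ (vk q)) (x q) (σ q)) *
          (if ∀ q, tok.ver κ (vk q) (x q) (σ q) then 1 else 0) = 1 := by
  have h1 : ∀ vk : Fin m → BitStr (tok.vkLen κ), (∏ q, tok.vkProb κ (vk q)) *
      ∑ σ : Fin m → BitStr (tok.sigLen κ),
        (∏ q, tok.signProb κ (tok.sk κ (vk q)) (x q) (σ q)) *
          (if ∀ q, tok.ver κ (vk q) (x q) (σ q) then 1 else 0) =
      ∏ q, (tok.vkProb κ (vk q) * ∑ σ, if tok.ver κ (vk q) (x q) σ then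
        tok.signProb κ (tok.sk κ (vk q)) (x q) σ else 0) := by
    intro vk
    rw [Finset.prod_mul_distrib]
    congr 1
    rw [Finset.prod_univ_sum, Fintype.piFinset_univ]
    refine Finset.sum_congr rfl fun σ _ => ?_
    by_cases h : ∀ q, tok.ver κ (vk q) (x q) (σ q)
    · simp [h]
    · obtain ⟨q, hq⟩ := not_forall.mp h
      rw [if_neg h, mul_zero, Finset.prod_eq_zero (Finset.mem_univ q)]
      rw [if_neg hq]
  simp only [h1]
  have h2 := Finset.prod_univ_sum (fun _ : Fin m => (Finset.univ : Finset (BitStr (tok.vkLen κ))))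
    (fun q v => tok.vkProb κ v * ∑ σ, if tok.ver κ v (x q) σ then
        tok.signProb κ (tok.sk κ v) (x q) σ else 0)
  rw [Fintype.piFinset_univ] at h2
  rw [← h2]
  exact Finset.prod_eq_one fun q _ => hc κ (x q)

end TokenScheme

/-! ### The evaluation is correct up to coinciding labels -/

section Correctness

variable {n m m' t : ℕ}

open Classical in
/-- The probability over the key of the keyed function that some two candidate labels coincide. -/
def collisionProb {K : Type} [Fintype K] {κ sl : ℕ} (P : LMPublic n m m' t)
    (F : K → List Bit → BitStr κ) (x : BitStr m) (σ : Fin m → BitStr sl) (c : Fin n → Block κ)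
    (r : BitStr t) : ℝ :=
  avg fun k' => if ∀ i < t, Separated P (F k') x σ c r i then 0 else 1

open Classical in
-- Invalid signatures and transcripts with coinciding candidates are discarded; both contribute
-- nonnegatively to the right-hand side.
lemma qevalProb_ge {tok : TokenScheme} {κ : ℕ} (P : LMPublic n m m' t) (ψ : QState (Fin n))
    (k : QASKey κ n) (vk : Fin m → BitStr (tok.vkLen κ)) (hash : List Bit → BitStr κ)
    (x : BitStr m) (y : BitStr m') :
    ∑ σ : Fin m → BitStr (tok.sigLen κ),
      ((∏ q, tok.signProb κ (tok.sk κ (vk q)) (x q) (σ q)) *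
        (if ∀ q, tok.ver κ (vk q) (x q) (σ q) then 1 else 0)) *
          ∑ r, ∑ v, transcriptWeight P k ψ x y r v *
            (1 - if ∀ i < t, Separated P hash x σ (P.join v) r i then 0 else 1) ≤
      qevalProb (qobf tok κ P ψ k vk hash) x y := by
  refine Finset.sum_le_sum fun σ _ => ?_
  have hs : 0 ≤ ∏ q, tok.signProb κ (tok.sk κ (vk q)) (x q) (σ q) :=
    Finset.prod_nonneg fun q _ => tok.signProb_nonneg κ (vk q) (x q) (σ q)
  by_cases hv : ∀ q, tok.ver κ (vk q) (x q) (σ q)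
  · rw [if_pos hv, mul_one]
    refine mul_le_mul_of_nonneg_left (le_trans (le_of_eq ?_)
      (sum_separated_le P ψ k vk hash x σ hv y)) hs
    refine Finset.sum_congr rfl fun r _ => Finset.sum_congr rfl fun v _ => ?_
    split_ifs <;> simp
  · rw [if_neg hv, mul_zero, zero_mul]
    exact mul_nonneg hs
      (Finset.sum_nonneg fun _ _ => Finset.sum_nonneg fun _ _ => weight_nonneg _)

/-- An average over an empty type would be `0`. A key exists because `κ < 2κ + 1` leaves room for
`S` and for some `Δ` outside it. -/
instance (κ n : ℕ) : Nonempty (QASKey κ n) := by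
  have hS₀ : ∃ S : Submodule Bit (Block κ), Module.finrank Bit S = κ := by
    have hf : Function.Injective (Fin.castLE (by omega : κ ≤ 2 * κ + 1)) := Fin.castLE_injective _
    refine ⟨LinearMap.range (Function.ExtendByZero.linearMap Bit
      (Fin.castLE (by omega : κ ≤ 2 * κ + 1))), ?_⟩
    rw [LinearMap.finrank_range_of_inj
      (fun a b h => Function.extend_injective hf (0 : Fin (2 * κ + 1) → Bit) h), Module.finrank_fin_fun]
  obtain ⟨S, hS⟩ := hS₀
  have h : ∃ Δ, Δ ∉ S := by
    by_contra hc
    push Not at hc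
    have : S = ⊤ := by ext v; simp [hc v]
    rw [this, finrank_top, Module.finrank_fin_fun] at hS
    omega
  obtain ⟨Δ, hΔ⟩ := h
  exact ⟨⟨⟨(S, Δ), hS, hΔ⟩, 0, 0⟩⟩

/-- The transcript weights do not involve the PRF key, so averaging over it only touches the
indicator of separated labels, for each fixed `σ`, `v` and `r`. Hence a bound that is uniform over
fixed data suffices, although `v` and `r` arise from a quantum measurement. -/
theorem obfEvalProb_ge {tok : TokenScheme} (hc : tok.Correct) (lam : ℕ) (P : LMPublic n m m' t)
    (F : BitStr lam → List Bit → BitStr (kappa lam n)) (ψ : QState (Fin n))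
    (x : BitStr m) (y : BitStr m') (δ : ℝ)
    (hδ : ∀ σ c r, collisionProb (sl := tok.sigLen (kappa lam n)) P F x σ c r ≤ δ) :
    (1 - δ) * P.evalProb ψ x y ≤ obfEvalProb tok lam P F ψ x y := by
  classical
  unfold obfEvalProb
  rw [← avg_const (α := QASKey (kappa lam n) n) ((1 - δ) * P.evalProb ψ x y)]
  refine avg_mono fun k => ?_
  have h1 : (1 - δ) * P.evalProb ψ x y =
      ∑ vk : Fin m → BitStr (tok.vkLen (kappa lam n)),
        (∏ q, tok.vkProb (kappa lam n) (vk q)) *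
          ∑ σ : Fin m → BitStr (tok.sigLen (kappa lam n)),
          ((∏ q, tok.signProb (kappa lam n) (tok.sk (kappa lam n) (vk q)) (x q) (σ q)) *
            (if ∀ q, tok.ver (kappa lam n) (vk q) (x q) (σ q) then 1 else 0)) *
            ∑ r, ∑ v, transcriptWeight P k ψ x y r v * (1 - δ) := by
    simp only [← Finset.sum_mul]
    rw [sum_transcriptWeight, mul_comm (P.evalProb ψ x y)]
    generalize (1 - δ) * P.evalProb ψ x y = X
    simp only [← mul_assoc, ← Finset.sum_mul]
    rw [tok.sum_valid hc, one_mul]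
  have h2 : ∀ k' : BitStr lam, ∑ vk : Fin m → BitStr (tok.vkLen (kappa lam n)),
        (∏ q, tok.vkProb (kappa lam n) (vk q)) *
          ∑ σ : Fin m → BitStr (tok.sigLen (kappa lam n)),
          ((∏ q, tok.signProb (kappa lam n) (tok.sk (kappa lam n) (vk q)) (x q) (σ q)) *
            (if ∀ q, tok.ver (kappa lam n) (vk q) (x q) (σ q) then 1 else 0)) *
            ∑ r, ∑ v, transcriptWeight P k ψ x y r v *
              (1 - if ∀ i < t, Separated P (F k') x σ (P.join v) r i then 0 else 1) ≤
      ∑ vk : Fin m → BitStr (tok.vkLen (kappa lam n)),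
        (∏ q, tok.vkProb (kappa lam n) (vk q)) *
          qevalProb (qobf tok (kappa lam n) P ψ k vk (F k')) x y := fun k' =>
    Finset.sum_le_sum fun vk _ => mul_le_mul_of_nonneg_left
      (qevalProb_ge P ψ k vk (F k') x y) (Finset.prod_nonneg fun q _ => tok.vkProb_nonneg _ _)
  refine le_trans ?_ (avg_mono h2)
  rw [h1]
  simp only [avg_sum, avg_mul_left]
  refine Finset.sum_le_sum fun vk _ => mul_le_mul_of_nonneg_left
    (Finset.sum_le_sum fun σ _ => mul_le_mul_of_nonneg_left (Finset.sum_le_sum fun r _ =>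
      Finset.sum_le_sum fun v _ => mul_le_mul_of_nonneg_left ?_ (weight_nonneg _)) ?_)
      (Finset.prod_nonneg fun q _ => tok.vkProb_nonneg _ _)
  · rw [avg_sub, avg_const]
    exact sub_le_sub_left (hδ σ (P.join v) r) 1
  · refine mul_nonneg (Finset.prod_nonneg fun q _ => tok.signProb_nonneg _ (vk q) (x q) (σ q)) ?_
    split_ifs <;> norm_num

end Correctness

/-! ### Pauli gates -/

lemma tphase_pow_four : (Complex.exp (Complex.I * (Real.pi / 4 : ℝ))) ^ 4 = -1 := by
  rw [← Complex.exp_nat_mul]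
  have : ((4 : ℕ) : ℂ) * (Complex.I * ((Real.pi / 4 : ℝ) : ℂ)) = Real.pi * Complex.I := by
    push_cast; ring
  rw [this, Complex.exp_pi_mul_I]

section Pauli

variable {ι : Type} [Fintype ι] [DecidableEq ι]

/-- The phase flip `Z = T⁴`. -/
def zGates (i : ι) : List (Gate ι) := [.tgate i, .tgate i, .tgate i, .tgate i]

/-- The bit flip `X = H Z H`. -/
def xGates (i : ι) : List (Gate ι) := [.had i] ++ zGates i ++ [.had i]

lemma runGates_z (i : ι) (ψ : QState ι) : runGates (zGates i) ψ = fun s => sgn (s i) * ψ s := by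
  funext s
  simp only [zGates, runGates, List.foldl_cons, List.foldl_nil, Gate.apply]
  rcases bit_cases (s i) with h | h
  · simp [h]
  · simp only [h, one_ne_zero, if_false, sgn_one]
    rw [← tphase_pow_four]; ring

lemma runGates_x (i : ι) (ψ : QState ι) :
    runGates (xGates i) ψ = fun s => ψ (Function.update s i (s i + 1)) := by
  rw [xGates, runGates_append, runGates_append, runGates_z]
  funext s
  simp only [runGates, List.foldl_cons, List.foldl_nil, had_apply, Function.update_idem,
    Function.update_self, sgn_zero, sgn_one]
  have key : ∀ a b c : ℂ, rt * (1 * (rt * (a + 1 * b)) + c * (-1 * (rt * (a + -1 * b)))) =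
      (1 / 2) * ((1 - c) * a + (1 + c) * b) := by
    intro a b c
    rw [← rt_mul_rt]; ring
  rw [key]
  rcases bit_cases (s i) with h | h
  · rw [h, sgn_zero, zero_add]; ring
  · rw [h, sgn_one, one_add_one_bit]; ring

lemma cnot_basisState (i j : ι) (h : i ≠ j) (b : ι → Bit) :
    (Gate.cnot i j h).apply (basisState b) = basisState (Function.update b j (b j + b i)) := by
  funext s
  rw [cnot_apply]
  unfold basisState
  refine if_congr ⟨?_, ?_⟩ rfl rfl
  · rintro rfl
    simp [Function.update_of_ne h, add_assoc, bit_add_self]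
  · rintro rfl
    simp [Function.update_of_ne h, add_assoc, bit_add_self]

lemma x_basisState (i : ι) (b : ι → Bit) :
    runGates (xGates i) (basisState b) = basisState (Function.update b i (b i + 1)) := by
  rw [runGates_x]
  funext s
  unfold basisState
  refine if_congr ⟨?_, ?_⟩ rfl rfl
  · rintro rfl
    simp [add_assoc, one_add_one_bit]
  · rintro rfl
    simp [add_assoc, one_add_one_bit]

lemma weight_project_basisState (p : (ι → Bit) → Prop) [DecidablePred p] (b : ι → Bit) :
    weight (project p (basisState b)) = if p b then 1 else 0 := by
  unfold weight
  rw [Finset.sum_eq_single b]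
  · rw [project_apply]
    split_ifs <;> simp [basisState]
  · intro s _ hs
    rw [project_apply]
    simp [basisState, hs]
  · simp

end Pauli

/-! ### Classical oracle circuits -/

section Runs

variable {κ : ℕ} {W : Type} [Fintype W] [DecidableEq W] {N : ℕ} (e : W ≃ Fin N)
  (F : List Bit → BitStr κ)

/-- The oracle circuit maps the basis state `s` to the basis state `s'`. -/
def Runs (gs : List (OGate κ N)) (s s' : W → Bit) : Prop :=
  gs.foldl (fun φ g => g.apply F φ) (basisState fun q => s (e.symm q)) =
    basisState fun q => s' (e.symm q)

lemma Runs.nil (s : W → Bit) : Runs e F [] s s := rfl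

variable {e F}

lemma Runs.append {gs gs' : List (OGate κ N)} {s s' s'' : W → Bit} (h : Runs e F gs s s')
    (h' : Runs e F gs' s' s'') : Runs e F (gs ++ gs') s s'' := by
  unfold Runs at *
  rw [List.foldl_append, h, h']

lemma foldl_gate (gs : List (Gate (Fin N))) (φ : QState (Fin N)) :
    (gs.map OGate.gate).foldl (fun φ g => g.apply F φ) φ = runGates gs φ := by
  rw [List.foldl_map]; rfl

lemma update_comp_symm (s : W → Bit) (w : W) (b : Bit) :
    Function.update (fun q => s (e.symm q)) (e w) b = fun q => Function.update s w b (e.symm q) := by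
  funext q
  by_cases h : q = e w
  · subst h; simp
  · rw [Function.update_of_ne h, Function.update_of_ne]
    rintro rfl; simp at h

variable (e F)

lemma runs_x (w : W) (s : W → Bit) :
    Runs e F ((xGates (e w)).map OGate.gate) s (Function.update s w (s w + 1)) := by
  unfold Runs
  rw [foldl_gate, x_basisState, Equiv.symm_apply_apply, update_comp_symm]

lemma runs_cnot (v w : W) (h : v ≠ w) (s : W → Bit) :
    Runs e F [OGate.gate (Gate.cnot (e v) (e w) (e.injective.ne h))] s
      (Function.update s w (s w + s v)) := by
  unfold Runs
  rw [List.foldl_cons, List.foldl_nil, OGate.apply, cnot_basisState, Equiv.symm_apply_apply,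
    Equiv.symm_apply_apply, update_comp_symm]

/-- The registers of a query. -/
def queryRegs (ws : List W) (hws : ws.Nodup) (out : Fin κ → W) (ho : Function.Injective out)
    (hd : ∀ o, out o ∉ ws) : Fin ws.length ⊕ Fin κ ↪ Fin N where
  toFun := Sum.elim (fun a => e (ws.get a)) fun o => e (out o)
  inj' := by
    rintro (a | o) (a' | o') h
    · exact congrArg _ (List.nodup_iff_injective_get.mp hws (e.injective h))
    · exact absurd (List.get_mem ws a) (by rw [e.injective h]; exact hd o')
    · exact absurd (List.get_mem ws a') (by rw [← e.injective h]; exact hd o)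
    · exact congrArg _ (ho (e.injective h))

/-- The queried wires are disjoint from the output wires, so the query string is unchanged by the
query and the map on strings is an involution; this identifies the unique string of nonzero
amplitude. -/
lemma runs_query (ws : List W) (hws : ws.Nodup) (out : Fin κ → W) (ho : Function.Injective out)
    (hd : ∀ o, out o ∉ ws) (s s' : W → Bit) (hs : ∀ w, (∀ o, out o ≠ w) → s' w = s w)
    (hs' : ∀ o, s' (out o) = s (out o) + F (ws.map s) o) :
    Runs e F [OGate.query ws.length (queryRegs e ws hws out ho hd)] s s' := by
  classical
  have hin : ∀ g : W → Bit, (List.ofFn fun a => g (e.symm (queryRegs e ws hws out ho hd (.inl a)))) =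
      ws.map g := by
    intro g
    have : (fun a => g (e.symm (queryRegs e ws hws out ho hd (.inl a)))) =
        fun a : Fin ws.length => g (ws.get a) := by
      funext a; simp [queryRegs]
    rw [this]
    conv_rhs => rw [← List.ofFn_get ws, List.map_ofFn]
    rfl
  have hsum : ∀ (w : W) (v : BitStr κ), (∑ o, if queryRegs e ws hws out ho hd (.inr o) = e w
      then v o else 0) = ∑ o, if out o = w then v o else 0 := by
    intro w v
    refine Finset.sum_congr rfl fun o _ => ?_
    simp [queryRegs]
  have hsum1 : ∀ (o : Fin κ) (v : BitStr κ), (∑ o', if out o' = out o then v o' else 0) = v o := by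
    intro o v
    simp [ho.eq_iff]
  have hsum0 : ∀ (w : W) (v : BitStr κ), (∀ o, out o ≠ w) →
      (∑ o', if out o' = w then v o' else 0) = 0 := by
    intro w v h
    exact Finset.sum_eq_zero fun o _ => if_neg (h o)
  unfold Runs
  rw [List.foldl_cons, List.foldl_nil]
  funext u
  unfold OGate.apply basisState
  obtain ⟨g, rfl⟩ : ∃ g : W → Bit, u = fun q => g (e.symm q) := ⟨fun w => u (e w), by simp⟩
  simp only
  rw [hin g]
  have hext : ∀ a b : W → Bit, ((fun q => a (e.symm q)) = fun q => b (e.symm q)) ↔ a = b := by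
    intro a b
    constructor
    · intro h; funext w; simpa using congrFun h (e w)
    · rintro rfl; rfl
  have hlhs : (fun q => g (e.symm q) + ∑ o, if queryRegs e ws hws out ho hd (.inr o) = q
      then F (ws.map g) o else 0) =
      fun q => (fun w => g w + ∑ o, if out o = w then F (ws.map g) o else 0) (e.symm q) := by
    funext q
    obtain ⟨w, rfl⟩ := e.surjective q
    simp only [Equiv.symm_apply_apply]
    rw [hsum]
  rw [hlhs]
  refine if_congr (Iff.trans (hext (fun w => g w + ∑ o, if out o = w then F (ws.map g) o else 0) s) (Iff.trans ?_ (hext g s').symm)) rfl rfl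
  have hmap : ∀ a b : W → Bit, (∀ w, (∀ o, out o ≠ w) → a w = b w) → ws.map a = ws.map b := by
    intro a b h
    refine List.map_congr_left fun w hw => h w fun o ho' => hd o (ho' ▸ hw)
  constructor
  · intro h
    have h1 : ∀ w, (∀ o, out o ≠ w) → g w = s w := by
      intro w hw
      have := congrFun h w
      simp only [hsum0 w _ hw, add_zero] at this
      exact this
    funext w
    by_cases hw : ∃ o, out o = w
    · obtain ⟨o, rfl⟩ := hw
      have := congrFun h (out o)
      simp only [hsum1] at this
      rw [hs', ← this, ← hmap g s h1, add_assoc, bit_add_self, add_zero]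
    · have hw' : ∀ o, out o ≠ w := fun o h => hw ⟨o, h⟩
      rw [hs w hw', h1 w hw']
  · rintro rfl
    funext w
    by_cases hw : ∃ o, out o = w
    · obtain ⟨o, rfl⟩ := hw
      rw [hsum1, hs', hmap g s hs, add_assoc, bit_add_self, add_zero]
    · have hw' : ∀ o, out o ≠ w := fun o h => hw ⟨o, h⟩
      rw [hsum0 _ _ hw', hs w hw', add_zero]

/-- One bit flip, of six gates, per wire that should hold `1`. The circuit does not depend on the
oracle. -/
lemma runs_load (s : W → Bit) : ∃ gs : List (OGate κ N), gs.length ≤ 6 * Fintype.card W ∧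
    ∀ F : List Bit → BitStr κ, Runs e F gs 0 s := by
  have h : ∀ l : List W, l.Nodup → ∃ gs : List (OGate κ N), gs.length ≤ 6 * l.length ∧
      ∀ F : List Bit → BitStr κ, Runs e F gs 0 (fun w => if w ∈ l then s w else 0) := by
    intro l
    induction l with
    | nil => exact fun _ => ⟨[], by simp, fun F => by
        convert Runs.nil e F 0 using 1; funext w; simp⟩
    | cons w l ih =>
      intro hl
      obtain ⟨hw, hl⟩ := List.nodup_cons.mp hl
      obtain ⟨gs, hg, hr⟩ := ih hl
      rcases bit_cases (s w) with hs | hs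
      · refine ⟨gs, by simp; omega, fun F => ?_⟩
        convert hr F using 2 with v
        by_cases hv : v = w
        · subst hv; simp [hs]
        · simp [hv]
      · refine ⟨gs ++ (xGates (e w)).map OGate.gate, by simp [xGates, zGates]; omega, fun F => ?_⟩
        convert (hr F).append (runs_x e F w _) using 1
        funext v
        by_cases hv : v = w
        · subst hv; simp [hs, hw]
        · simp [hv]
  obtain ⟨gs, hg, hr⟩ := h Finset.univ.toList (Finset.nodup_toList _)
  refine ⟨gs, by simpa using hg, fun F => ?_⟩
  simpa using hr F

/-- Since `u` is hard-wired, a parity needs only CNOT gates; an equality test would need products of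
bits. -/
lemma runs_parity (A : Fin κ → W) (out : W) (hA : ∀ o, A o ≠ out) (u : BitStr κ) :
    ∃ gs : List (OGate κ N), gs.length ≤ κ ∧ ∀ (F : List Bit → BitStr κ) (s : W → Bit),
      Runs e F gs s (Function.update s out (s out + ∑ o, u o * s (A o))) := by
  classical
  have h : ∀ l : List (Fin κ), l.Nodup → ∃ gs : List (OGate κ N), gs.length ≤ l.length ∧
      ∀ (F : List Bit → BitStr κ) (s : W → Bit),
      Runs e F gs s (Function.update s out (s out + ∑ o ∈ l.toFinset, u o * s (A o))) := by
    intro l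
    induction l with
    | nil => exact fun _ => ⟨[], by simp, fun F s => by simpa using Runs.nil e F s⟩
    | cons o l ih =>
      intro hl
      obtain ⟨hw, hl⟩ := List.nodup_cons.mp hl
      obtain ⟨gs, hg, hr⟩ := ih hl
      have hw' : o ∉ l.toFinset := by simpa using hw
      rcases bit_cases (u o) with hs | hs
      · refine ⟨gs, by simp; omega, fun F s => ?_⟩
        convert hr F s using 3
        rw [List.toFinset_cons, Finset.sum_insert hw', hs, zero_mul, zero_add]
      · refine ⟨gs ++ [OGate.gate (Gate.cnot (e (A o)) (e out) (e.injective.ne (hA o)))],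
          by simp; omega, fun F s => ?_⟩
        convert (hr F s).append (runs_cnot e F (A o) out (hA o) _) using 1
        rw [List.toFinset_cons, Finset.sum_insert hw', hs, one_mul, Function.update_idem,
          Function.update_self, Function.update_of_ne (hA o), add_assoc, add_comm (s (A o))]
  obtain ⟨gs, hg, hr⟩ := h (List.finRange κ) (List.nodup_finRange κ)
  refine ⟨gs, by simpa using hg, fun F s => ?_⟩
  simpa using hr F s

end Runs

/-! ### The circuit that tests two labels for coincidence -/

section Collision

variable {n m m' t : ℕ} (P : LMPublic n m m' t) {κ sl : ℕ}

/-- The part of the hash input that does not depend on the labels. -/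
def hashPrefix (x : BitStr m) (σ : Fin m → BitStr sl) (c : Fin n → Block κ) (i : ℕ) : List Bit :=
  List.ofFn x ++
  (List.finRange m).flatMap (fun i => List.ofFn (σ i)) ++
  ((List.finRange (t + 1)).filter fun j => decide (j.val ≤ i)).flatMap (fun j =>
    ((P.V j).sort (· ≤ ·)).flatMap fun w => List.ofFn (c w))

lemma hashInput_eq (x : BitStr m) (σ : Fin m → BitStr sl) (c : Fin n → Block κ) (i : ℕ)
    (ℓ : Fin i → BitStr κ) (b : Bit) :
    hashInput P x σ c i ℓ b =
      hashPrefix P x σ c i ++ (List.finRange i).flatMap (fun j => List.ofFn (ℓ j)) ++ [b] := rfl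

/-- The sets `V_j` are disjoint, so at most `n` blocks enter the string, whatever the number of
layers. -/
lemma length_hashPrefix_le (x : BitStr m) (σ : Fin m → BitStr sl) (c : Fin n → Block κ) (i : ℕ) :
    (hashPrefix P x σ c i).length ≤ m + m * sl + n * (2 * κ + 1) := by
  unfold hashPrefix
  rw [List.length_append, List.length_append, List.length_ofFn, List.length_flatMap,
    List.length_flatMap]
  have h1 : ((List.finRange m).map fun i => (List.ofFn (σ i)).length).sum = m * sl := by
    simp
  have h2 : ∀ j, (((P.V j).sort (· ≤ ·)).flatMap fun w => List.ofFn (c w)).length =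
      (P.V j).card * (2 * κ + 1) := by
    intro j; simp [List.length_flatMap]
  have h3 : ((((List.finRange (t + 1)).filter fun j => decide (j.val ≤ i)).map fun j =>
      (((P.V j).sort (· ≤ ·)).flatMap fun w => List.ofFn (c w)).length).sum) ≤
      n * (2 * κ + 1) := by
    simp only [h2]
    calc _ ≤ ((List.finRange (t + 1)).map fun j => (P.V j).card * (2 * κ + 1)).sum :=
          ((List.filter_sublist).map _).sum_le_sum fun _ _ => Nat.zero_le _
      _ = ∑ j, (P.V j).card * (2 * κ + 1) := by
          rw [← List.ofFn_eq_map, List.sum_ofFn]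
      _ = (Finset.univ.biUnion P.V).card * (2 * κ + 1) := by
          rw [← Finset.sum_mul, Finset.card_biUnion]
          exact fun i _ j _ h => P.V_disjoint i j h
      _ ≤ n * (2 * κ + 1) := by
          gcongr
          simpa using Finset.card_le_univ (Finset.univ.biUnion P.V)
  omega

lemma length_hashPrefix_mono (x : BitStr m) (σ : Fin m → BitStr sl) (c : Fin n → Block κ)
    {i j : ℕ} (h : i ≤ j) :
    (hashPrefix P x σ c i).length ≤ (hashPrefix P x σ c j).length := by
  unfold hashPrefix
  simp only [List.length_append]
  gcongr 1
  rw [List.length_flatMap, List.length_flatMap]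
  refine List.Sublist.sum_le_sum (List.Sublist.map _ ?_) fun _ _ => Nat.zero_le _
  refine List.monotone_filter_right _ fun a ha => ?_
  simp only [decide_eq_true_eq] at ha ⊢
  exact ha.trans h

lemma length_hashInput (x : BitStr m) (σ : Fin m → BitStr sl) (c : Fin n → Block κ) (i : ℕ)
    (ℓ : Fin i → BitStr κ) (b : Bit) :
    (hashInput P x σ c i ℓ b).length = (hashPrefix P x σ c i).length + i * κ + 1 := by
  rw [hashInput_eq]
  simp [List.length_flatMap, add_assoc]

/-- Wires: the constant parts of the queries, their last bits, the labels, the register of the two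
candidate labels, and the output. -/
abbrev CollWires (i N κ : ℕ) : Type :=
  (Fin (i + 1) × Fin N) ⊕ (Fin (i + 2) ⊕ ((Fin i × Fin κ) ⊕ (Fin κ ⊕ Unit)))

/-- The content of the wires. -/
def collState {N : ℕ} (i : ℕ) (pre : ℕ → List Bit) (r : ℕ → Bit) (ℓ : Fin i → BitStr κ) (j : ℕ)
    (A : BitStr κ) (out : Bit) : CollWires i N κ → Bit :=
  Sum.elim (fun p => (pre p.1)[p.2.val]?.getD 0)
    (Sum.elim (fun b => if b.val < i then r b else if b.val = i then 0 else 1)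
      (Sum.elim (fun p => if p.1.val < j then ℓ p.1 p.2 else 0)
        (Sum.elim A fun _ => out)))

/-- The wires of the query of layer `j` whose last bit is on wire `b`. -/
def collQuery {N : ℕ} (i : ℕ) (pre : ℕ → List Bit) (hN : ∀ j, (pre j).length ≤ N) (j : ℕ)
    (hj : j ≤ i) (b : Fin (i + 2)) : List (CollWires i N κ) :=
  (List.finRange (pre j).length).map
      (fun p => Sum.inl (⟨j, Nat.lt_succ_of_le hj⟩, Fin.castLE (hN j) p)) ++
    (List.finRange j).flatMap (fun a => (List.finRange κ).map fun o =>
      Sum.inr (Sum.inr (Sum.inl (Fin.castLE hj a, o)))) ++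
    [Sum.inr (Sum.inl b)]

lemma nodup_collQuery {N : ℕ} (i : ℕ) (pre : ℕ → List Bit) (hN : ∀ j, (pre j).length ≤ N) (j : ℕ)
    (hj : j ≤ i) (b : Fin (i + 2)) : (collQuery (κ := κ) i pre hN j hj b).Nodup := by
  unfold collQuery
  have h1 : ((List.finRange (pre j).length).map (fun p =>
      (Sum.inl (⟨j, Nat.lt_succ_of_le hj⟩, Fin.castLE (hN j) p) : CollWires i N κ))).Nodup := by
    refine (List.nodup_finRange _).map fun p q h => ?_
    simpa [Fin.ext_iff] using h
  have h2 : ((List.finRange j).flatMap (fun a => (List.finRange κ).map fun o =>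
      (Sum.inr (Sum.inr (Sum.inl (Fin.castLE hj a, o))) : CollWires i N κ))).Nodup := by
    have : ((List.finRange j).flatMap (fun a => (List.finRange κ).map fun o =>
      (Sum.inr (Sum.inr (Sum.inl (Fin.castLE hj a, o))) : CollWires i N κ))) =
      ((List.finRange j).product (List.finRange κ)).map fun p =>
        (Sum.inr (Sum.inr (Sum.inl (Fin.castLE hj p.1, p.2))) : CollWires i N κ) := by
      simp [List.product, List.map_flatMap, Function.comp_def]
    rw [this]
    refine ((List.nodup_finRange _).product (List.nodup_finRange _)).map fun p q h => ?_
    simpa [Fin.ext_iff, Prod.ext_iff] using h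
  refine List.Nodup.append (List.Nodup.append h1 h2 ?_) (List.nodup_singleton _) ?_
  · intro w hw hw'
    simp only [List.mem_map, List.mem_flatMap] at hw hw'
    obtain ⟨p, _, rfl⟩ := hw
    obtain ⟨a, _, o, _, h⟩ := hw'
    simp at h
  · intro w hw hw'
    simp only [List.mem_append, List.mem_map, List.mem_flatMap, List.mem_singleton] at hw hw'
    subst hw'
    rcases hw with ⟨p, _, h⟩ | ⟨a, _, o, _, h⟩ <;> simp at h

lemma map_collQuery {N : ℕ} (i : ℕ) (pre : ℕ → List Bit) (hN : ∀ j, (pre j).length ≤ N) (j : ℕ)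
    (hj : j ≤ i) (b : Fin (i + 2)) (r : ℕ → Bit) (ℓ : Fin i → BitStr κ) (A : BitStr κ)
    (out : Bit) :
    (collQuery i pre hN j hj b).map (collState i pre r ℓ j A out) =
      pre j ++ (List.finRange j).flatMap (fun a => List.ofFn (ℓ (Fin.castLE hj a))) ++
        [if b.val < i then r b else if b.val = i then 0 else 1] := by
  unfold collQuery
  rw [List.map_append, List.map_append]
  congr 2
  · rw [List.map_map, ← List.ofFn_eq_map]
    conv_rhs => rw [← List.ofFn_get (pre j)]
    congr 1
    funext p
    simp [collState]
  · rw [List.map_flatMap]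
    refine List.flatMap_congr fun a _ => ?_
    rw [List.map_map, List.ofFn_eq_map]
    refine List.map_congr_left fun o _ => ?_
    simp [collState]

/-- Constants are loaded, the labels are computed one after the other by queries, both candidates of
layer `i` are added into the same register, and their parity against `u` is copied out. The labels
enter as any `ℓ` satisfying the recursion, so the circuit itself is independent of `F`. -/
lemma runs_coll {N M : ℕ} (i : ℕ) (pre : ℕ → List Bit) (hN : ∀ j, (pre j).length ≤ N)
    (r : ℕ → Bit) (u : BitStr κ) (e : CollWires i N κ ≃ Fin M) :
    ∃ gs : List (OGate κ M), gs.length ≤ 6 * M + i + 2 + κ ∧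
      ∀ (F : List Bit → BitStr κ) (ℓ : Fin i → BitStr κ),
        (∀ a : Fin i, ℓ a = F (pre a ++ (List.finRange a.val).flatMap
          (fun b => List.ofFn (ℓ (Fin.castLE a.isLt.le b))) ++ [r a])) →
        Runs e F gs 0 (collState i pre r ℓ i
          (F (pre i ++ (List.finRange i).flatMap (fun b => List.ofFn (ℓ b)) ++ [0]) +
            F (pre i ++ (List.finRange i).flatMap (fun b => List.ofFn (ℓ b)) ++ [1]))
          (∑ o, u o * (F (pre i ++ (List.finRange i).flatMap (fun b => List.ofFn (ℓ b)) ++ [0]) +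
            F (pre i ++ (List.finRange i).flatMap (fun b => List.ofFn (ℓ b)) ++ [1])) o)) := by
  obtain ⟨g₀, hg₀, hr₀⟩ := runs_load (κ := κ) e (collState (N := N) i pre r (0 : Fin i → BitStr κ) 0 0 0)
  have hcard : Fintype.card (CollWires i N κ) = M := by
    rw [Fintype.card_congr e, Fintype.card_fin]
  rw [hcard] at hg₀
  -- One query per label: the label of layer `j` is written to its own wires, from which all later
  -- queries read it.
  have hlab : ∀ j, j ≤ i → ∃ gs : List (OGate κ M), gs.length ≤ j ∧
      ∀ (F : List Bit → BitStr κ) (ℓ : Fin i → BitStr κ),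
        (∀ a : Fin i, ℓ a = F (pre a ++ (List.finRange a.val).flatMap
          (fun b => List.ofFn (ℓ (Fin.castLE a.isLt.le b))) ++ [r a])) →
        Runs e F gs (collState i pre r 0 0 0 0) (collState i pre r ℓ j 0 0) := by
    intro j
    induction j with
    | zero =>
      refine fun _ => ⟨[], le_rfl, fun F ℓ _ => ?_⟩
      convert Runs.nil e F _ using 1
      funext w
      rcases w with p | b | p | o | _ <;> simp [collState]
    | succ j ih =>
      intro hj
      obtain ⟨gs, hg, hr⟩ := ih (Nat.le_of_succ_le hj)
      have hjlt : j < i := hj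
      refine ⟨gs ++ [OGate.query _ (queryRegs e
        (collQuery i pre hN j hjlt.le ⟨j, by omega⟩) (nodup_collQuery ..)
        (fun o => Sum.inr (Sum.inr (Sum.inl (⟨j, hjlt⟩, o))))
        (fun o o' h => by simpa using h) ?_)], by simp; omega, fun F ℓ hℓ =>
          (hr F ℓ hℓ).append (runs_query e F _ _ _ _ _ _ _ ?_ ?_)⟩
      · intro o ho
        simp only [collQuery, List.mem_append, List.mem_map, List.mem_flatMap,
          List.mem_singleton] at ho
        rcases ho with (⟨p, _, h⟩ | ⟨a, _, o', _, h⟩) | h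
        · simp at h
        · have : a.val = j := by
            have := congrArg Fin.val (Prod.ext_iff.mp (Sum.inl.inj (Sum.inr.inj (Sum.inr.inj h)))).1
            simpa using this
          exact absurd a.isLt (by omega)
        · simp at h
      · rintro (p | b | ⟨a, o⟩ | o | _) h
        · rfl
        · rfl
        · have hne : a.val ≠ j := by
            rintro rfl
            exact h o rfl
          have : a.val < j + 1 ↔ a.val < j := by omega
          simp only [collState, Sum.elim_inr, Sum.elim_inl, this]
        · rfl
        · rfl
      · intro o
        rw [map_collQuery]
        have := congrFun (hℓ ⟨j, hjlt⟩) o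
        simp only [hjlt, if_true]
        simp only [collState, Sum.elim_inr, Sum.elim_inl, lt_irrefl, if_false, zero_add,
          Nat.lt_succ_self, if_true]
        exact this
  obtain ⟨g₁, hg₁, hr₁⟩ := hlab i le_rfl
  have hout : ∀ b : Fin (i + 2), ∀ o : Fin κ,
      (Sum.inr (Sum.inr (Sum.inr (Sum.inl o))) : CollWires i N κ) ∉
        collQuery i pre hN i le_rfl b := by
    intro b o ho
    simp only [collQuery, List.mem_append, List.mem_map, List.mem_flatMap,
      List.mem_singleton] at ho
    rcases ho with (⟨p, _, h⟩ | ⟨a, _, o', _, h⟩) | h <;> simp at h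
  have hinj : Function.Injective
      (fun o : Fin κ => (Sum.inr (Sum.inr (Sum.inr (Sum.inl o))) : CollWires i N κ)) :=
    fun o o' h => by simpa using h
  obtain ⟨g₂, hg₂, hr₂⟩ := runs_parity e
    (fun o : Fin κ => (Sum.inr (Sum.inr (Sum.inr (Sum.inl o))) : CollWires i N κ))
    (Sum.inr (Sum.inr (Sum.inr (Sum.inr ())))) (fun o => by simp) u
  have hq : ∀ (b : Fin (i + 2)) (F : List Bit → BitStr κ) (ℓ : Fin i → BitStr κ) (A : BitStr κ),
      Runs e F [OGate.query _ (queryRegs e (collQuery i pre hN i le_rfl b) (nodup_collQuery ..) _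
        hinj (hout b))] (collState i pre r ℓ i A 0)
        (collState i pre r ℓ i (A + F (pre i ++
          (List.finRange i).flatMap (fun b => List.ofFn (ℓ b)) ++
          [if b.val < i then r b else if b.val = i then 0 else 1])) 0) := by
    intro b F ℓ A
    refine runs_query e F _ _ _ _ _ _ _ ?_ ?_
    · rintro (p | b | ⟨a, o⟩ | o | _) h
      · rfl
      · rfl
      · rfl
      · exact absurd rfl (h o)
      · rfl
    · intro o
      rw [map_collQuery]
      rfl
  -- The wires `i` and `i + 1` for last bits hold the constants `0` and `1` of the two candidates.
  refine ⟨g₀ ++ (g₁ ++ ([OGate.query _ (queryRegs e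
      (collQuery i pre hN i le_rfl ⟨i, by omega⟩) (nodup_collQuery ..) _ hinj (hout _))] ++
      ([OGate.query _ (queryRegs e
      (collQuery i pre hN i le_rfl ⟨i + 1, by omega⟩) (nodup_collQuery ..) _ hinj (hout _))] ++
      g₂))), ?_, fun F ℓ hℓ => (hr₀ F).append ((hr₁ F ℓ hℓ).append
        ((hq _ F ℓ 0).append ((hq _ F ℓ _).append ?_)))⟩
  · simp only [List.length_append, List.length_singleton]
    omega
  · convert hr₂ F _ using 1
    have h1 : ¬ (i + 1 < i) := by omega
    have h2 : ¬ (i + 1 = i) := by omega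
    funext w
    rcases w with p | b | p | o | _
    · rfl
    · rfl
    · rfl
    · simp [collState, Function.update_of_ne, h1]
    · simp [collState, h1]

end Collision

/-! ### Coinciding labels and pseudorandomness -/

/-- A nonzero vector has odd parity against exactly half of all `u`: flipping `u` at a coordinate
where `A` is `1` exchanges the two halves. -/
lemma sum_parity {κ : ℕ} (A : BitStr κ) :
    ∑ u : BitStr κ, (if ∑ o, u o * A o = 1 then (1 : ℝ) else 0) =
      if A = 0 then 0 else 2 ^ κ / 2 := by
  by_cases h : A = 0
  · subst h; simp
  · rw [if_neg h]
    obtain ⟨o, ho⟩ := Function.ne_iff.mp h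
    have ho1 : A o = 1 := (bit_cases _).resolve_left ho
    have h1 : ∀ u : BitStr κ, ∑ a, (u + (Pi.single o 1 : BitStr κ)) a * A a = (∑ a, u a * A a) + 1 := by
      intro u
      simp only [Pi.add_apply, add_mul, Finset.sum_add_distrib]
      congr 1
      rw [Finset.sum_eq_single o]
      · simp [ho1]
      · intro a _ ha; simp [ha]
      · simp
    have h2 : ∑ u : BitStr κ, (if ∑ o, u o * A o = 1 then (1 : ℝ) else 0) =
        ∑ u : BitStr κ, (1 - if ∑ o, u o * A o = 1 then (1 : ℝ) else 0) := by
      refine Fintype.sum_equiv (Equiv.addRight (Pi.single o 1)) _ _ fun u => ?_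
      rw [Equiv.coe_addRight, h1]
      rcases bit_cases (∑ a, u a * A a) with e | e <;> rw [e] <;> simp [one_add_one_bit]
    rw [Finset.sum_sub_distrib] at h2
    have h3 : ∑ _u : BitStr κ, (1 : ℝ) = 2 ^ κ := by simp
    rw [h3] at h2
    linarith

section Random

variable {n m m' t : ℕ} (P : LMPublic n m m' t) {κ sl : ℕ}

lemma labels_congr {hash hash' : List Bit → BitStr κ} (x : BitStr m) (σ : Fin m → BitStr sl)
    (c : Fin n → Block κ) (r : BitStr t) (i : ℕ)
    (h : ∀ j < i, ∀ ℓ b, hash (hashInput P x σ c j ℓ b) = hash' (hashInput P x σ c j ℓ b)) :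
    labels P hash x σ c r i = labels P hash' x σ c r i := by
  induction i with
  | zero => rfl
  | succ i ih =>
    have hi := ih fun j hj => h j (Nat.lt_succ_of_lt hj)
    simp only [labels, hi, h i (Nat.lt_succ_self i)]

/-- The hash input of candidate `b` of layer `i`. -/
def candInput (hash : List Bit → BitStr κ) (x : BitStr m) (σ : Fin m → BitStr sl)
    (c : Fin n → Block κ) (r : BitStr t) (i : ℕ) (b : Bit) : List Bit :=
  hashInput P x σ c i (labels P hash x σ c r i) b

lemma candInput_ne (hash : List Bit → BitStr κ) (x : BitStr m) (σ : Fin m → BitStr sl)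
    (c : Fin n → Block κ) (r : BitStr t) (i : ℕ) :
    candInput P hash x σ c r i 0 ≠ candInput P hash x σ c r i 1 := by
  intro h
  have := (List.append_inj' h rfl).2
  simp at this

/-- The queries for the earlier labels are strictly shorter than the candidates of layer `i`, since
each label adds `κ ≥ 1` bits. -/
lemma candInput_congr {hash hash' : List Bit → BitStr κ} (hκ : 1 ≤ κ) (x : BitStr m)
    (σ : Fin m → BitStr sl) (c : Fin n → Block κ) (r : BitStr t) (i : ℕ)
    (h : ∀ l, l.length < (hashPrefix P x σ c i).length + i * κ + 1 → hash l = hash' l) (b : Bit) :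
    candInput P hash x σ c r i b = candInput P hash' x σ c r i b := by
  unfold candInput
  rw [labels_congr P x σ c r i]
  intro j hj ℓ b
  refine h _ ?_
  rw [length_hashInput]
  have h1 := length_hashPrefix_mono P x σ c hj.le
  have h2 : j * κ < i * κ := Nat.mul_lt_mul_of_pos_right hj hκ
  omega

/-- Flipping the random function at the second candidate, in a coordinate where `u` is `1`, is a
measure-preserving involution that flips the parity, so both values are equally likely. -/
lemma avg_random_parity (hκ : 1 ≤ κ) (x : BitStr m) (σ : Fin m → BitStr sl) (c : Fin n → Block κ)
    (r : BitStr t) (i N : ℕ) (hN : (hashPrefix P x σ c i).length + i * κ + 1 ≤ N)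
    (u : BitStr κ) (hu : u ≠ 0) :
    avg (fun R : BoundedFn κ N =>
      if ∑ o, u o * (R.toOracle (candInput P R.toOracle x σ c r i 0) +
        R.toOracle (candInput P R.toOracle x σ c r i 1)) o = 1 then (1 : ℝ) else 0) = 1 / 2 := by
  obtain ⟨o, ho⟩ := Function.ne_iff.mp hu
  have ho1 : u o = 1 := (bit_cases _).resolve_left ho
  set q : BoundedFn κ N → Bit → List Bit := fun R b => candInput P R.toOracle x σ c r i b with hq
  have hlen : ∀ R b, (q R b).length = (hashPrefix P x σ c i).length + i * κ + 1 := fun R b =>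
    length_hashInput ..
  let Φ : BoundedFn κ N → BoundedFn κ N := fun R j s =>
    R j s + if List.ofFn s = q R 1 then Pi.single o 1 else 0
  have hΦ : ∀ R l, (Φ R).toOracle l = R.toOracle l + if l = q R 1 then Pi.single o 1 else 0 := by
    intro R l
    unfold BoundedFn.toOracle
    by_cases hl : l.length ≤ N
    · rw [dif_pos hl, dif_pos hl]
      simp only [Φ]
      congr 2
      exact propext (by rw [show (List.ofFn fun i => l.get i) = l from List.ofFn_get l])
    · rw [dif_neg hl, dif_neg hl, if_neg, add_zero]
      rintro rfl
      exact hl ((hlen R 1).le.trans hN)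
  -- The query point itself depends on `R`, but only through values at shorter strings, which `Φ`
  -- leaves alone; this also makes `Φ` an involution.
  have hqΦ : ∀ R b, q (Φ R) b = q R b := by
    intro R b
    refine candInput_congr P hκ x σ c r i (fun l hl => ?_) b
    rw [hΦ, if_neg, add_zero]
    rintro rfl
    exact absurd hl (by rw [hlen]; exact lt_irrefl _)
  have hinv : Function.Involutive Φ := by
    intro R
    funext j s
    change (Φ R) j s + (if List.ofFn s = q (Φ R) 1 then Pi.single o 1 else 0) = R j s
    rw [hqΦ]
    change R j s + _ + _ = R j s
    rw [add_assoc]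
    split_ifs
    · have : (Pi.single o 1 : BitStr κ) + Pi.single o 1 = 0 := funext fun _ => bit_add_self _
      rw [this, add_zero]
    · simp
  have hflip : ∀ R, ∑ a, u a * ((Φ R).toOracle (q (Φ R) 0) + (Φ R).toOracle (q (Φ R) 1)) a =
      (∑ a, u a * (R.toOracle (q R 0) + R.toOracle (q R 1)) a) + 1 := by
    intro R
    rw [hqΦ, hqΦ, hΦ, hΦ, if_pos rfl, if_neg (candInput_ne P R.toOracle x σ c r i), add_zero,
      ← add_assoc]
    generalize R.toOracle (q R 0) + R.toOracle (q R 1) = w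
    simp only [Pi.add_apply, mul_add, Finset.sum_add_distrib]
    congr 1
    · rw [Finset.sum_eq_single o]
      · simp [ho1]
      · intro a _ ha; simp [ha]
      · simp
  have h1 : avg (fun R : BoundedFn κ N =>
      if ∑ a, u a * (R.toOracle (q R 0) + R.toOracle (q R 1)) a = 1 then (1 : ℝ) else 0) =
      avg (fun R : BoundedFn κ N =>
      1 - if ∑ a, u a * (R.toOracle (q R 0) + R.toOracle (q R 1)) a = 1 then (1 : ℝ) else 0) := by
    unfold avg
    congr 1
    refine Fintype.sum_bijective Φ hinv.bijective _ _ fun R => ?_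
    rw [hflip]
    rcases bit_cases (∑ a, u a * (R.toOracle (q R 0) + R.toOracle (q R 1)) a) with e | e <;>
      rw [e] <;> simp [one_add_one_bit]
  rw [avg_sub, avg_const] at h1
  linarith

/-- A bound on the size of the circuits that test labels for coincidence. -/
def collSize (n m t κ sl : ℕ) : ℕ :=
  7 * ((t + 1) * (m + m * sl + n * (2 * κ + 1)) + (t + 2) + t * κ + κ + 1) + t + 2 + κ

lemma exists_parity_distinguisher (x : BitStr m) (σ : Fin m → BitStr sl) (c : Fin n → Block κ)
    (r : BitStr t) (i : ℕ) (hi : i < t) (u : BitStr κ) :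
    ∃ D : Distinguisher κ, D.size ≤ collSize n m t κ sl ∧
      (hashPrefix P x σ c i).length + i * κ + 1 ≤ D.wires ∧
      ∀ F : List Bit → BitStr κ, D.accept F =
        if ∑ o, u o * (F (candInput P F x σ c r i 0) + F (candInput P F x σ c r i 1)) o = 1
          then 1 else 0 := by
  set N := m + m * sl + n * (2 * κ + 1) with hN
  have hpre : ∀ j, (hashPrefix P x σ c j).length ≤ N := length_hashPrefix_le P x σ c
  set e := Fintype.equivFin (CollWires i N κ) with he
  obtain ⟨gs, hgs, hr⟩ := runs_coll i (hashPrefix P x σ c) hpre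
    (fun j => if h : j < t then r ⟨j, h⟩ else 0) u e
  have hcard : Fintype.card (CollWires i N κ) = (i + 1) * N + ((i + 2) + (i * κ + (κ + 1))) := by
    simp
  refine ⟨⟨_, gs, e (Sum.inr (Sum.inr (Sum.inr (Sum.inr ()))))⟩, ?_, ?_, fun F => ?_⟩
  · change Fintype.card (CollWires i N κ) + gs.length ≤ _
    unfold collSize
    rw [← hN]
    have h1 : (i + 1) * N ≤ (t + 1) * N := Nat.mul_le_mul_right _ (by omega)
    have h2 : i * κ ≤ t * κ := Nat.mul_le_mul_right _ hi.le
    omega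
  -- The query occupies distinct wires, so its length cannot exceed their number; oracles on strings
  -- of that length therefore cover it.
  · have h1 := (nodup_collQuery (κ := κ) i (hashPrefix P x σ c) hpre i le_rfl 0).length_le_card
    refine le_trans (le_of_eq ?_) h1
    simp [collQuery, List.length_flatMap, add_assoc]
  · have h := hr F (labels P F x σ c r i) ?_
    · unfold Distinguisher.accept
      have h' : gs.foldl (fun φ g => g.apply F φ) (basisState 0) = _ := h
      simp only
      rw [h', weight_project_basisState]
      simp only [Equiv.symm_apply_apply]
      rfl
    · intro a
      have h1 : (fun b => labels P F x σ c r i (Fin.castLE a.isLt.le b)) = labels P F x σ c r a :=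
        funext fun b => labels_castLE P F x σ c r _ b
      have h2 := labels_castLE P F x σ c r hi.le a
      have hat : a.val < t := a.isLt.trans hi
      rw [← h2]
      have h3 := labels_at P F x σ c r ⟨a.val, hat⟩
      have h4 : Fin.castLE hi.le a = ⟨a.val, hat⟩ := rfl
      rw [h4, h3, dif_pos hat]
      congr 1
      rw [hashInput_eq]
      congr 2
      refine List.flatMap_congr fun b _ => ?_
      rw [labels_castLE]

open Classical in
-- If the candidates of a layer coincide with probability `p`, the parity is `1` with probability
-- `(1 - p)/2` on average over all `u`, against `1/2` for a random function. The vector `u = 0`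
-- explains only `2^{-κ}` of the gap, so some `u ≠ 0` has advantage of order `p`. A union bound over
-- the layers, all bounded by the worst one, gives the factor `t`.
lemma exists_distinguisher {K : Type} [Fintype K] [Nonempty K] (hκ : 1 ≤ κ) (ht : 1 ≤ t)
    (F : K → List Bit → BitStr κ) (x : BitStr m) (σ : Fin m → BitStr sl) (c : Fin n → Block κ)
    (r : BitStr t) :
    ∃ D : Distinguisher κ, D.size ≤ collSize n m t κ sl ∧
      collisionProb P F x σ c r ≤ t * (2 * |avg (fun key => D.accept (F key)) -
        avg (fun R : BoundedFn κ D.wires => D.accept R.toOracle)| + 1 / 2 ^ κ) := by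
  have : Nonempty (Fin t) := ⟨⟨0, ht⟩⟩
  let p : Fin t → ℝ := fun i => avg fun k' => if Separated P (F k') x σ c r i then 0 else 1
  obtain ⟨i, hi⟩ := Finite.exists_max p
  have h1 : collisionProb P F x σ c r ≤ t * p i := by
    calc collisionProb P F x σ c r ≤ avg (fun k' => ∑ i : Fin t,
          if Separated P (F k') x σ c r i then (0 : ℝ) else 1) := by
          refine avg_mono fun k' => ?_
          have h0 : ∀ i : Fin t, 0 ≤ if Separated P (F k') x σ c r i then (0 : ℝ) else 1 := by
            intro i; split_ifs <;> norm_num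
          split_ifs with h
          · exact Finset.sum_nonneg fun i _ => h0 i
          · push Not at h
            obtain ⟨j, hj, hs⟩ := h
            refine le_trans ?_ (Finset.single_le_sum (fun i _ => h0 i)
              (Finset.mem_univ (⟨j, hj⟩ : Fin t)))
            rw [if_neg hs]
      _ = ∑ i : Fin t, p i := avg_sum _ _
      _ ≤ ∑ _j : Fin t, p i := Finset.sum_le_sum fun j _ => hi j
      _ = t * p i := by simp
  let A : K → BitStr κ := fun k' => F k' (candInput P (F k') x σ c r i 0) +
    F k' (candInput P (F k') x σ c r i 1)
  have hA : ∀ k', A k' = 0 ↔ ¬ Separated P (F k') x σ c r i := by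
    intro k'
    have : ∀ a b : BitStr κ, a + b = 0 ↔ a = b := fun a b => by
      simp only [funext_iff, Pi.add_apply, Pi.zero_apply, CharTwo.add_eq_zero]
    rw [this, Separated, not_not]
    rfl
  let a : BitStr κ → ℝ := fun u => avg fun k' => if ∑ o, u o * A k' o = 1 then 1 else 0
  have h2 : ∑ u, (1 / 2 - a u) = 2 ^ κ / 2 * p i := by
    have h3 : ∑ u, a u = avg fun k' => 2 ^ κ / 2 * (1 - if Separated P (F k') x σ c r i
        then (0 : ℝ) else 1) := by
      rw [← avg_sum]
      congr 1
      funext k'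
      rw [sum_parity]
      by_cases hs : Separated P (F k') x σ c r i
      · rw [if_neg (fun h => (hA k').mp h hs), if_pos hs]; ring
      · rw [if_pos ((hA k').mpr hs), if_neg hs]; ring
    rw [Finset.sum_sub_distrib, h3, avg_mul_left, avg_sub, avg_const]
    simp only [Finset.sum_const, Finset.card_univ, Fintype.card_fun, ZMod.card, Fintype.card_fin,
      nsmul_eq_mul]
    push_cast
    change 2 ^ κ * (1 / 2) - 2 ^ κ / 2 * (1 - p i) = _
    ring
  have : Nonempty {u : BitStr κ // u ≠ 0} :=
    ⟨⟨fun _ => 1, fun h => one_ne_zero (congrFun h ⟨0, hκ⟩)⟩⟩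
  obtain ⟨u, hu⟩ := Finite.exists_max fun u : {u : BitStr κ // u ≠ 0} => |1 / 2 - a u|
  -- The term of `u = 0`, where the parity is constantly `0`, is `1/2`; all others are bounded by
  -- the best nonzero `u`.
  have h4 : 2 ^ κ / 2 * p i ≤ 1 / 2 + 2 ^ κ * |1 / 2 - a u| := by
    rw [← h2, ← Finset.add_sum_erase _ _ (Finset.mem_univ (0 : BitStr κ))]
    have ha0 : a 0 = 0 := by simp [a, avg]
    rw [ha0, sub_zero]
    refine add_le_add_right ?_ (1 / 2)
    calc ∑ v ∈ Finset.univ.erase 0, (1 / 2 - a v) ≤ ∑ _v ∈ Finset.univ.erase (0 : BitStr κ),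
          |1 / 2 - a u| := Finset.sum_le_sum fun v hv =>
            (le_abs_self _).trans (hu ⟨v, Finset.ne_of_mem_erase hv⟩)
      _ ≤ ∑ _v : BitStr κ, |1 / 2 - a u| :=
          Finset.sum_le_sum_of_subset_of_nonneg (Finset.erase_subset _ _)
            fun _ _ _ => abs_nonneg _
      _ = 2 ^ κ * |1 / 2 - a u| := by simp
  obtain ⟨D, hD, hw, hacc⟩ := exists_parity_distinguisher P x σ c r i i.isLt u.1
  refine ⟨D, hD, h1.trans (mul_le_mul_of_nonneg_left ?_ (Nat.cast_nonneg t))⟩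
  have h5 : avg (fun key => D.accept (F key)) = a u := by
    simp only [hacc]; rfl
  have h6 : avg (fun R : BoundedFn κ D.wires => D.accept R.toOracle) = 1 / 2 := by
    simp only [hacc]
    exact avg_random_parity P hκ x σ c r i D.wires hw u.1 u.2
  rw [h5, h6, abs_sub_comm]
  have hpos : (0 : ℝ) < 2 ^ κ := by positivity
  have h7 : p i = (2 ^ κ / 2 * p i) * (2 / 2 ^ κ) := by field_simp
  rw [h7]
  calc (2 ^ κ / 2 * p i) * (2 / 2 ^ κ) ≤ (1 / 2 + 2 ^ κ * |1 / 2 - a u|) * (2 / 2 ^ κ) :=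
        mul_le_mul_of_nonneg_right h4 (by positivity)
    _ = _ := by field_simp; ring

end Random

/-! ### Polynomially bounded and negligible functions -/

lemma eval_mono_nat {p : Polynomial ℕ} {a b : ℕ} (h : a ≤ b) : p.eval a ≤ p.eval b := by
  rw [Polynomial.eval_eq_sum_range, Polynomial.eval_eq_sum_range]
  exact Finset.sum_le_sum fun i _ => Nat.mul_le_mul_left _ (Nat.pow_le_pow_left h i)

lemma polyBounded_iff {f : ℕ → ℕ} :
    PolyBounded f ↔ ∃ p : Polynomial ℕ, ∀ k, f k ≤ p.eval k := by
  constructor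
  · rintro ⟨c, hc⟩
    exact ⟨Polynomial.X ^ c + Polynomial.C c, fun k => by simpa using hc k⟩
  · rintro ⟨p, hp⟩
    -- For `k ≥ 2` the coefficient sum `p(1)` is absorbed as `p(1) ≤ k^{p(1)}`; for `k < 2` the
    -- additive constant suffices.
    refine ⟨p.eval 1 + p.natDegree, fun k => (hp k).trans ?_⟩
    have h1 : 1 ≤ k → p.eval k ≤ p.eval 1 * k ^ p.natDegree := by
      intro hk
      rw [Polynomial.eval_eq_sum_range, Polynomial.eval_eq_sum_range, Finset.sum_mul]
      refine Finset.sum_le_sum fun i hi => ?_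
      rw [one_pow, mul_one]
      exact Nat.mul_le_mul_left _
        (Nat.pow_le_pow_right hk (Nat.lt_succ_iff.mp (Finset.mem_range.mp hi)))
    rcases Nat.lt_or_ge k 2 with hk | hk
    · have hk' : p.eval k ≤ p.eval 1 := eval_mono_nat (by omega)
      exact hk'.trans ((Nat.le_add_right _ _).trans (Nat.le_add_left _ _))
    · calc p.eval k ≤ p.eval 1 * k ^ p.natDegree := h1 (by omega)
        _ ≤ k ^ p.eval 1 * k ^ p.natDegree :=
          Nat.mul_le_mul_right _ (Nat.lt_pow_self (by omega)).le
        _ ≤ _ := by rw [← pow_add]; omega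

namespace PolyBounded

variable {f g : ℕ → ℕ}

lemma mono (hg : PolyBounded g) (h : ∀ k, f k ≤ g k) : PolyBounded f := by
  obtain ⟨c, hc⟩ := hg
  exact ⟨c, fun k => (h k).trans (hc k)⟩

lemma const (a : ℕ) : PolyBounded fun _ => a :=
  polyBounded_iff.mpr ⟨Polynomial.C a, fun k => by simp⟩

lemma id : PolyBounded fun k => k :=
  polyBounded_iff.mpr ⟨Polynomial.X, fun k => by simp⟩

lemma add (hf : PolyBounded f) (hg : PolyBounded g) : PolyBounded fun k => f k + g k := by
  obtain ⟨p, hp⟩ := polyBounded_iff.mp hf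
  obtain ⟨q, hq⟩ := polyBounded_iff.mp hg
  exact polyBounded_iff.mpr ⟨p + q, fun k => by
    rw [Polynomial.eval_add]; exact add_le_add (hp k) (hq k)⟩

lemma mul (hf : PolyBounded f) (hg : PolyBounded g) : PolyBounded fun k => f k * g k := by
  obtain ⟨p, hp⟩ := polyBounded_iff.mp hf
  obtain ⟨q, hq⟩ := polyBounded_iff.mp hg
  exact polyBounded_iff.mpr ⟨p * q, fun k => by
    rw [Polynomial.eval_mul]; exact Nat.mul_le_mul (hp k) (hq k)⟩

lemma pow (hf : PolyBounded f) (a : ℕ) : PolyBounded fun k => f k ^ a := by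
  induction a with
  | zero => simpa using const 1
  | succ a ih => simpa only [pow_succ] using ih.mul hf

lemma max (hf : PolyBounded f) (hg : PolyBounded g) : PolyBounded fun k => max (f k) (g k) :=
  (hf.add hg).mono fun _ => max_le (Nat.le_add_right _ _) (Nat.le_add_left _ _)

lemma comp (hf : PolyBounded f) (hg : PolyBounded g) : PolyBounded fun k => f (g k) := by
  obtain ⟨p, hp⟩ := polyBounded_iff.mp hf
  obtain ⟨q, hq⟩ := polyBounded_iff.mp hg
  exact polyBounded_iff.mpr ⟨p.comp q, fun k => by
    rw [Polynomial.eval_comp]; exact (hp _).trans (eval_mono_nat (hq k))⟩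

/-- Eventually, a polynomially bounded function is below a fixed power. -/
lemma eventually_le_pow (hf : PolyBounded f) : ∃ a, ∀ k, 2 ≤ k → f k ≤ k ^ a := by
  obtain ⟨c, hc⟩ := hf
  refine ⟨c + 1, fun k hk => (hc k).trans ?_⟩
  have : c ≤ k ^ c := (Nat.lt_pow_self (by omega)).le
  calc k ^ c + c ≤ k ^ c * 2 := by omega
    _ ≤ k ^ c * k := Nat.mul_le_mul_left _ hk
    _ = k ^ (c + 1) := (pow_succ _ _).symm

end PolyBounded

namespace Negligible

variable {f g : ℕ → ℝ}

lemma mono_eventually (hg : Negligible g) (N : ℕ) (h : ∀ k, N < k → f k ≤ g k) :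
    Negligible f := by
  intro c
  obtain ⟨M, hM⟩ := hg c
  exact ⟨Nat.max M N, fun k hk => (h k ((Nat.le_max_right M N).trans_lt hk)).trans_lt
    (hM k ((Nat.le_max_left M N).trans_lt hk))⟩

lemma poly_mul {p : ℕ → ℕ} (hp : PolyBounded p) (hf : Negligible f) :
    Negligible fun k => p k * f k := by
  intro c
  obtain ⟨a, ha⟩ := hp.eventually_le_pow
  obtain ⟨M, hM⟩ := hf (c + a)
  refine ⟨Nat.max M 1, fun k hk => ?_⟩
  have hk1 : 1 < k := (Nat.le_max_right M 1).trans_lt hk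
  have hkM : M < k := (Nat.le_max_left M 1).trans_lt hk
  have hk0 : (0 : ℝ) < k := by exact_mod_cast (by omega : 0 < k)
  have h1 : (p k : ℝ) ≤ (k : ℝ) ^ a := by exact_mod_cast ha k hk1
  rcases le_or_gt (f k) 0 with h0 | h0
  · exact (mul_nonpos_of_nonneg_of_nonpos (Nat.cast_nonneg _) h0).trans_lt (by positivity)
  · calc (p k : ℝ) * f k ≤ (k : ℝ) ^ a * f k := mul_le_mul_of_nonneg_right h1 h0.le
      _ < (k : ℝ) ^ a * (1 / (k : ℝ) ^ (c + a)) :=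
        mul_lt_mul_of_pos_left (hM k hkM) (by positivity)
      _ = _ := by rw [pow_add]; field_simp

lemma max_zero (hf : Negligible f) : Negligible fun k => max (f k) 0 := by
  intro c
  obtain ⟨M, hM⟩ := hf c
  refine ⟨M, fun k hk => max_lt (hM k hk) ?_⟩
  have hk0 : (0 : ℝ) < k := by exact_mod_cast (by omega : 0 < k)
  positivity

lemma add (hf : Negligible f) (hg : Negligible g) : Negligible fun k => f k + g k := by
  intro c
  obtain ⟨M, hM⟩ := hf (c + 1)
  obtain ⟨M', hM'⟩ := hg (c + 1)
  refine ⟨Nat.max (Nat.max M M') 1, fun k hk => ?_⟩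
  have h1 : M < k := ((Nat.le_max_left M M').trans (Nat.le_max_left _ 1)).trans_lt hk
  have h2 : M' < k := ((Nat.le_max_right M M').trans (Nat.le_max_left _ 1)).trans_lt hk
  have h3 : 1 < k := (Nat.le_max_right _ 1).trans_lt hk
  have hk2 : (2 : ℝ) ≤ k := by exact_mod_cast h3
  have hk0 : (0 : ℝ) < k := by linarith
  calc f k + g k < 1 / (k : ℝ) ^ (c + 1) + 1 / (k : ℝ) ^ (c + 1) := add_lt_add (hM k h1) (hM' k h2)
    _ = 2 / k * (1 / (k : ℝ) ^ c) := by rw [pow_succ]; field_simp; norm_num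
    _ ≤ 1 * (1 / (k : ℝ) ^ c) :=
      mul_le_mul_of_nonneg_right ((div_le_one hk0).mpr hk2) (by positivity)
    _ = _ := one_mul _

lemma half_pow : Negligible fun k => 1 / 2 ^ k := by
  intro c
  have h := tendsto_pow_const_mul_const_pow_of_abs_lt_one c (r := (1 / 2 : ℝ))
    (by rw [abs_of_pos] <;> norm_num)
  have h1 := h.eventually (gt_mem_nhds one_pos)
  obtain ⟨N, hN⟩ := Filter.eventually_atTop.mp h1
  refine ⟨N, fun k hk => ?_⟩
  have h2 := hN k hk.le
  have hk0 : (0 : ℝ) < k := by exact_mod_cast (by omega : 0 < k)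
  rw [one_div_pow] at h2
  rw [lt_div_iff₀ (by positivity), mul_comm]
  exact h2

end Negligible

lemma PolyBounded.kappa {n : ℕ → ℕ} (hn : PolyBounded n) :
    PolyBounded fun lam => kappa lam (n lam) :=
  PolyBounded.id.max (hn.pow 4)

/-! ### Correctness of the scheme -/

lemma collisionProb_le_one {n m m' t : ℕ} {K : Type} [Fintype K] [Nonempty K] {κ sl : ℕ}
    (P : LMPublic n m m' t) (F : K → List Bit → BitStr κ) (x : BitStr m) (σ : Fin m → BitStr sl)
    (c : Fin n → Block κ) (r : BitStr t) : collisionProb P F x σ c r ≤ 1 := by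
  rw [← avg_const (α := K) 1]
  refine avg_mono fun k' => ?_
  split_ifs <;> norm_num

/-- A distinguisher without gates. -/
def trivialDistinguisher (κ : ℕ) : Distinguisher κ := ⟨1, [], 0⟩

/-- The distinguishers may be non-uniform, so for each security parameter the worst `x, σ, c, r` can
be hard-wired. This yields one negligible bound for all inputs. -/
theorem schemeCorrectOn {m m' : ℕ → ℕ} (A : LMFamily m m') (tok : TokenScheme)
    (F : KeyedFn A.kap) (hA : A.PolySize) (hc : tok.Correct) (hF : IsPRF F)
    (ψ : ∀ lam : ℕ, QState (Fin (A.n lam))) (ε : ℕ → ℝ)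
    (Q : ∀ lam : ℕ, BitStr (m lam) → BitStr (m' lam)) (hε : Negligible ε)
    (hQ : IsPseudoDet (fun lam => (A.prog lam).evalProb (ψ lam)) ε Q) :
    SchemeCorrectOn tok A F ψ Q := by
  obtain ⟨hm, hm', hn, ht, -⟩ := hA
  have hκ : PolyBounded A.kap := hn.kappa
  have hsl : PolyBounded fun lam => tok.sigLen (A.kap lam) := tok.sigLen_poly.comp hκ
  -- The extra `1` accommodates `trivialDistinguisher`, which has a single wire.
  let size : ℕ → ℕ := fun lam =>
    collSize (A.n lam) (m lam) (A.t lam) (A.kap lam) (tok.sigLen (A.kap lam)) + 1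
  have hsize : PolyBounded size := by
    have hp : PolyBounded fun lam => m lam + m lam * tok.sigLen (A.kap lam) +
        A.n lam * (2 * A.kap lam + 1) :=
      (hm.add (hm.mul hsl)).add (hn.mul (((PolyBounded.const 2).mul hκ).add (.const 1)))
    exact ((((PolyBounded.const 7).mul ((((((ht.add (.const 1)).mul hp).add
      (ht.add (.const 2))).add (ht.mul hκ)).add hκ).add (.const 1))).add ht).add
        (.const 2) |>.add hκ).add (.const 1)
  have key : ∀ lam, ∃ (δ : ℝ) (D : Distinguisher (A.kap lam)), 0 ≤ δ ∧ δ ≤ 1 ∧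
      (∀ x σ c r, collisionProb (sl := tok.sigLen (A.kap lam)) (A.prog lam) (F lam) x σ c r ≤ δ) ∧
      D.size ≤ size lam ∧ (0 < lam → δ ≤ A.t lam * (2 * |avg (fun key => D.accept (F lam key)) -
        avg (fun R : BoundedFn (A.kap lam) D.wires => D.accept R.toOracle)| + 1 / 2 ^ lam)) := by
    intro lam
    let I := BitStr (m lam) × (Fin (m lam) → BitStr (tok.sigLen (A.kap lam))) ×
      (Fin (A.n lam) → Block (A.kap lam)) × BitStr (A.t lam)
    obtain ⟨p, hp⟩ := Finite.exists_max fun p : I =>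
      collisionProb (A.prog lam) (F lam) p.1 p.2.1 p.2.2.1 p.2.2.2
    set δ := collisionProb (A.prog lam) (F lam) p.1 p.2.1 p.2.2.1 p.2.2.2 with hδ
    have h0 : 0 ≤ δ := avg_nonneg fun k' => by split_ifs <;> norm_num
    have h1 : δ ≤ 1 := collisionProb_le_one ..
    have hmax : ∀ x σ c r, collisionProb (sl := tok.sigLen (A.kap lam)) (A.prog lam) (F lam)
        x σ c r ≤ δ := fun x σ c r => hp (x, σ, c, r)
    -- With `t = 0` there are no labels and `δ = 0`; at parameter `0` nothing is claimed.
    by_cases hpos : 1 ≤ lam ∧ 1 ≤ A.t lam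
    · have hk : lam ≤ A.kap lam := le_max_left _ _
      obtain ⟨D, hD, hb⟩ := exists_distinguisher (A.prog lam) (hpos.1.trans hk) hpos.2 (F lam)
        p.1 p.2.1 p.2.2.1 p.2.2.2
      refine ⟨δ, D, h0, h1, hmax, hD.trans (Nat.le_succ _), fun _ => hb.trans ?_⟩
      refine mul_le_mul_of_nonneg_left (add_le_add_right ?_ _) (Nat.cast_nonneg _)
      exact one_div_le_one_div_of_le (by positivity) (pow_le_pow_right₀ (by norm_num) hk)
    · refine ⟨δ, trivialDistinguisher _, h0, h1, hmax, ?_, fun hlam => ?_⟩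
      · exact Nat.succ_le_succ (Nat.zero_le _)
      · have ht0 : A.t lam = 0 := by omega
        have : δ = 0 := by
          rw [hδ, collisionProb]
          have h : ∀ k', ∀ i < A.t lam, Separated (A.prog lam) (F lam k') p.1 p.2.1 p.2.2.1
              p.2.2.2 i := fun k' i hi => absurd hi (by omega)
          simp only [if_pos (h _)]
          exact avg_const 0
        rw [this, ht0]; simp
  choose δ D h0 h1 hmax hD hb using key
  have hadv := hF D (hsize.mono hD)
  have hδ : Negligible δ := by
    refine ((Negligible.poly_mul ((PolyBounded.const 2).mul ht) hadv).add
      (Negligible.poly_mul ht .half_pow)).mono_eventually 0 fun lam hlam => (hb lam hlam).trans ?_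
    apply le_of_eq
    push_cast
    ring
  -- The error `ε` may be negative; its positive part makes `(1 - δ)(1 - ε⁺) ≥ 1 - ε⁺ - δ` hold.
  refine ⟨fun lam => max (ε lam) 0 + δ lam, hε.max_zero.add hδ, fun lam x => ?_⟩
  refine le_trans ?_ (obfEvalProb_ge hc lam (A.prog lam) (F lam) (ψ lam) x (Q lam x) (δ lam)
    (hmax lam x))
  have h2 : 1 - max (ε lam) 0 ≤ (A.prog lam).evalProb (ψ lam) x (Q lam x) :=
    le_trans (by linarith [le_max_left (ε lam) 0]) (hQ lam x)
  have h3 := mul_le_mul_of_nonneg_left h2 (sub_nonneg.mpr (h1 lam))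
  nlinarith [mul_nonneg (h0 lam) (le_max_right (ε lam) 0)]

/-! ### Circuits for linear maps and Pauli operators -/

section Linear

variable {ι : Type} [Fintype ι] [DecidableEq ι]

/-- The circuit maps the standard basis state of `u` to that of `M u`. -/
def Implements (gs : List (Gate ι)) (M : (ι → Bit) ≃ₗ[Bit] (ι → Bit)) : Prop :=
  ∀ (ψ : QState ι) (u : ι → Bit), runGates gs ψ (M u) = ψ u

lemma Implements.append {gs gs' : List (Gate ι)} {M M' : (ι → Bit) ≃ₗ[Bit] (ι → Bit)}
    (h : Implements gs M) (h' : Implements gs' M') : Implements (gs ++ gs') (M.trans M') := by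
  intro ψ u
  rw [runGates_append, LinearEquiv.trans_apply, h', h]

/-- Addition of a multiple of `w` to `u`, where the factor is the coordinate `i` of `u`. -/
def transvect (i : ι) (w : ι → Bit) (hw : w i = 0) : (ι → Bit) ≃ₗ[Bit] (ι → Bit) :=
  LinearEquiv.ofInvolutive
    (LinearMap.id + (LinearMap.proj i : (ι → Bit) →ₗ[Bit] Bit).smulRight w) (by
      intro u
      funext a
      simp [hw, add_assoc, bit_add_self])

lemma transvect_apply (i : ι) (w : ι → Bit) (hw : w i = 0) (u : ι → Bit) :
    transvect i w hw u = u + u i • w := rfl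

lemma implements_cnot (i j : ι) (h : i ≠ j) :
    Implements [Gate.cnot i j h] (transvect i (Pi.single j 1) (Pi.single_eq_of_ne h 1)) := by
  intro ψ u
  rw [runGates_cons, runGates_nil, cnot_apply, transvect_apply]
  congr 1
  funext a
  by_cases ha : a = j
  · subst ha
    simp [h, add_assoc, bit_add_self]
  · simp [ha]

lemma exists_fanout (i : ι) (l : List ι) (hl : i ∉ l) (w : ι → Bit) (hw : w i = 0)
    (h : w = (l.map fun j => Pi.single j 1).sum) :
    ∃ gs : List (Gate ι), gs.length = l.length ∧ Implements gs (transvect i w hw) := by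
  induction l generalizing w with
  | nil =>
    refine ⟨[], rfl, fun ψ u => ?_⟩
    rw [runGates_nil, transvect_apply, h]; simp
  | cons j l ih =>
    have hij : i ≠ j := fun e => hl (e ▸ List.mem_cons_self)
    have hl' : i ∉ l := fun e => hl (List.mem_cons_of_mem _ e)
    have hw' : (l.map fun j => (Pi.single j 1 : ι → Bit)).sum i = 0 := by
      have := congrFun h i
      rw [hw] at this
      simpa [hij] using this.symm
    obtain ⟨gs, hgs, hM⟩ := ih hl' _ hw' rfl
    refine ⟨[Gate.cnot i j hij] ++ gs, by simp [hgs], ?_⟩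
    have := (implements_cnot i j hij).append hM
    convert this using 1
    ext1 u
    rw [LinearEquiv.trans_apply]
    simp only [transvect_apply, h, List.map_cons, List.sum_cons, smul_add, Pi.add_apply,
      Pi.smul_apply, Pi.single_eq_of_ne hij, smul_zero, add_zero, add_assoc]

lemma exists_implements_transvect (i : ι) (w : ι → Bit) (hw : w i = 0) :
    ∃ gs : List (Gate ι), gs.length ≤ Fintype.card ι ∧ Implements gs (transvect i w hw) := by
  classical
  set l := (Finset.univ.filter fun j => w j = 1).toList with hl
  obtain ⟨gs, hgs, hM⟩ := exists_fanout i l (by simp [hl, hw]) w hw (by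
    rw [hl, Finset.sum_map_toList, Finset.sum_filter]
    conv_lhs => rw [pi_eq_sum_univ w]
    refine Finset.sum_congr rfl fun j _ => ?_
    rcases bit_cases (w j) with e | e
    · simp [e]
    · rw [e, if_pos rfl, one_smul]
      funext a
      simp [Pi.single_apply, eq_comm])
  refine ⟨gs, ?_, hM⟩
  rw [hgs, hl, Finset.length_toList]
  exact Finset.card_le_univ _

/-- A transvection adds to the unit vector at `p` the rest of `u`. If `u p = 0`, one further CNOT
controlled by `b`, where `u` is `1`, clears the coordinate `p`. Both steps fix the unit vectors in
`T`. -/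
lemma exists_implements_single (p b : ι) (u : ι → Bit) (hb : u b = 1) (T : Set ι) (hpT : p ∉ T)
    (hbT : b ∉ T) :
    ∃ (gs : List (Gate ι)) (K : (ι → Bit) ≃ₗ[Bit] (ι → Bit)),
      gs.length ≤ Fintype.card ι + 1 ∧ Implements gs K ∧ K (Pi.single p 1) = u ∧
      ∀ a ∈ T, K (Pi.single a 1) = Pi.single a 1 := by
  have hfix : ∀ a ∈ T, a ≠ p ∧ a ≠ b := fun a ha =>
    ⟨fun e => hpT (e ▸ ha), fun e => hbT (e ▸ ha)⟩
  set w := Function.update u p 0 with hw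
  have hwp : w p = 0 := by simp [hw]
  obtain ⟨gs, hgs, hM⟩ := exists_implements_transvect p w hwp
  have hp : transvect p w hwp (Pi.single p 1) = Function.update u p 1 := by
    rw [transvect_apply]
    funext a
    by_cases ha : a = p
    · subst ha; simp [hwp]
    · simp [ha, hw]
  have hT : ∀ a ∈ T, transvect p w hwp (Pi.single a 1) = Pi.single a 1 := by
    intro a ha
    rw [transvect_apply, Pi.single_eq_of_ne (hfix a ha).1.symm]; simp
  rcases bit_cases (u p) with h | h
  · have hbp : b ≠ p := by rintro rfl; rw [h] at hb; exact zero_ne_one hb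
    refine ⟨gs ++ [Gate.cnot b p hbp], _, by simpa using hgs,
      hM.append (implements_cnot b p hbp), ?_, fun a ha => ?_⟩
    · rw [LinearEquiv.trans_apply, hp, transvect_apply]
      funext a
      by_cases ha : a = p
      · subst ha; simp [hbp, hb, h, one_add_one_bit]
      · simp [ha]
    · rw [LinearEquiv.trans_apply, hT a ha, transvect_apply,
        Pi.single_eq_of_ne (hfix a ha).2.symm]
      simp
  · refine ⟨gs, _, by omega, hM, ?_, hT⟩
    rw [hp, ← h, Function.update_eq_self]

/-- Gaussian elimination, one vector at a time; each new step is run before the circuit already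
built. -/
lemma exists_implements_basis {N : ℕ} (p : ℕ) (hp : p ≤ N) (v : Fin p → Fin N → Bit)
    (hv : LinearIndependent Bit v) :
    ∃ (gs : List (Gate (Fin N))) (M : (Fin N → Bit) ≃ₗ[Bit] (Fin N → Bit)),
      gs.length ≤ p * (N + 1) ∧ Implements gs M ∧
      ∀ a, M (Pi.single (Fin.castLE hp a) 1) = v a := by
  induction p with
  | zero => exact ⟨[], LinearEquiv.refl _ _, by simp, fun _ _ => rfl, fun a => a.elim0⟩
  | succ p ih =>
    obtain ⟨hv0, hlast⟩ := linearIndependent_finSucc'.mp hv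
    obtain ⟨gs, M, hgs, hM, hMv⟩ := ih (Nat.le_of_succ_le hp) (Fin.init v) hv0
    set u := M.symm (v (Fin.last p)) with hu
    -- Pulled back by `M`, independence says that `u` is not supported on the first `p` coordinates;
    -- this supplies the control wire `b`.
    have hb : ∃ b : Fin N, p ≤ b.val ∧ u b = 1 := by
      by_contra hcon
      push Not at hcon
      apply hlast
      have h1 : v (Fin.last p) = M u := by rw [hu, LinearEquiv.apply_symm_apply]
      rw [h1, pi_eq_sum_univ' u, map_sum]
      refine Submodule.sum_mem _ fun a _ => ?_
      rw [map_smul]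
      by_cases ha : a.val < p
      · refine Submodule.smul_mem _ _ (Submodule.subset_span ⟨⟨a.val, ha⟩, ?_⟩)
        rw [← hMv]
        rfl
      · rw [(bit_cases (u a)).resolve_right (hcon a (by omega)), zero_smul]
        exact Submodule.zero_mem _
    obtain ⟨b, hbp, hb1⟩ := hb
    obtain ⟨gs', K, hgs', hK, hKu, hKT⟩ := exists_implements_single (⟨p, hp⟩ : Fin N) b u hb1
      {a | a.val < p} (by simp) (by simpa using hbp)
    refine ⟨gs' ++ gs, K.trans M, ?_, hK.append hM, fun a => ?_⟩
    · rw [List.length_append, Nat.succ_mul]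
      rw [Fintype.card_fin] at hgs'
      omega
    · rw [LinearEquiv.trans_apply]
      induction a using Fin.lastCases with
      | last =>
        have : Fin.castLE hp (Fin.last p) = ⟨p, hp⟩ := rfl
        rw [this, hKu, hu, LinearEquiv.apply_symm_apply]
      | cast a =>
        rw [hKT _ (by simp)]
        exact hMv a

/-- The circuit for a product of phase flips. -/
def zsGates (l : List ι) (z : ι → Bit) : List (Gate ι) :=
  l.flatMap fun a => if z a = 1 then zGates a else []

/-- The circuit for a product of bit flips. -/
def xsGates (l : List ι) (x : ι → Bit) : List (Gate ι) :=
  l.flatMap fun a => if x a = 1 then xGates a else []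

lemma length_zsGates_le (l : List ι) (z : ι → Bit) : (zsGates l z).length ≤ 4 * l.length := by
  induction l with
  | nil => simp [zsGates]
  | cons a l ih =>
    have : (zsGates (a :: l) z).length =
        (if z a = 1 then zGates a else []).length + (zsGates l z).length := by
      simp [zsGates]
    rw [this]
    split_ifs
    · simp only [zGates, List.length_cons, List.length_nil]; omega
    · simp only [List.length_cons, List.length_nil]; omega

lemma length_xsGates_le (l : List ι) (x : ι → Bit) : (xsGates l x).length ≤ 6 * l.length := by
  induction l with
  | nil => simp [xsGates]
  | cons a l ih =>
    have : (xsGates (a :: l) x).length =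
        (if x a = 1 then xGates a else []).length + (xsGates l x).length := by
      simp [xsGates]
    rw [this]
    split_ifs
    · simp only [xGates, zGates, List.length_append, List.length_cons, List.length_nil]; omega
    · simp only [List.length_cons, List.length_nil]; omega

lemma runGates_zs (l : List ι) (z : ι → Bit) (ψ : QState ι) :
    runGates (zsGates l z) ψ = fun s => sgn (l.map fun a => z a * s a).sum * ψ s := by
  induction l generalizing ψ with
  | nil => funext s; simp [zsGates]
  | cons a l ih =>
    have : zsGates (a :: l) z = (if z a = 1 then zGates a else []) ++ zsGates l z := by
      simp [zsGates]
    rw [this, runGates_append, ih]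
    funext s
    rw [List.map_cons, List.sum_cons, sgn_add]
    rcases bit_cases (z a) with e | e
    · simp [e]
    · rw [if_pos e, runGates_z, e, one_mul]; ring

lemma runGates_xs (l : List ι) (x : ι → Bit) (ψ : QState ι) :
    runGates (xsGates l x) ψ = fun s => ψ (s + (l.map fun a => Pi.single a (x a)).sum) := by
  induction l generalizing ψ with
  | nil => funext s; simp [xsGates]
  | cons a l ih =>
    have : xsGates (a :: l) x = (if x a = 1 then xGates a else []) ++ xsGates l x := by
      simp [xsGates]
    rw [this, runGates_append, ih]
    funext s
    rw [List.map_cons, List.sum_cons]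
    rcases bit_cases (x a) with e | e
    · simp [e]
    · rw [if_pos e, runGates_x, e]
      beta_reduce
      congr 1
      funext b
      by_cases hb : b = a
      · subst hb; simp only [Function.update_self, Pi.add_apply, Pi.single_eq_same]; ring
      · simp [hb]

end Linear

/-! ### The encoding circuit -/

section Encode

variable {κ n : ℕ}

/-- Hadamard gates on `κ` zero wires produce a uniform superposition over their span, and a linear
circuit carries it to `S` while sending the unit vector of the data wire to `Δ`. Such a circuit
exists because `Δ ∉ S` makes these vectors independent. -/
lemma exists_encAmp_circuit (k : QASKey κ n) :
    ∃ gs : List (Gate (Fin (2 * κ + 1))), gs.length ≤ κ + (κ + 1) * (2 * κ + 2) ∧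
      ∀ b : Bit, runGates gs (basisState (Pi.single 0 b)) = k.encAmp b := by
  classical
  let bS : Module.Basis (Fin κ) Bit k.S := Module.finBasisOfFinrankEq Bit k.S k.1.2.1
  let v : Fin (κ + 1) → Block κ := Fin.cons k.Δ fun i => (bS i : Block κ)
  have hspan : Submodule.span Bit (Set.range fun i => (bS i : Block κ)) = k.S := by
    have := congrArg (Submodule.map k.S.subtype) bS.span_eq
    rw [Submodule.map_span, Submodule.map_top, Submodule.range_subtype, ← Set.range_comp] at this
    exact this
  have hv : LinearIndependent Bit v := by
    refine linearIndependent_finCons.mpr ⟨?_, ?_⟩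
    · exact bS.linearIndependent.map' k.S.subtype k.S.ker_subtype
    · rw [hspan]; exact k.Δ_notMem
  obtain ⟨gs, M, hgs, hM, hMv⟩ := exists_implements_basis (N := 2 * κ + 1) (κ + 1) (by omega) v hv
  have hM0 : M (Pi.single 0 1) = k.Δ := hMv 0
  have hMS : ∀ i : Fin κ, M (Pi.single ⟨i.val + 1, by omega⟩ 1) = bS i := fun i => hMv i.succ
  let l : List (Fin (2 * κ + 1)) := (List.finRange κ).map fun i => ⟨i.val + 1, by omega⟩
  have hmem : ∀ a : Fin (2 * κ + 1), a ∈ l ↔ 1 ≤ a.val ∧ a.val ≤ κ := by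
    intro a
    simp only [l, List.mem_map, List.mem_finRange, true_and]
    constructor
    · rintro ⟨i, rfl⟩; exact ⟨by simp, i.isLt⟩
    · rintro ⟨h1, h2⟩; exact ⟨⟨a.val - 1, by omega⟩, Fin.ext (by simp; omega)⟩
  have hl : l.Nodup := (List.nodup_finRange κ).map fun i j h => by
    simpa [Fin.ext_iff] using h
  have hlen : l.length = κ := by simp [l]
  -- Under `M`, the subspace `S` corresponds to the strings supported on the Hadamard wires `l`.
  have hS : ∀ u : Block κ, M u ∈ k.S ↔ ∀ w, w ∉ l → u w = 0 := by
    intro u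
    constructor
    · intro h w hw
      have h1 : M u = M (∑ i : Fin κ, bS.repr ⟨M u, h⟩ i •
          (Pi.single ⟨i.val + 1, by omega⟩ 1 : Block κ)) := by
        rw [map_sum]
        simp only [map_smul, hMS]
        have := congrArg k.S.subtype (bS.sum_repr ⟨M u, h⟩)
        rw [map_sum] at this
        exact this.symm
      rw [M.injective h1, Finset.sum_apply]
      refine Finset.sum_eq_zero fun i _ => ?_
      rw [Pi.smul_apply, Pi.single_eq_of_ne, smul_zero]
      rintro rfl
      exact hw ((hmem _).mpr ⟨by simp, i.isLt⟩)
    · intro h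
      rw [pi_eq_sum_univ' u, map_sum]
      refine Submodule.sum_mem _ fun a _ => ?_
      rw [map_smul]
      by_cases ha : a ∈ l
      · obtain ⟨i, -, rfl⟩ := List.mem_map.mp ha
        refine Submodule.smul_mem _ _ ?_
        have h2 := hMS i
        rw [h2]
        exact (bS i).2
      · rw [h a ha, zero_smul]; exact Submodule.zero_mem _
  have hrt : rt ^ κ = 1 / (Real.sqrt (2 ^ κ) : ℂ) := by
    have h : Real.sqrt (2 ^ κ) = Real.sqrt 2 ^ κ := by
      rw [Real.sqrt_eq_rpow, Real.sqrt_eq_rpow, ← Real.rpow_natCast, ← Real.rpow_natCast,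
        ← Real.rpow_mul (by norm_num), ← Real.rpow_mul (by norm_num), mul_comm]
    rw [h, rt, one_div_pow]
    push_cast
    rfl
  refine ⟨l.map Gate.had ++ gs, ?_, fun b => ?_⟩
  · rw [List.length_append, List.length_map, hlen]
    exact Nat.add_le_add_left hgs _
  · funext c
    obtain ⟨u, rfl⟩ := M.surjective c
    rw [runGates_append, hM]
    change hadList l _ u = _
    rw [hadList_apply l hl, hlen, Finset.sum_eq_single (Pi.single 0 b)]
    · have h0 : (0 : Fin (2 * κ + 1)) ∉ l := by rw [hmem]; simp
      have hz : ∑ w ∈ l.toFinset, u w * (Pi.single 0 b : Block κ) w = 0 :=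
        Finset.sum_eq_zero fun w hw => by
          rw [Pi.single_eq_of_ne, mul_zero]
          rintro rfl
          exact h0 (List.mem_toFinset.mp hw)
      rw [hz, sgn_zero, one_mul, QASKey.encAmp]
      have hb : b • k.Δ = M (Pi.single 0 b) := by
        rw [← hM0, ← map_smul]
        congr 1
        funext j
        by_cases hj : j = 0
        · subst hj; simp
        · simp [hj]
      rw [hb, ← map_sub, hS]
      simp only [basisState, if_true, mul_ite, mul_one, mul_zero, hrt]
      have hiff : (∀ w, w ∉ l → (Pi.single 0 b : Block κ) w = u w) ↔
          ∀ w, w ∉ l → (u - (Pi.single 0 b : Block κ)) w = 0 :=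
        forall₂_congr fun w _ => by rw [Pi.sub_apply, sub_eq_zero, eq_comm]
      by_cases hh : ∀ w, w ∉ l → (u - (Pi.single 0 b : Block κ)) w = 0
      · rw [if_pos hh, if_pos (hiff.mpr hh)]
      · rw [if_neg hh, if_neg (mt hiff.mp hh)]
    · intro w _ hw
      rw [basisState, if_neg hw, mul_zero, ite_self]
    · intro h; exact absurd (Finset.mem_univ _) h

lemma exists_stdAmp_circuit (k : QASKey κ n) (q : QASKey.Pauli κ n) (w : Fin n) :
    ∃ gs : List (Gate (Fin (2 * κ + 1))),
      gs.length ≤ κ + (κ + 1) * (2 * κ + 2) + 10 * (2 * κ + 1) ∧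
      ∀ b : Bit, runGates gs (basisState (Pi.single 0 b)) = k.stdAmp q w b := by
  obtain ⟨gs, hgs, h⟩ := exists_encAmp_circuit k
  refine ⟨gs ++ zsGates (List.finRange _) (q.2 w) ++ xsGates (List.finRange _) (q.1 w), ?_,
    fun b => ?_⟩
  · have h1 := length_zsGates_le (List.finRange (2 * κ + 1)) (q.2 w)
    have h2 := length_xsGates_le (List.finRange (2 * κ + 1)) (q.1 w)
    rw [List.length_finRange] at h1 h2
    rw [List.length_append, List.length_append]
    omega
  · rw [runGates_append, runGates_append, h, runGates_zs, runGates_xs]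
    funext c
    have h1 : ((List.finRange (2 * κ + 1)).map fun a => (Pi.single a (q.1 w a) : Block κ)).sum =
        q.1 w := by
      rw [← List.ofFn_eq_map, List.sum_ofFn]
      exact Finset.univ_sum_single _
    have h2 : c + q.1 w = c - q.1 w := by
      funext a; exact (CharTwo.sub_eq_add _ _).symm
    have h3 : ∀ s : Block κ, ((List.finRange (2 * κ + 1)).map fun a => q.2 w a * s a).sum =
        dotProduct (q.2 w) s := by
      intro s
      rw [← List.ofFn_eq_map, List.sum_ofFn]
      rfl
    simp only [h1, h2, h3]
    rfl

lemma runGates_blocks {ν β : Type} [Fintype ν] [DecidableEq ν] [Fintype β] [DecidableEq β]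
    (gs : ν → List (Gate β)) (A B : ν → Bit → QState β)
    (l : List ν) (hl : l.Nodup) (h : ∀ w ∈ l, ∀ b, runGates (gs w) (A w b) = B w b)
    (ψ : QState ν) :
    runGates (l.flatMap fun w => (gs w).map (Gate.onBlock w)) (encWith A ψ) =
      encWith (fun w => if w ∈ l then B w else A w) ψ := by
  induction l generalizing A with
  | nil => simp
  | cons w l ih =>
    obtain ⟨hw, hl⟩ := List.nodup_cons.mp hl
    rw [List.flatMap_cons, runGates_append, runGates_onBlock_encWith, ih]
    · congr 1
      funext w'
      by_cases e : w' = w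
      · subst e
        rw [if_neg hw, if_pos List.mem_cons_self, Function.update_self]
        funext b
        exact h w' List.mem_cons_self b
      · simp only [List.mem_cons, e, false_or, Function.update_of_ne e]
    · exact hl
    · intro w' hw' b
      rw [Function.update_of_ne (by rintro rfl; exact hw hw')]
      exact h w' (List.mem_cons_of_mem _ hw') b

theorem exists_enc_circuit (k : QASKey κ n) :
    ∃ gs : List (Gate (Fin n × Fin (2 * κ + 1))),
      gs.length ≤ n * (κ + (κ + 1) * (2 * κ + 2) + 10 * (2 * κ + 1)) ∧
      ∀ ψ, runGates gs (padBlocks ψ) = k.enc ψ := by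
  choose gs hgs h using exists_stdAmp_circuit k (k.x, k.z)
  refine ⟨(List.finRange n).flatMap fun w => (gs w).map (Gate.onBlock w), ?_, fun ψ => ?_⟩
  · rw [List.length_flatMap]
    refine (List.sum_le_card_nsmul _ (κ + (κ + 1) * (2 * κ + 2) + 10 * (2 * κ + 1)) ?_).trans ?_
    · intro x hx
      obtain ⟨w, -, rfl⟩ := List.mem_map.mp hx
      rw [List.length_map]
      exact hgs w
    · simp
  · have hpad : padBlocks ψ =
        encWith (fun (_ : Fin n) b => basisState (Pi.single (0 : Fin (2 * κ + 1)) b)) ψ := by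
      funext c
      unfold padBlocks encWith basisState
      have hiff : ∀ b : BitStr n, (∀ w, (fun a => c (w, a)) = Pi.single 0 (b w)) ↔
          (∀ i, ∀ a, a ≠ 0 → c (i, a) = 0) ∧ (fun i => c (i, 0)) = b := by
        intro b
        constructor
        · intro hb
          refine ⟨fun i a ha => ?_, funext fun i => ?_⟩
          · rw [congrFun (hb i) a, Pi.single_eq_of_ne ha]
          · rw [congrFun (hb i) 0, Pi.single_eq_same]
        · rintro ⟨h1, rfl⟩ w
          funext a
          by_cases ha : a = 0
          · subst ha; simp
          · rw [h1 w a ha, Pi.single_eq_of_ne ha]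
      simp only [Finset.prod_ite_zero, Finset.mem_univ, true_imp_iff, hiff,
        Finset.prod_const_one, mul_ite, mul_one, mul_zero]
      split_ifs with h1
      · have h2 : ∀ b : BitStr n, ((∀ i, ∀ a, a ≠ 0 → c (i, a) = 0) ∧
            (fun i => c (i, 0)) = b) ↔ (fun i => c (i, 0)) = b := fun b => and_iff_right h1
        simp only [h2, Finset.sum_ite_eq, Finset.mem_univ, if_true]
      · simp only [h1, false_and, if_false, Finset.sum_const_zero]
    rw [hpad, k.enc_eq, runGates_blocks gs _ (fun w => k.stdAmp (k.x, k.z) w) _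
      (List.nodup_finRange n) fun w _ => h w]
    simp only [List.mem_finRange, if_true]
    rfl

end Encode

/-! ### Running time of the scheme -/

section Length

variable {n m m' t : ℕ}

lemma length_linEvalGates (κ : ℕ) (L : LinOp n) :
    (linEvalGates κ L).length = L.length * (2 * κ + 1) := by
  simp [linEvalGates, List.length_flatMap]

lemma length_encHadGates_le (κ : ℕ) (θ : Bases n) :
    (encHadGates κ θ).length ≤ n * (2 * κ + 1) := by
  have h : θ.hadWires.length ≤ n := by
    refine (List.length_filter_le _ _).trans ?_
    rw [List.length_finRange]
  calc (encHadGates κ θ).length = θ.hadWires.length * (2 * κ + 1) := by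
        simp [encHadGates, List.length_flatMap]
    _ ≤ _ := Nat.mul_le_mul_right _ h

lemma length_qevalProgram_le (κ : ℕ) (P : LMPublic n m m' t) :
    (qevalProgram κ P).length ≤
      P.linSize * (2 * κ + 1) + (t + 1) * (2 * (n * (2 * κ + 1)) + 1) := by
  have h1 : (qevalProgram κ P).length ≤ (∑ i : Fin t, ((P.L i.castSucc).length * (2 * κ + 1) +
      (2 * (n * (2 * κ + 1)) + 1))) + ((P.L (Fin.last t)).length * (2 * κ + 1) +
      (2 * (n * (2 * κ + 1)) + 1)) := by
    rw [qevalProgram, List.length_append, List.length_append, List.length_flatMap,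
      ← Fin.sum_univ_def, add_assoc]
    refine add_le_add (Finset.sum_le_sum fun i _ => ?_) ?_
    · have := length_encHadGates_le κ (P.θ i.castSucc)
      simp only [List.length_append, List.length_map, List.length_cons, List.length_nil,
        length_linEvalGates]
      omega
    · have := length_encHadGates_le κ (P.θ (Fin.last t))
      simp only [List.length_append, List.length_map, List.length_cons, List.length_nil,
        length_linEvalGates]
      omega
  refine h1.trans (le_of_eq ?_)
  rw [LMPublic.linSize, Fin.sum_univ_castSucc, Finset.sum_add_distrib, add_mul, Finset.sum_mul]
  simp only [Finset.sum_const, Finset.card_univ, Fintype.card_fin, smul_eq_mul]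
  ring

end Length

theorem schemePolyTime {m m' : ℕ → ℕ} (tok : TokenScheme) (A : LMFamily m m') (hA : A.PolySize) :
    SchemePolyTime tok A := by
  obtain ⟨hm, hm', hn, ht, hL⟩ := hA
  have hκ : PolyBounded A.kap := hn.kappa
  have h2 : PolyBounded fun lam => 2 * A.kap lam := (PolyBounded.const 2).mul hκ
  have h21 : PolyBounded fun lam => 2 * A.kap lam + 1 := h2.add (.const 1)
  refine ⟨(hn.mul h21).add (hm.mul (tok.skQubits_poly.comp hκ)), ⟨fun lam => A.n lam *
    (A.kap lam + (A.kap lam + 1) * (2 * A.kap lam + 2) + 10 * (2 * A.kap lam + 1)),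
    hn.mul ((hκ.add ((hκ.add (.const 1)).mul (h2.add (.const 2)))).add
      ((PolyBounded.const 10).mul h21)), fun lam k => exists_enc_circuit k⟩, ?_⟩
  exact ((hL.mul h21).add ((ht.add (.const 1)).mul
    (((PolyBounded.const 2).mul (hn.mul h21)).add (.const 1)))).mono
      fun lam => length_qevalProgram_le _ _

/-! ### The scheme for a general and for a universal family. -/

theorem scheme_of_polySize {m m' : ℕ → ℕ} (A : LMFamily m m') (tok : TokenScheme)
    (F : KeyedFn A.kap) (hA : A.PolySize) (hc : tok.Correct) (hF : IsPRF F) :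
    SchemePolyTime tok A ∧
      ∀ (ψ : ∀ lam : ℕ, QState (Fin (A.n lam))) (ε : ℕ → ℝ)
        (Q : ∀ lam : ℕ, BitStr (m lam) → BitStr (m' lam)),
        Negligible ε → IsPseudoDet (fun lam => (A.prog lam).evalProb (ψ lam)) ε Q →
        SchemeCorrectOn tok A F ψ Q :=
  ⟨schemePolyTime tok A hA, fun ψ ε Q hε hQ => schemeCorrectOn A tok F hA hc hF ψ ε Q hε hQ⟩

theorem universal_scheme {n m m' : ℕ → ℕ} (U : UniversalLM n m m') (hU : U.IsUniversal)
    (tok : TokenScheme) (F : KeyedFn U.fam.kap) (hc : tok.Correct) (hF : IsPRF F) :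
    SchemePolyTime tok U.fam ∧
      ∀ (C : ∀ lam : ℕ, QCircuit (m lam) (n lam) (m' lam))
        (φ : ∀ lam : ℕ, QState (Fin (n lam))) (ε : ℕ → ℝ)
        (Q : ∀ lam : ℕ, BitStr (m lam) → BitStr (m' lam)),
        (∀ lam, (C lam).gates.length ≤ n lam) → (∀ lam, IsPure (φ lam)) →
        Negligible ε → IsPseudoDet (fun lam => (C lam).outProb (φ lam)) ε Q →
        SchemeCorrectOn tok U.fam F (fun lam => U.input lam (C lam) (φ lam)) Q := by
  obtain ⟨hP, -, -, hev⟩ := hU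
  refine ⟨schemePolyTime tok _ hP, fun C φ ε Q hC hφ hε hQ => ?_⟩
  refine schemeCorrectOn U.fam tok F hP hc hF _ ε Q hε fun lam x => ?_
  exact (hQ lam x).trans_eq (hev lam (C lam) (φ lam) (hC lam) (hφ lam) x (Q lam x)).symm

/-! ### Programs without linear operations -/

/-- A program whose layers only measure. Wire `w` is read in the standard basis in layer `ρ w`,
and it is collapsed in the basis `b w` in layer `τ w`. The functions are given on strings of all
wires and all results, where what has not been measured is replaced by zeros. -/
structure MeasProgram (N m m' t : ℕ) where
  ρ : Fin N → ℕ
  τ : Fin N → ℕ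
  τ_le : ∀ w, τ w ≤ t
  b : Fin N → Bit
  f : Fin t → BitStr m → BitStr t → (Fin N → Bit) → Bit
  g : BitStr m → BitStr t → (Fin N → Bit) → BitStr m'

namespace MeasProgram

variable {N m m' t : ℕ} (M : MeasProgram N m m' t)

/-- The bases of layer `i`. -/
def basis (i : ℕ) : Bases N := fun w =>
  if M.τ w ≤ i then some (M.b w) else if M.ρ w = i then some 0 else none

lemma mem_Phi_basis (i : ℕ) (w : Fin N) :
    w ∈ (M.basis i).Phi ↔ M.τ w ≤ i ∨ M.ρ w = i := by
  rw [Bases.Phi, Finset.mem_filter, basis]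
  by_cases h1 : M.τ w ≤ i <;> by_cases h2 : M.ρ w = i <;> simp only [h1, h2] <;> simp

/-- The results before layer `i`. -/
def past (i : ℕ) (r : BitStr t) : BitStr t := fun j => if j.val < i then r j else 0

/-- The measured string as the string of all wires. -/
def extend (i : ℕ) (s : {w // w ∈ (M.basis i).Phi} → Bit) : Fin N → Bit := fun w =>
  if h : w ∈ (M.basis i).Phi then s ⟨w, h⟩ else 0

/-- The string that layer `i` obtains, when `s` is the outcome of the final measurement and `u` is
the content of the wires before. -/
def mix (i : ℕ) (s u : Fin N → Bit) : Fin N → Bit := fun w =>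
  if M.τ w ≤ i then s w else if M.ρ w = i then u w else 0

/-- The classical part of the LM program. -/
def toLM : LMPublic N m m' t where
  L := fun _ => []
  θ := fun i => M.basis i
  V := fun i => Finset.univ.filter fun w => M.τ w = i
  f := fun i x r s => M.f i x (fun j => if h : j.val < i.val then r ⟨j, h⟩ else 0) (M.extend i s)
  g := fun x r s => M.g x r (M.extend t s)
  V_disjoint := by
    intro i j hij
    refine Finset.disjoint_left.mpr fun w hi hj => hij (Fin.ext ?_)
    exact (Finset.mem_filter.mp hi).2.symm.trans (Finset.mem_filter.mp hj).2
  V_subset := by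
    intro i j hji w hw
    have h : M.τ w ≤ i.val := (Finset.mem_filter.mp hw).2.le.trans hji
    exact (M.mem_Phi_basis i w).mpr (Or.inl h)
  V_cover := fun w => ⟨⟨M.τ w, Nat.lt_succ_of_le (M.τ_le w)⟩, by simp⟩
  θ_stable := by
    intro i j hji w hw
    have h : M.τ w = j.val := (Finset.mem_filter.mp hw).2
    have h' : M.τ w ≤ i.val := h.le.trans hji
    simp [basis, h']
    omega
  L_fresh := fun _ _ _ c hc => absurd hc List.not_mem_nil

lemma linSize_toLM : M.toLM.linSize = 0 := by
  simp [LMPublic.linSize, toLM]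

/-- A wire measured but not yet collapsed in layer `i` must have reading time `i`, so it is in the
standard basis and occurs in no earlier measurement. There are no CNOT gates to check. -/
lemma collapsible_toLM : M.toLM.Collapsible := by
  intro i w hw
  obtain ⟨h1, h2⟩ := Finset.mem_filter.mp hw
  have hτ : ¬ M.τ w ≤ i.val := by
    intro h
    refine h2 ⟨M.τ w, by have := i.isLt; omega⟩ h ?_
    simp [toLM]
  have hρ : M.ρ w = i.val := by
    exact ((M.mem_Phi_basis i w).mp h1).resolve_left hτ
  refine ⟨by simp [toLM, basis, hτ, hρ], fun j hj => ?_, fun _ _ c hc => absurd hc List.not_mem_nil⟩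
  have hj' : j.val < i.val := hj
  have h3 : ¬ M.τ w ≤ j.val := by omega
  have h4 : M.ρ w ≠ j.val := by omega
  exact fun h => ((M.mem_Phi_basis j w).mp h).elim h3 h4

lemma mem_below (w : Fin N) (i : ℕ) : w ∈ M.toLM.below i ↔ M.τ w < i := by
  constructor
  · rintro ⟨j, hj, hw⟩
    have : M.τ w = j.val := (Finset.mem_filter.mp hw).2
    omega
  · intro h
    exact ⟨⟨M.τ w, Nat.lt_succ_of_le (M.τ_le w)⟩, h, by simp [toLM]⟩

lemma extend_eq_mix (i : ℕ) (s u : Fin N → Bit) (h : ∀ w, M.τ w ≤ i → u w = s w) :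
    M.extend i (fun w => u w.1) = M.mix i s u := by
  funext w
  unfold extend mix
  by_cases h1 : M.τ w ≤ i
  · have : w ∈ (M.basis i).Phi := (M.mem_Phi_basis i w).mpr (Or.inl h1)
    rw [dif_pos this, if_pos h1]; exact h w h1
  · by_cases h2 : M.ρ w = i
    · have : w ∈ (M.basis i).Phi := (M.mem_Phi_basis i w).mpr (Or.inr h2)
      rw [dif_pos this, if_neg h1, if_pos h2]
    · have : w ∉ (M.basis i).Phi := fun h => ((M.mem_Phi_basis i w).mp h).elim h1 h2
      rw [dif_neg this, if_neg h1, if_neg h2]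

lemma mix_congr (i : ℕ) {s s' : Fin N → Bit} (u : Fin N → Bit)
    (h : ∀ w, M.τ w ≤ i → s w = s' w) : M.mix i s u = M.mix i s' u := by
  funext w
  unfold mix
  by_cases h1 : M.τ w ≤ i
  · rw [if_pos h1, if_pos h1, h w h1]
  · rw [if_neg h1, if_neg h1]

/-- The wires that are collapsed in the Hadamard basis. -/
def xWires : List (Fin N) := (List.finRange N).filter fun w => decide (M.b w = 1)

/-- The condition that the final string `s` and the initial string `u` lead to the results `r`. -/
def cond (x : BitStr m) (r : BitStr t) (s u : Fin N → Bit) (i : Fin t) : Prop :=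
  M.f i x (past i r) (M.mix i s u) = r i

/-- The Hadamard wires of layer `i` are already collapsed, and with those wires frozen at `s` the
condition ignores their content. The basis changes around each projection therefore cancel, and all
projections merge into one in the standard basis. -/
lemma finish_residual (x : BitStr m) (r : BitStr t) (s : Fin N → Bit) (ψ : QState (Fin N)) :
    M.toLM.finish (M.toLM.residual (fun i u => M.cond x r s u i) ψ) =
      hadList M.xWires (project (fun u => ∀ i, M.cond x r s u i) ψ) := by
  have h1 : ∀ (i : Fin t) φ, measureStep (M.toLM.L i.castSucc).gates
      (M.toLM.θ i.castSucc).hadWires (fun u => M.cond x r s u i) φ =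
      project (fun u => M.cond x r s u i) φ := by
    intro i φ
    change hadList _ (project _ (hadList _ φ)) = _
    rw [hadList_project (T := {w | ¬ M.τ w ≤ i}), hadList_hadList]
    · intro u u' h
      have : M.mix i s u = M.mix i s u' := by
        funext w
        unfold mix
        by_cases h1 : M.τ w ≤ i.val
        · rw [if_pos h1, if_pos h1]
        · rw [if_neg h1, if_neg h1, h w h1]
      simp only [cond, this]
    · intro w hw
      rw [Bases.mem_hadWires] at hw
      by_contra h
      have h' : ¬ M.τ w ≤ i.val := h
      simp only [toLM, basis, Fin.val_castSucc, if_neg h'] at hw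
      split_ifs at hw
      exact zero_ne_one (Option.some.inj hw)
  have h2 : ∀ (l : List (Fin t)) φ, l.foldl (fun φ i => measureStep (M.toLM.L i.castSucc).gates
      (M.toLM.θ i.castSucc).hadWires (fun u => M.cond x r s u i) φ) φ =
      project (fun u => ∀ i ∈ l, M.cond x r s u i) φ := by
    intro l
    induction l with
    | nil => intro φ; simp [project_true]
    | cons i l ih =>
      intro φ
      rw [List.foldl_cons, ih, h1, project_project]
      refine project_congr (fun u => ?_) _
      simp [and_comm]
  unfold LMPublic.residual
  rw [h2]
  have h3 : (M.toLM.θ (Fin.last t)).hadWires = M.xWires := by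
    unfold Bases.hadWires xWires
    congr 1
    funext w
    simp [toLM, basis, M.τ_le]
  rw [LMPublic.finish, h3]
  simp only [List.mem_finRange, true_imp_iff]
  rfl

open Classical in
-- Although the functions use outcomes of earlier Hadamard measurements, deferral allows the final
-- outcome `s` to be fixed first; the program is then one projection followed by one Hadamard
-- transform.
theorem evalProb_toLM (ψ : QState (Fin N)) (x : BitStr m) (y : BitStr m') :
    M.toLM.evalProb ψ x y = ∑ r : BitStr t, ∑ s : Fin N → Bit, if M.g x r s = y then
      ‖hadList M.xWires (project (fun u => ∀ i, M.cond x r s u i) ψ) s‖ ^ 2 else 0 := by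
  unfold LMPublic.evalProb
  refine Finset.sum_congr rfl fun r _ => ?_
  have h1 : ∀ v : (i : Fin t) → {w // w ∈ M.toLM.V i.castSucc} → Bit,
      weight (project (fun s : Fin N → Bit => M.toLM.g x r (fun w => s w.1) = y)
        (runGates ((M.toLM.L (Fin.last t)).gates ++ (M.toLM.θ (Fin.last t)).hadGates)
          ((List.finRange t).foldl (M.toLM.layer x r v) ψ))) =
      ∑ s : Fin N → Bit, if (fun (i : Fin t) (w : {w // w ∈ M.toLM.V i.castSucc}) => s w.1) = v
        then (if M.g x r s = y then
          ‖hadList M.xWires (project (fun u => ∀ i, M.cond x r s u i) ψ) s‖ ^ 2 else 0) else 0 := by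
    intro v
    rw [runGates_append]
    have h := M.toLM.foldl_layer x r v (fun i u => M.cond x r (M.toLM.join v) u i)
      (fun i s hs => ?_) ψ
    · have h' : ∀ φ, runGates (M.toLM.θ (Fin.last t)).hadGates
          (runGates (M.toLM.L (Fin.last t)).gates φ) = M.toLM.finish φ := fun _ => rfl
      rw [h', h, finish_residual]
      refine Finset.sum_congr rfl fun s _ => ?_
      simp only [project_apply]
      have hg : M.toLM.g x r (fun w => s w.1) = M.g x r s := by
        change M.g x r (M.extend t fun w => s w.1) = _
        rw [M.extend_eq_mix t s s fun _ _ => rfl]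
        congr 1
        funext w
        simp [mix, M.τ_le]
      rw [hg]
      have hv := M.toLM.eq_join_iff v s
      by_cases ha : Agree (M.toLM.below t) (M.toLM.join v) s
      · rw [if_pos ha, if_pos (hv.mp ha)]
        have hc : ∀ u i, M.cond x r (M.toLM.join v) u i ↔ M.cond x r s u i := by
          intro u i
          unfold cond
          rw [M.mix_congr i u fun w hw => (ha w ?_).symm]
          exact (M.mem_below w t).mpr (lt_of_le_of_lt hw i.isLt)
        simp only [hc]
        split_ifs <;> simp
      · rw [if_neg ha, if_neg (mt hv.mpr ha)]
        split_ifs <;> simp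
    · unfold cond
      have he : M.extend i (fun w => s w.1) = M.mix i (M.toLM.join v) s :=
        M.extend_eq_mix i _ s fun w hw => hs w ((M.mem_below w (i + 1)).mpr
          (Nat.lt_succ_of_le hw))
      rw [← he]
      have hp : (fun j : Fin t => if h : j.val < i.val then
          r (Fin.castLE i.isLt.le ⟨j, h⟩) else 0) = past i r := by
        funext j
        unfold past
        split_ifs <;> rfl
      rw [← hp]
      rfl
  simp only [h1]
  rw [Finset.sum_comm]
  simp only [Finset.sum_ite_eq, Finset.mem_univ, if_true]

end MeasProgram

/-! ### Computation by measurements on one slot -/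

/-- The phase of the `T` gate. -/
def tph (b : Bit) : ℂ := if b = 0 then 1 else Complex.exp (Complex.I * (Real.pi / 4 : ℝ))

/-- The phase of the `S` gate. -/
def sph (b : Bit) : ℂ := tph b * tph b

lemma tph_zero : tph 0 = 1 := if_pos rfl

lemma norm_tph (b : Bit) : ‖tph b‖ = 1 := by
  unfold tph
  split_ifs
  · simp
  · rw [mul_comm Complex.I, Complex.norm_exp_ofReal_mul_I]

lemma norm_sph (b : Bit) : ‖sph b‖ = 1 := by
  rw [sph, norm_mul, norm_tph, one_mul]

/-- Removal of the masks `a` and `b` from the phases. -/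
lemma tph_mul_sph (h a b : Bit) :
    tph (h + a) * sph (a * h + b) = tph a * sph b * tph h * sgn (h * a * b) := by
  have h4 : tph 1 * tph 1 * (tph 1 * tph 1) = -1 := by
    have := tphase_pow_four
    have h1 : tph 1 = Complex.exp (Complex.I * (Real.pi / 4 : ℝ)) := if_neg one_ne_zero
    rw [← h1] at this
    rw [← this]; ring
  rcases bit_cases h with rfl | rfl <;> rcases bit_cases a with rfl | rfl <;>
    rcases bit_cases b with rfl | rfl <;>
    simp only [zero_add, add_zero, mul_zero, mul_one, one_mul, tph_zero,
      sgn_zero, sgn_one, one_add_one_bit, sph]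
  · ring
  · linear_combination h4

section Slot

variable {ι : Type} [Fintype ι] [DecidableEq ι]

/-- The contents of a register of the qubits `ι` and a junk qubit. -/
abbrev Reg (ι : Type) : Type := Option ι → Bit

/-- The variables of a slot: the outgoing register and three further ancillas. -/
abbrev SlotVar (ι : Type) : Type := Option ι ⊕ Fin 3

/-- An operation on the register: a phase `T` on the value of `h`, then the linear map `M`, then a
Hadamard gate on the junk qubit. -/
structure SlotOp (ι : Type) where
  M : Reg ι ≃ₗ[Bit] Reg ι
  h : Reg ι →ₗ[Bit] Bit

/-- The action on states. -/
def SlotOp.apply (o : SlotOp ι) (χ : QState (Option ι)) : QState (Option ι) :=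
  (Gate.had none).apply fun Y => tph (o.h (o.M.symm Y)) * χ (o.M.symm Y)

/-- The measurement results of a slot: one for each wire of the register (where that of the
junk qubit belongs to the ancilla of the Hadamard gate), and two for the `T` gate. -/
structure SlotRes (ι : Type) where
  c : Reg ι
  T : Bit
  S : Bit

/-- Pauli corrections: bit flips `a` and phase flips `β`. -/
structure Frame (ι : Type) where
  a : Reg ι
  β : Reg ι

/-- The exponent of the phase flip on the slot output `j` before the Hadamard gate. -/
def Frame.dual (q : Frame ι) (o : SlotOp ι) (r : SlotRes ι) (s : SlotVar ι → Bit)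
    (j : Option ι) : Bit :=
  dotProduct q.β (o.M.symm (Pi.single j 1)) +
    (r.T * r.S + s (.inr 1) + r.T * s (.inr 2)) * o.h (o.M.symm (Pi.single j 1))

/-- The Pauli corrections after a slot with results `r`, when `s` are the outcomes of the Hadamard
basis measurements of the slot variables. -/
def Frame.next (q : Frame ι) (o : SlotOp ι) (r : SlotRes ι) (s : SlotVar ι → Bit) : Frame ι where
  a := fun j => match j with
    | none => q.dual o r s none + s (.inr 0)
    | some i => r.c (some i)
  β := fun j => (match j with
    | none => r.c none
    | some i => q.dual o r s (some i)) + s (.inl j)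

/-- The condition on the incoming register `A` and the slot variables `b` for the results `r`. -/
def slotCond (o : SlotOp ι) (a : Reg ι) (r : SlotRes ι) (A : Reg ι) (b : SlotVar ι → Bit) : Prop :=
  (∀ j, (match j with | none => b (.inr 0) | some i => b (.inl (some i))) + o.M (A + a) j = r.c j) ∧
    b (.inr 1) + o.h (A + a) = r.T ∧ b (.inr 2) + r.T * o.h (A + a) = r.S

/-- The amplitudes of the slot variables, up to normalisation. -/
def slotAmp (b : SlotVar ι → Bit) : ℂ :=
  sgn (b (.inr 0) * b (.inl none)) * (tph (b (.inr 1)) * sph (b (.inr 2)))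

open Classical in
/-- The contribution of a slot to the amplitude of a path. -/
def slotWeight (o : SlotOp ι) (a : Reg ι) (r : SlotRes ι) (s : SlotVar ι → Bit) (A : Reg ι)
    (b : SlotVar ι → Bit) : ℂ :=
  if slotCond o a r A b then sgn (∑ v, s v * b v) * slotAmp b else 0

lemma sum_all_but_one {ν : Type} [Fintype ν] [DecidableEq ν] (i : ν) (s : ν → Bit)
    (f : (ν → Bit) → ℂ) :
    ∑ Y : ν → Bit, (if ∀ w, w ≠ i → Y w = s w then f Y else 0) =
      f (Function.update s i 0) + f (Function.update s i 1) := by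
  have hne : Function.update s i (0 : Bit) ≠ Function.update s i 1 := by
    intro h
    have := congrFun h i
    simp at this
  rw [← Finset.sum_filter, ← Finset.sum_pair hne]
  refine Finset.sum_congr ?_ fun _ _ => rfl
  ext Y
  simp only [Finset.mem_filter, Finset.mem_univ, true_and, Finset.mem_insert,
    Finset.mem_singleton]
  constructor
  · intro h
    have h' : ∀ b, Y i = b → Y = Function.update s i b := by
      intro b hb
      funext w
      by_cases hw : w = i
      · subst hw; rw [hb, Function.update_self]
      · rw [h w hw, Function.update_of_ne hw]
    exact (bit_cases (Y i)).imp (h' 0) (h' 1)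
  · rintro (rfl | rfl) w hw <;> rw [Function.update_of_ne hw]

lemma linear_eq_sum {ν : Type} [Fintype ν] [DecidableEq ν] (F : (ν → Bit) →ₗ[Bit] Bit)
    (Y : ν → Bit) : F Y = ∑ j, F (Pi.single j 1) * Y j := by
  conv_lhs => rw [pi_eq_sum_univ' Y, map_sum]
  refine Finset.sum_congr rfl fun j _ => ?_
  rw [map_smul, smul_eq_mul, mul_comm]

lemma reg_add_self (a : Reg ι) : a + a = 0 := funext fun _ => bit_add_self _

lemma bit_add_eq_iff (a b c : Bit) : a + b = c ↔ a = b + c := by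
  constructor
  · rintro rfl
    rw [add_left_comm, bit_add_self, add_zero]
  · rintro rfl
    rw [add_right_comm, bit_add_self, zero_add]

/-- The values of the slot variables for given results. -/
def slotVal (o : SlotOp ι) (r : SlotRes ι) (X : Reg ι) (R : Reg ι) : SlotVar ι → Bit :=
  Sum.elim R ![o.M X none + r.c none, o.h X + r.T, r.T * o.h X + r.S]

/-- The results determine every slot variable from the incoming and the outgoing register, and tie
these two registers in all coordinates except that of the junk qubit, which stays free. -/
lemma slotCond_iff (o : SlotOp ι) (a : Reg ι) (r : SlotRes ι) (A : Reg ι) (b : SlotVar ι → Bit)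
    (R : Reg ι) :
    ((fun j => b (.inl j)) = R ∧ slotCond o a r A b) ↔
      ((∀ j, j ≠ none → o.M (A + a) j = (R + r.c) j) ∧ b = slotVal o r (A + a) R) := by
  unfold slotCond
  simp only [bit_add_eq_iff]
  constructor
  · rintro ⟨rfl, h1, h2, h3⟩
    refine ⟨fun j hj => ?_, funext fun v => ?_⟩
    · obtain ⟨i, rfl⟩ := Option.ne_none_iff_exists'.mp hj
      have h := h1 (some i)
      simp only at h
      rw [Pi.add_apply, h, add_assoc, bit_add_self, add_zero]
    · rcases v with j | k
      · rfl
      · fin_cases k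
        · exact h1 none
        · exact h2
        · exact h3
  · rintro ⟨h1, rfl⟩
    refine ⟨rfl, fun j => ?_, rfl, rfl⟩
    rcases j with _ | i
    · rfl
    · change R (some i) = _
      rw [h1 (some i) (by simp), Pi.add_apply, add_assoc, bit_add_self, add_zero]

/-- All signs of a slot: on the left the old phase flips, the Hadamard outcomes, the controlled
phase of the junk ancillas and the sign left by the `T` gadget; on the right a constant, the new
phase flips and the kernel of a Hadamard gate on the junk qubit. -/
lemma slot_exponent (o : SlotOp ι) (q : Frame ι) (r : SlotRes ι) (s : SlotVar ι → Bit) (R Y : Reg ι)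
    (hY : ∀ j, j ≠ none → Y j = (R + (q.next o r s).a) j) :
    dotProduct q.β (o.M.symm Y + q.a) +
      ((∑ v, s v * slotVal o r (o.M.symm Y) R v) + (Y none + r.c none) * R none +
        o.h (o.M.symm Y) * r.T * r.S) =
    (dotProduct q.β q.a + s (.inr 0) * r.c none + s (.inr 1) * r.T + s (.inr 2) * r.S +
      ∑ i, q.dual o r s (some i) * r.c (some i)) +
      (dotProduct (q.next o r s).β R + (R + (q.next o r s).a) none * Y none) := by
  -- The sign is linear in `M⁻¹ Y`. Its coefficients in the coordinates of `Y` are those of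
  -- `Frame.dual`, and outside the junk coordinate `Y` is known from `R`.
  have hlin : dotProduct q.β (o.M.symm Y) +
      (r.T * r.S + s (.inr 1) + r.T * s (.inr 2)) * o.h (o.M.symm Y) =
      q.dual o r s none * Y none + ∑ i, q.dual o r s (some i) * (R (some i) + r.c (some i)) := by
    have h1 : ∑ i, q.dual o r s (some i) * (R (some i) + r.c (some i)) =
        ∑ i, q.dual o r s (some i) * Y (some i) :=
      Finset.sum_congr rfl fun i _ => by rw [hY (some i) (by simp)]; rfl
    rw [h1, ← Fintype.sum_option (f := fun j => q.dual o r s j * Y j)]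
    let F : Reg ι →ₗ[Bit] Bit := (dotProductBilin Bit Bit q.β) ∘ₗ o.M.symm.toLinearMap +
      (r.T * r.S + s (.inr 1) + r.T * s (.inr 2)) • (o.h ∘ₗ o.M.symm.toLinearMap)
    exact linear_eq_sum F Y
  have h2 : ∑ v, s v * slotVal o r (o.M.symm Y) R v = (∑ j, s (.inl j) * R j) +
      (s (.inr 0) * (Y none + r.c none) + s (.inr 1) * (o.h (o.M.symm Y) + r.T) +
        s (.inr 2) * (r.T * o.h (o.M.symm Y) + r.S)) := by
    rw [Fintype.sum_sum_type, Fin.sum_univ_three]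
    simp [slotVal]
  have h3 : dotProduct (q.next o r s).β R = r.c none * R none +
      (∑ i, q.dual o r s (some i) * R (some i)) + ∑ j, s (.inl j) * R j := by
    have h4 : ∀ f : Reg ι, dotProduct f R = f none * R none + ∑ i, f (some i) * R (some i) :=
      fun f => Fintype.sum_option _
    rw [h4, Fintype.sum_option]
    simp only [Frame.next, add_mul, Finset.sum_add_distrib]
    ring
  have h5 : (R + (q.next o r s).a) none = R none + (q.dual o r s none + s (.inr 0)) := rfl
  rw [h2, h3, h5, dotProduct_add]
  simp only [mul_add, Finset.sum_add_distrib] at hlin ⊢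
  have hc : ∀ z : Bit, z = -z := fun z => (CharTwo.neg_eq z).symm
  have h2z : (2 : Bit) = 0 := one_add_one_bit
  linear_combination hlin

/-- The effect of a slot on a state with Pauli corrections. -/
theorem exists_slot_transfer (o : SlotOp ι) (q : Frame ι) (r : SlotRes ι) (s : SlotVar ι → Bit) :
    ∃ c : ℂ, ‖c‖ ^ 2 = 2 ∧ ∀ (χ : QState (Option ι)) (R : Reg ι),
      ∑ A : Reg ι, ∑ b : SlotVar ι → Bit, (if (fun j => b (.inl j)) = R then
        (sgn (dotProduct q.β A) * χ (A + q.a)) * slotWeight o q.a r s A b else 0) =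
      c * (sgn (dotProduct (q.next o r s).β R) * o.apply χ (R + (q.next o r s).a)) := by
  classical
  set κ : Bit := dotProduct q.β q.a + s (.inr 0) * r.c none + s (.inr 1) * r.T + s (.inr 2) * r.S +
      ∑ i, q.dual o r s (some i) * r.c (some i) with hκ
  refine ⟨sgn κ * (tph r.T * sph r.S) * rt⁻¹, ?_, fun χ R => ?_⟩
  -- The sum over paths contains no `1/√2`, whereas `SlotOp.apply` has one from its Hadamard gate;
  -- hence the squared norm `2`.
  · rw [norm_mul, norm_mul, norm_mul, norm_sgn, norm_tph, norm_sph, norm_inv, one_mul, one_mul,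
      one_mul, inv_pow, norm_rt_sq]
    norm_num
  have h1 : ∀ A : Reg ι, ∑ b : SlotVar ι → Bit, (if (fun j => b (.inl j)) = R then
        (sgn (dotProduct q.β A) * χ (A + q.a)) * slotWeight o q.a r s A b else 0) =
      if ∀ j, j ≠ none → o.M (A + q.a) j = (R + (q.next o r s).a) j then
        (sgn (dotProduct q.β A) * χ (A + q.a)) *
          (sgn (∑ v, s v * slotVal o r (A + q.a) R v) * slotAmp (slotVal o r (A + q.a) R))
      else 0 := by
    intro A
    have hb : ∀ b : SlotVar ι → Bit, (if (fun j => b (.inl j)) = R then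
        (sgn (dotProduct q.β A) * χ (A + q.a)) * slotWeight o q.a r s A b else 0) =
        if b = slotVal o r (A + q.a) R then
          (if ∀ j, j ≠ none → o.M (A + q.a) j = (R + (q.next o r s).a) j then
            (sgn (dotProduct q.β A) * χ (A + q.a)) * (sgn (∑ v, s v * b v) * slotAmp b) else 0)
        else 0 := by
      intro b
      have hiff := slotCond_iff o q.a r A b R
      have ha : (∀ j, j ≠ none → o.M (A + q.a) j = (R + r.c) j) ↔
          ∀ j, j ≠ none → o.M (A + q.a) j = (R + (q.next o r s).a) j := by
        refine forall₂_congr fun j hj => ?_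
        obtain ⟨i, rfl⟩ := Option.ne_none_iff_exists'.mp hj
        rfl
      rw [ha] at hiff
      unfold slotWeight
      rw [mul_ite, mul_zero, ← ite_and, ← ite_and]
      exact if_congr (hiff.trans and_comm) rfl rfl
    simp only [hb, Finset.sum_ite_eq', Finset.mem_univ, if_true]
  simp only [h1]
  -- Substitution `Y = M (A + a)`. Only the junk coordinate of `Y` is then free, and its two values
  -- form the Hadamard gate.
  let e : Reg ι ≃ Reg ι := o.M.symm.toEquiv.trans (Equiv.addRight q.a)
  rw [← Equiv.sum_comp e]
  have he : ∀ Y, e Y + q.a = o.M.symm Y := by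
    intro Y
    change o.M.symm Y + q.a + q.a = _
    rw [add_assoc, reg_add_self, add_zero]
  simp only [he, LinearEquiv.apply_symm_apply]
  rw [sum_all_but_one none (R + (q.next o r s).a) fun Y =>
    (sgn (dotProduct q.β (e Y)) * χ (o.M.symm Y)) *
          (sgn (∑ v, s v * slotVal o r (o.M.symm Y) R v) * slotAmp (slotVal o r (o.M.symm Y) R))]
  have h2 : ∀ y : Bit, (fun Y => (sgn (dotProduct q.β (e Y)) * χ (o.M.symm Y)) *
      (sgn (∑ v, s v * slotVal o r (o.M.symm Y) R v) * slotAmp (slotVal o r (o.M.symm Y) R)))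
        (Function.update (R + (q.next o r s).a) none y) =
      sgn κ * (tph r.T * sph r.S) * sgn (dotProduct (q.next o r s).β R) *
        (sgn ((R + (q.next o r s).a) none * y) * (fun Y => tph (o.h (o.M.symm Y)) *
          χ (o.M.symm Y)) (Function.update (R + (q.next o r s).a) none y)) := by
    intro y
    set Y : Reg ι := Function.update (R + (q.next o r s).a) none y with hYdef
    have hY : ∀ j, j ≠ none → Y j = (R + (q.next o r s).a) j := fun j hj =>
      Function.update_of_ne hj _ _
    have hYn : Y none = y := Function.update_self ..
    have hexp := congrArg sgn (slot_exponent o q r s R Y hY)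
    rw [← hκ, hYn] at hexp
    simp only [sgn_add] at hexp
    have hamp : slotAmp (slotVal o r (o.M.symm Y) R) = sgn ((y + r.c none) * R none) *
        (tph r.T * sph r.S * tph (o.h (o.M.symm Y)) * sgn (o.h (o.M.symm Y) * r.T * r.S)) := by
      rw [← tph_mul_sph, slotAmp]
      simp [slotVal, hYn]
    have heY : dotProduct q.β (e Y) = dotProduct q.β (o.M.symm Y + q.a) := rfl
    simp only
    rw [hamp, heY]
    linear_combination (χ (o.M.symm Y) * (tph r.T * sph r.S * tph (o.h (o.M.symm Y)))) * hexp
  refine (congrArg₂ (· + ·) (h2 0) (h2 1)).trans ?_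
  rw [SlotOp.apply, had_apply, mul_zero, mul_one, sgn_zero, one_mul]
  have hrt : rt ≠ 0 := by
    intro h
    have := norm_rt_sq
    rw [h] at this
    norm_num at this
  field_simp

end Slot

/-! ### Paths through the slots -/

section Path

variable {ι : Type} [Fintype ι] [DecidableEq ι]

/-- The Pauli corrections before slot `k`. -/
def frameAt (q : Frame ι) (o : ℕ → SlotOp ι) (r : ℕ → SlotRes ι) (s : ℕ → SlotVar ι → Bit) :
    ℕ → Frame ι
  | 0 => q
  | k + 1 => (frameAt q o r s k).next (o k) (r k) (s k)

/-- The state before slot `k`, without Pauli corrections. -/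
def evolve (o : ℕ → SlotOp ι) (χ : QState (Option ι)) : ℕ → QState (Option ι)
  | 0 => χ
  | k + 1 => (o k).apply (evolve o χ k)

/-- The incoming register of slot `k`. -/
def prevReg {K : ℕ} (A : Reg ι) (b : Fin K → SlotVar ι → Bit) : ℕ → Reg ι
  | 0 => A
  | k + 1 => if h : k < K then fun j => b ⟨k, h⟩ (.inl j) else 0

lemma prevReg_snoc {K : ℕ} (A : Reg ι) (b : Fin K → SlotVar ι → Bit) (c : SlotVar ι → Bit)
    (k : ℕ) (hk : k ≤ K) :
    prevReg A (Fin.snoc b c : Fin (K + 1) → SlotVar ι → Bit) k = prevReg A b k := by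
  cases k with
  | zero => rfl
  | succ k =>
    have h1 : k < K + 1 := by omega
    have h2 : k < K := hk
    simp only [prevReg, dif_pos h1, dif_pos h2]
    have : (⟨k, h1⟩ : Fin (K + 1)) = Fin.castSucc ⟨k, h2⟩ := rfl
    rw [this, Fin.snoc_castSucc (α := fun _ => SlotVar ι → Bit)]

lemma prevReg_snoc_last {K : ℕ} (A : Reg ι) (b : Fin K → SlotVar ι → Bit) (c : SlotVar ι → Bit) :
    prevReg A (Fin.snoc b c : Fin (K + 1) → SlotVar ι → Bit) (K + 1) = fun j => c (.inl j) := by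
  have h1 : K < K + 1 := by omega
  simp only [prevReg, dif_pos h1]
  have : (⟨K, h1⟩ : Fin (K + 1)) = Fin.last K := rfl
  rw [this, Fin.snoc_last (α := fun _ => SlotVar ι → Bit)]

/-- Feynman paths through `K` slots. The results and outcomes are fixed, so the Pauli corrections
are constants and the slots can be summed out one after the other, each contributing a factor of
squared norm `2`. -/
theorem exists_path_sum (q : Frame ι) (o : ℕ → SlotOp ι) (r : ℕ → SlotRes ι)
    (s : ℕ → SlotVar ι → Bit) (K : ℕ) :
    ∃ c : ℂ, ‖c‖ ^ 2 = 2 ^ K ∧ ∀ (χ : QState (Option ι)) (R : Reg ι),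
      ∑ A : Reg ι, ∑ b : Fin K → SlotVar ι → Bit, (if prevReg A b K = R then
        (sgn (dotProduct q.β A) * χ (A + q.a)) * ∏ k : Fin K, slotWeight (o k)
          (frameAt q o r s k).a (r k) (s k) (prevReg A b k) (b k) else 0) =
      c * (sgn (dotProduct (frameAt q o r s K).β R) *
        evolve o χ K (R + (frameAt q o r s K).a)) := by
  induction K with
  | zero =>
    refine ⟨1, by simp, fun χ R => ?_⟩
    simp [prevReg, frameAt, evolve]
  | succ K ih =>
    obtain ⟨c, hc, h⟩ := ih
    obtain ⟨d, hd, h'⟩ := exists_slot_transfer (o K) (frameAt q o r s K) (r K) (s K)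
    refine ⟨c * d, by rw [norm_mul, mul_pow, hc, hd, pow_succ], fun χ R => ?_⟩
    set f : Reg ι → (Fin K → SlotVar ι → Bit) → ℂ := fun A b =>
      (sgn (dotProduct q.β A) * χ (A + q.a)) * ∏ k : Fin K, slotWeight (o k)
          (frameAt q o r s k).a (r k) (s k) (prevReg A b k) (b k) with hf
    set W : Reg ι → (SlotVar ι → Bit) → ℂ := fun A b =>
      slotWeight (o K) (frameAt q o r s K).a (r K) (s K) A b with hW
    have h1 : ∀ A : Reg ι, ∑ b : Fin (K + 1) → SlotVar ι → Bit, (if prevReg A b (K + 1) = R then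
        (sgn (dotProduct q.β A) * χ (A + q.a)) * ∏ k : Fin (K + 1), slotWeight (o k)
          (frameAt q o r s k).a (r k) (s k) (prevReg A b k) (b k) else 0) =
        ∑ b', ∑ e : SlotVar ι → Bit, if (fun j => e (.inl j)) = R then
          f A b' * W (prevReg A b' K) e else 0 := by
      intro A
      rw [← Equiv.sum_comp (Fin.snocEquiv fun _ : Fin (K + 1) => SlotVar ι → Bit),
        Fintype.sum_prod_type_right]
      refine Finset.sum_congr rfl fun b' _ => Finset.sum_congr rfl fun e _ => ?_
      have hsn : (Fin.snocEquiv fun _ : Fin (K + 1) => SlotVar ι → Bit) (e, b') =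
        (Fin.snoc b' e : Fin (K + 1) → SlotVar ι → Bit) := rfl
      rw [hsn, prevReg_snoc_last, Fin.prod_univ_castSucc]
      congr 1
      rw [Fin.snoc_last (α := fun _ => SlotVar ι → Bit), Fin.val_last, prevReg_snoc _ _ _ K le_rfl,
        ← mul_assoc]
      congr 2
      refine Finset.prod_congr rfl fun k _ => ?_
      rw [Fin.snoc_castSucc (α := fun _ => SlotVar ι → Bit), Fin.val_castSucc,
        prevReg_snoc _ _ _ k k.isLt.le]
    simp only [h1]
    have h2 : ∀ A b', (∑ e : SlotVar ι → Bit, if (fun j => e (.inl j)) = R then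
        f A b' * W (prevReg A b' K) e else 0) = ∑ B : Reg ι, (if prevReg A b' K = B then f A b'
          else 0) * ∑ e : SlotVar ι → Bit, if (fun j => e (.inl j)) = R then W B e else 0 := by
      intro A b'
      simp only [ite_mul, zero_mul, Finset.sum_ite_eq, Finset.mem_univ, if_true]
      rw [Finset.mul_sum]
      refine Finset.sum_congr rfl fun e _ => ?_
      rw [mul_ite, mul_zero]
    simp only [h2]
    -- The paths are grouped by the register `B` that enters the last slot.
    have h3 : ∑ A : Reg ι, ∑ b', ∑ B : Reg ι, (if prevReg A b' K = B then f A b' else 0) *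
        (∑ e : SlotVar ι → Bit, if (fun j => e (.inl j)) = R then W B e else 0) =
        ∑ B : Reg ι, (∑ A : Reg ι, ∑ b', if prevReg A b' K = B then f A b' else 0) *
          ∑ e : SlotVar ι → Bit, if (fun j => e (.inl j)) = R then W B e else 0 := by
      simp only [Finset.sum_mul]
      rw [Finset.sum_comm]
      refine (Finset.sum_congr rfl fun b' _ => Finset.sum_comm).trans ?_
      rw [Finset.sum_comm]
      exact Finset.sum_congr rfl fun B _ => Finset.sum_comm
    rw [h3]
    have h4 := h' (evolve o χ K) R
    rw [frameAt, evolve, mul_assoc, ← h4, Finset.mul_sum]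
    refine Finset.sum_congr rfl fun B _ => ?_
    rw [h χ B, Finset.mul_sum, Finset.mul_sum]
    refine Finset.sum_congr rfl fun e _ => ?_
    rw [mul_ite, mul_ite, mul_zero, mul_zero, mul_assoc]

end Path

/-! ### Circuits as operations of slots -/

section GateSlots

variable {ι : Type} [Fintype ι] [DecidableEq ι]

/-- A state of the qubits `ι` together with a state of the junk qubit. -/
def withJunk (φ : QState ι) (ξ : Bit → ℂ) : QState (Option ι) := fun X =>
  φ (fun i => X (some i)) * ξ (X none)

/-- The Hadamard gate on the junk qubit. -/
def junkHad (ξ : Bit → ℂ) : Bit → ℂ := fun b => rt * (ξ 0 + sgn b * ξ 1)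

lemma had_withJunk (φ : QState ι) (ξ : Bit → ℂ) :
    (Gate.had none).apply (withJunk φ ξ) = withJunk φ (junkHad ξ) := by
  funext X
  rw [had_apply]
  have h : ∀ b, (fun i => Function.update X none b (some i)) = fun i => X (some i) := fun b =>
    funext fun i => Function.update_of_ne (by simp) _ _
  simp only [withJunk, junkHad, h, Function.update_self]
  ring

lemma junkHad_norm (ξ : Bit → ℂ) (h : ‖ξ 0‖ ^ 2 + ‖ξ 1‖ ^ 2 = 1) :
    ‖junkHad ξ 0‖ ^ 2 + ‖junkHad ξ 1‖ ^ 2 = 1 := by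
  simp only [junkHad, sgn_zero, sgn_one, one_mul, norm_mul, mul_pow, norm_rt_sq, neg_mul,
    ← sub_eq_add_neg]
  have := parallelogram_law_with_norm ℝ (ξ 0) (ξ 1)
  nlinarith

lemma weight_withJunk (φ : QState ι) (ξ : Bit → ℂ) (h : ‖ξ 0‖ ^ 2 + ‖ξ 1‖ ^ 2 = 1)
    (p : (ι → Bit) → Prop) :
    weight (project (fun X => p fun i => X (some i)) (withJunk φ ξ)) = weight (project p φ) := by
  classical
  unfold weight
  let e : Bit × (ι → Bit) ≃ (Option ι → Bit) := (Equiv.piOptionEquivProd (β := fun _ => Bit)).symm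
  rw [← Equiv.sum_comp e, Fintype.sum_prod_type_right]
  refine Finset.sum_congr rfl fun s _ => ?_
  have h1 : ∀ b, (fun i => e (b, s) (some i)) = s := fun b => rfl
  have h2 : ∀ b, e (b, s) none = b := fun b => rfl
  have h3 : ∀ f : Bit → ℝ, ∑ b, f b = f 0 + f 1 := fun f => Fin.sum_univ_two f
  simp only [project_apply, withJunk, h1, h2]
  by_cases hp : p s
  · simp only [if_pos hp, norm_mul, mul_pow]
    rw [h3, ← mul_add, h, mul_one]
  · simp [if_neg hp]

/-- The exchange of a wire with the junk qubit. -/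
def swapJunk (i : ι) : Reg ι ≃ₗ[Bit] Reg ι :=
  LinearEquiv.funCongrLeft Bit Bit (Equiv.swap none (some i))

lemma swapJunk_symm_apply (i : ι) (X : Reg ι) :
    (swapJunk i).symm X = fun j => X (Equiv.swap none (some i) j) := by
  rw [LinearEquiv.symm_apply_eq]
  funext j
  simp [swapJunk, LinearMap.funLeft]

/-- The linear map before the Hadamard gate on the junk qubit. -/
def preMap : Option (Gate ι) → (Reg ι ≃ₗ[Bit] Reg ι)
  | some (.cnot i j h) => transvect (some i) (Pi.single (some j) 1)
      (Pi.single_eq_of_ne (fun e => h (Option.some.inj e)) 1)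
  | some (.had i) => swapJunk i
  | _ => LinearEquiv.refl Bit _

/-- The linear map after the Hadamard gate on the junk qubit. -/
def postMap : Option (Gate ι) → (Reg ι ≃ₗ[Bit] Reg ι)
  | some (.had i) => swapJunk i
  | _ => LinearEquiv.refl Bit _

/-- The linear form that determines the phase. -/
def phaseForm : Option (Gate ι) → (Reg ι →ₗ[Bit] Bit)
  | some (.tgate i) => LinearMap.proj (some i)
  | _ => 0

/-- The operation of a slot for a gate and the final map of the previous gate. -/
def gateOp (G' G : Option (Gate ι)) : SlotOp ι where
  M := (postMap G').trans (preMap G)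
  h := phaseForm G ∘ₗ (postMap G').toLinearMap

/-- The action of a gate, if any. -/
def applyOpt (G : Option (Gate ι)) (φ : QState ι) : QState ι := G.elim φ fun g => g.apply φ

/-- Every slot ends with a Hadamard gate on the junk qubit. For a Hadamard gate of the circuit its
wire is in the junk position at that moment, so the junk state is untouched; for all other gates
only the junk state changes. The state stays swapped, which `postMap` records. -/
lemma gateStep (G : Option (Gate ι)) (φ : QState ι) (ξ : Bit → ℂ) :
    ∃ ξ' : Bit → ℂ, (‖ξ 0‖ ^ 2 + ‖ξ 1‖ ^ 2 = 1 → ‖ξ' 0‖ ^ 2 + ‖ξ' 1‖ ^ 2 = 1) ∧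
      ∀ Z, (Gate.had none).apply (fun Y => tph (phaseForm G ((preMap G).symm Y)) *
        withJunk φ ξ ((preMap G).symm Y)) Z = withJunk (applyOpt G φ) ξ' (postMap G Z) := by
  rcases G with _ | (⟨i, j, hij⟩ | i | i)
  · refine ⟨junkHad ξ, junkHad_norm ξ, fun Z => ?_⟩
    have h : (fun Y => tph (phaseForm none ((preMap none).symm Y)) *
        withJunk φ ξ ((preMap none).symm Y)) = withJunk φ ξ := by
      funext Y
      change tph 0 * _ = _
      rw [tph_zero, one_mul]; rfl
    rw [h, had_withJunk]
    rfl
  · refine ⟨junkHad ξ, junkHad_norm ξ, fun Z => ?_⟩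
    have h : (fun Y => tph (phaseForm (some (.cnot i j hij)) ((preMap (some (.cnot i j hij))).symm Y)) *
        withJunk φ ξ ((preMap (some (.cnot i j hij))).symm Y)) =
        withJunk ((Gate.cnot i j hij).apply φ) ξ := by
      funext Y
      have hY : (preMap (some (.cnot i j hij))).symm Y =
          Y + Y (some i) • Pi.single (some j) 1 := rfl
      change tph 0 * _ = _
      rw [tph_zero, one_mul, hY]
      simp only [withJunk, cnot_apply]
      congr 1
      · congr 1
        funext k
        by_cases hk : k = j
        · subst hk; simp
        · simp [hk]
      · simp
    rw [h, had_withJunk]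
    rfl
  · refine ⟨ξ, id, fun Z => ?_⟩
    have h : (fun Y => tph (phaseForm (some (.had i)) ((preMap (some (.had i))).symm Y)) *
        withJunk φ ξ ((preMap (some (.had i))).symm Y)) =
        fun Y => withJunk φ ξ (fun j => Y (Equiv.swap none (some i) j)) := by
      funext Y
      change tph 0 * _ = _
      rw [tph_zero, one_mul]
      exact congrArg (withJunk φ ξ) (swapJunk_symm_apply i Y)
    rw [h]
    change _ = withJunk ((Gate.had i).apply φ) ξ (fun j => Z (Equiv.swap none (some i) j))
    simp only [had_apply, withJunk]
    have h1 : ∀ b, (fun k => Function.update Z none b (Equiv.swap none (some i) (some k))) =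
        Function.update (fun k => Z (Equiv.swap none (some i) (some k))) i b := by
      intro b
      funext k
      by_cases hk : k = i
      · subst hk; simp
      · rw [Function.update_of_ne hk, Equiv.swap_apply_of_ne_of_ne (by simp) (by simpa using hk),
          Function.update_of_ne (by simp)]
    have h2 : ∀ b, Function.update Z none b (some i) = Z (some i) := fun b =>
      Function.update_of_ne (by simp) _ _
    simp only [h1, Equiv.swap_apply_left, Equiv.swap_apply_right, h2]
    ring
  · refine ⟨junkHad ξ, junkHad_norm ξ, fun Z => ?_⟩
    have h : (fun Y => tph (phaseForm (some (.tgate i)) ((preMap (some (.tgate i))).symm Y)) *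
        withJunk φ ξ ((preMap (some (.tgate i))).symm Y)) =
        withJunk ((Gate.tgate i).apply φ) ξ := by
      funext Y
      change tph (Y (some i)) * withJunk φ ξ Y = _
      simp only [withJunk, Gate.apply, tph, mul_assoc]
    rw [h, had_withJunk]
    rfl

/-- The slot operations of a circuit; slot `0` has no gate. -/
def circuitOps (G : ℕ → Option (Gate ι)) : ℕ → SlotOp ι
  | 0 => gateOp none none
  | 1 => gateOp none (G 0)
  | k + 2 => gateOp (G k) (G (k + 1))

lemma gateOp_apply (G' G : Option (Gate ι)) (φ : QState ι) (ξ : Bit → ℂ) :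
    ∃ ξ' : Bit → ℂ, (‖ξ 0‖ ^ 2 + ‖ξ 1‖ ^ 2 = 1 → ‖ξ' 0‖ ^ 2 + ‖ξ' 1‖ ^ 2 = 1) ∧
      (gateOp G' G).apply (fun Z => withJunk φ ξ (postMap G' Z)) =
        fun Z => withJunk (applyOpt G φ) ξ' (postMap G Z) := by
  obtain ⟨ξ', h1, h2⟩ := gateStep G φ ξ
  refine ⟨ξ', h1, funext fun Z => ?_⟩
  rw [← h2, SlotOp.apply]
  congr 1
  funext Y
  have hY : (gateOp G' G).M.symm Y = (postMap G').symm ((preMap G).symm Y) := rfl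
  have hh : ∀ X, (gateOp G' G).h X = phaseForm G (postMap G' X) := fun X => rfl
  rw [hY, hh, LinearEquiv.apply_symm_apply]

/-- The state after the first `k` gates. -/
def runOpts (G : ℕ → Option (Gate ι)) (φ : QState ι) : ℕ → QState ι
  | 0 => φ
  | k + 1 => applyOpt (G k) (runOpts G φ k)

/-- The swap left over by one gate is undone by the next slot. The offset is due to the empty slot
`0`: after `k + 2` slots, `k + 1` gates have been applied. -/
lemma evolve_circuitOps (G : ℕ → Option (Gate ι)) (φ : QState ι) (ξ : Bit → ℂ)
    (hξ : ‖ξ 0‖ ^ 2 + ‖ξ 1‖ ^ 2 = 1) (k : ℕ) :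
    ∃ ξ' : Bit → ℂ, ‖ξ' 0‖ ^ 2 + ‖ξ' 1‖ ^ 2 = 1 ∧
      evolve (circuitOps G) (withJunk φ ξ) (k + 2) =
        fun Z => withJunk (runOpts G φ (k + 1)) ξ' (postMap (G k) Z) := by
  induction k with
  | zero =>
    obtain ⟨ξ1, h1, e1⟩ := gateOp_apply none none φ ξ
    obtain ⟨ξ2, h2, e2⟩ := gateOp_apply none (G 0) φ ξ1
    refine ⟨ξ2, h2 (h1 hξ), ?_⟩
    change (gateOp none (G 0)).apply ((gateOp none none).apply (withJunk φ ξ)) = _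
    rw [show (gateOp none none).apply (withJunk φ ξ) = _ from e1]
    exact e2
  | succ k ih =>
    obtain ⟨ξ1, h1, e1⟩ := ih
    obtain ⟨ξ2, h2, e2⟩ := gateOp_apply (G k) (G (k + 1)) (runOpts G φ (k + 1)) ξ1
    refine ⟨ξ2, h2 h1, ?_⟩
    change (gateOp (G k) (G (k + 1))).apply (evolve (circuitOps G) (withJunk φ ξ) (k + 2)) = _
    rw [e1]
    exact e2

lemma runOpts_getElem? (L : List (Gate ι)) (φ : QState ι) (k : ℕ) (hk : L.length ≤ k) :
    runOpts (fun i => L[i]?) φ k = runGates L φ := by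
  have h : ∀ k, runOpts (fun i => L[i]?) φ k = runGates (L.take k) φ := by
    intro k
    induction k with
    | zero => rfl
    | succ k ih =>
      rw [runOpts, ih, List.take_add_one, runGates_append]
      cases L[k]? <;> rfl
  rw [h, List.take_of_length_le hk]

end GateSlots

/-! ### Amplitudes of programs without linear operations -/

namespace MeasProgram

variable {N m m' t : ℕ} (M : MeasProgram N m m' t) {W : Type} [Fintype W] [DecidableEq W]
  (e : W ≃ Fin N)

open Classical in
/-- The amplitude of the final outcome `s` with results `r`, up to normalisation. -/
def amp (ψ : QState (Fin N)) (x : BitStr m) (r : BitStr t) (s : W → Bit) : ℂ :=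
  ∑ u : W → Bit, if (∀ w, M.b (e w) ≠ 1 → u w = s w) ∧
      ∀ i, M.cond x r (fun w => s (e.symm w)) (fun w => u (e.symm w)) i then
    sgn (∑ w, if M.b (e w) = 1 then s w * u w else 0) * ψ (fun w => u (e.symm w)) else 0

lemma mem_xWires (w : Fin N) : w ∈ M.xWires ↔ M.b w = 1 := by
  simp [xWires]

lemma nodup_xWires : M.xWires.Nodup := (List.nodup_finRange N).filter _

lemma length_xWires :
    M.xWires.length = (Finset.univ.filter fun w : W => M.b (e w) = 1).card := by
  rw [← List.toFinset_card_of_nodup M.nodup_xWires]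
  refine (Finset.card_bij (fun w _ => e w) (fun w hw => ?_) (fun a _ b _ h => e.injective h)
    fun w hw => ⟨e.symm w, ?_, e.apply_symm_apply w⟩).symm
  · simpa [mem_xWires] using hw
  · simpa [mem_xWires] using hw

open Classical in
lemma hadList_xWires (ψ : QState (Fin N)) (x : BitStr m) (r : BitStr t) (s : W → Bit) :
    hadList M.xWires (project (fun u => ∀ i, M.cond x r (fun w => s (e.symm w)) u i) ψ)
      (fun w => s (e.symm w)) = rt ^ M.xWires.length * M.amp e ψ x r s := by
  rw [hadList_apply _ M.nodup_xWires]
  congr 1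
  unfold amp
  rw [← Equiv.sum_comp (e.arrowCongr (Equiv.refl Bit))]
  refine Finset.sum_congr rfl fun u _ => ?_
  have hu : e.arrowCongr (Equiv.refl Bit) u = fun w => u (e.symm w) := rfl
  rw [hu]
  have h1 : (∀ w, w ∉ M.xWires → u (e.symm w) = s (e.symm w)) ↔
      ∀ w, M.b (e w) ≠ 1 → u w = s w := by
    constructor
    · intro h w hw
      simpa using h (e w) (by rwa [mem_xWires])
    · intro h w hw
      exact h (e.symm w) (by rwa [mem_xWires, ← e.apply_symm_apply w] at hw)
  have h2 : ∑ w ∈ M.xWires.toFinset, s (e.symm w) * u (e.symm w) =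
      ∑ w, if M.b (e w) = 1 then s w * u w else 0 := by
    rw [← Equiv.sum_comp e.symm, ← Finset.sum_filter]
    refine Finset.sum_congr ?_ fun _ _ => rfl
    ext w
    simp [mem_xWires]
  rw [project_apply, h2, ite_and, mul_ite, mul_zero]
  by_cases hc : ∀ w, M.b (e w) ≠ 1 → u w = s w
  · rw [if_pos hc, if_pos (h1.mpr hc)]
  · rw [if_neg hc, if_neg (mt h1.mp hc)]

open Classical in
lemma evalProb_eq_sum_amp (ψ : QState (Fin N)) (x : BitStr m) (y : BitStr m') :
    M.toLM.evalProb ψ x y = ∑ r : BitStr t, ∑ s : W → Bit,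
      if M.g x r (fun w => s (e.symm w)) = y then
        (1 / 2) ^ (Finset.univ.filter fun w : W => M.b (e w) = 1).card * ‖M.amp e ψ x r s‖ ^ 2
      else 0 := by
  rw [M.evalProb_toLM]
  refine Finset.sum_congr rfl fun r _ => ?_
  rw [← Equiv.sum_comp (e.arrowCongr (Equiv.refl Bit))]
  refine Finset.sum_congr rfl fun s _ => ?_
  have hs : e.arrowCongr (Equiv.refl Bit) s = fun w => s (e.symm w) := rfl
  rw [hs, M.hadList_xWires e, norm_mul, mul_pow, norm_pow, ← pow_mul, mul_comm _ 2, pow_mul,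
    norm_rt_sq, M.length_xWires e]

end MeasProgram

/-! ### The universal program -/

section Universal

variable (n m m' d : ℕ)

/-- The wires of a circuit: the input register and the program register. -/
abbrev CWire : Type := Fin m ⊕ Fin n

/-- The number of layers of a slot. -/
def slotLayers : ℕ := 2 + Fintype.card (Option (CWire n m))

/-- The number of layers. -/
def layers : ℕ := (n + 2) * slotLayers n m

/-- The result of layer `lay (k, l)` is the entry `l` of the results of slot `k`. -/
def lay : Fin (n + 2) × (Fin 2 ⊕ Option (CWire n m)) ≃ Fin (layers n m) :=
  (Equiv.prodCongr (Equiv.refl _) ((Equiv.sumCongr (Equiv.refl _)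
    (Fintype.equivFin (Option (CWire n m)))).trans finSumFinEquiv)).trans finProdFinEquiv

/-- The ancillas: copies of the slot variables for each layer, and further copies of the last
register. -/
abbrev AncWire : Type :=
  (Fin (n + 2) × SlotVar (CWire n m) × Fin (layers n m)) ⊕ Option (CWire n m)

/-- All wires of the universal program. -/
abbrev UWire : Type := (Fin n ⊕ Fin d) ⊕ AncWire n m

variable {n m m' d}

lemma lay_val (k : Fin (n + 2)) (l : Fin 2 ⊕ Option (CWire n m)) :
    ∃ o < slotLayers n m, (lay n m (k, l)).val = o + slotLayers n m * k ∧
      (l = .inl 0 → o = 0) ∧ (l = .inl 1 → o = 1) := by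
  refine ⟨_, (finSumFinEquiv ((Equiv.sumCongr (Equiv.refl _)
    (Fintype.equivFin (Option (CWire n m)))) l)).isLt, rfl, ?_, ?_⟩
  · rintro rfl; rfl
  · rintro rfl; rfl

lemma le_lay (k : Fin (n + 2)) (l : Fin 2 ⊕ Option (CWire n m)) :
    slotLayers n m * k ≤ (lay n m (k, l)).val := by
  obtain ⟨o, ho, h, -⟩ := lay_val k l
  omega

lemma lay_lt (k : Fin (n + 2)) (l : Fin 2 ⊕ Option (CWire n m)) :
    (lay n m (k, l)).val < slotLayers n m * (k + 1) := by
  obtain ⟨o, ho, h, -⟩ := lay_val k l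
  rw [mul_add]
  omega

/-- The correction by the `S` phase is adaptive: the layer for `S` uses the result for `T`. -/
lemma lay_T_lt_S (k : Fin (n + 2)) :
    (lay n m (k, .inl 0)).val < (lay n m (k, .inl 1)).val := by
  obtain ⟨o, ho, h, h0, -⟩ := lay_val (m := m) k (.inl 0)
  obtain ⟨o', ho', h', -, h1⟩ := lay_val (m := m) k (.inl 1)
  rw [h, h', h0 rfl, h1 rfl]
  omega

lemma layers_pos : 0 < layers n m := Nat.mul_pos (by omega) (by unfold slotLayers; omega)

/-- The results of slot `k`. -/
def slotRes (r : BitStr (layers n m)) (k : ℕ) : SlotRes (CWire n m) :=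
  if h : k < n + 2 then ⟨fun j => r (lay n m (⟨k, h⟩, .inr j)), r (lay n m (⟨k, h⟩, .inl 0)),
    r (lay n m (⟨k, h⟩, .inl 1))⟩ else ⟨0, 0, 0⟩

/-- The parities of the final outcomes of the copies of the variables of slot `k`. -/
def slotOut (s : UWire n m d → Bit) (k : ℕ) : SlotVar (CWire n m) → Bit := fun v =>
  if h : k < n + 2 then ∑ i, s (.inr (.inl (⟨k, h⟩, v, i))) else 0

/-- The initial phase flips. -/
def initFrame (s : UWire n m d → Bit) : Frame (CWire n m) where
  a := 0
  β := fun j => match j with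
    | some (.inr i) => s (.inl (.inl i))
    | _ => 0

/-- A decoding of circuits: the gates, and the output wires. -/
abbrev Decoding (n m m' d : ℕ) : Type :=
  BitStr d → (ℕ → Option (Gate (CWire n m))) × (Fin m' → Option (CWire n m))

/-- The circuit in the description register. -/
def descBits (s : UWire n m d → Bit) : BitStr d := fun i => s (.inl (.inr i))

/-- The Pauli corrections before slot `k`. -/
def uframe (D : Decoding n m m' d) (r : BitStr (layers n m)) (s : UWire n m d → Bit) (k : ℕ) :
    Frame (CWire n m) :=
  frameAt (initFrame s) (circuitOps (D (descBits s)).1) (slotRes r) (slotOut s) k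

/-- The input register for the classical input `x`. -/
def inputReg (x : BitStr m) (φ : BitStr n) : Reg (CWire n m)
  | none => 0
  | some (.inl i) => x i
  | some (.inr i) => φ i

/-- The incoming register of slot `k`, as read in layer `i`. -/
def readReg (x : BitStr m) (s : UWire n m d → Bit) (i : Fin (layers n m)) (k : Fin (n + 2)) :
    Reg (CWire n m) :=
  if h : k.val = 0 then inputReg x fun b => s (.inl (.inl b)) else
    fun j => s (.inr (.inl (⟨k.val - 1, by omega⟩, .inl j, i)))

/-- The bit that a layer of a slot measures. -/
def slotBit {ι : Type} [Fintype ι] [DecidableEq ι] (o : SlotOp ι) (a : Reg ι) (T : Bit) (A : Reg ι)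
    (b : SlotVar ι → Bit) : Fin 2 ⊕ Option ι → Bit
  | .inl 0 => b (.inr 1) + o.h (A + a)
  | .inl 1 => b (.inr 2) + T * o.h (A + a)
  | .inr none => b (.inr 0) + o.M (A + a) none
  | .inr (some i) => b (.inl (some i)) + o.M (A + a) (some i)

/-- The result of layer `lay (k, l)` if the wires contain `s`. -/
def layerBit (D : Decoding n m m' d) (x : BitStr m) (r : BitStr (layers n m))
    (s : UWire n m d → Bit) (k : Fin (n + 2)) (l : Fin 2 ⊕ Option (CWire n m)) : Bit :=
  slotBit (circuitOps (D (descBits s)).1 k) (uframe D r s k).a (slotRes r k).T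
    (readReg x s (lay n m (k, l)) k) (fun v => s (.inr (.inl (k, v, lay n m (k, l))))) l

/-- The layer in which a wire is read. -/
def readTime : UWire n m d → ℕ
  | .inl (.inl i) => lay n m (0, .inr (some (.inr i)))
  | .inl (.inr _) => 0
  | .inr (.inl (_, _, i)) => i
  | .inr (.inr _) => layers n m

/-- The layer in which a wire is collapsed. -/
def collapseTime : UWire n m d → ℕ
  | .inl (.inl _) => slotLayers n m
  | .inl (.inr _) => 0
  | .inr (.inl (k, .inl _, _)) => min (slotLayers n m * (k + 2)) (layers n m)
  | .inr (.inl (k, .inr _, _)) => slotLayers n m * (k + 1)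
  | .inr (.inr _) => layers n m

/-- The basis in which a wire is collapsed. -/
def collapseBasis : UWire n m d → Bit
  | .inl (.inl _) => 1
  | .inl (.inr _) => 0
  | .inr (.inl _) => 1
  | .inr (.inr _) => 0

lemma collapseTime_le (w : UWire n m d) : collapseTime w ≤ layers n m := by
  rcases w with (i | i) | (⟨k, j | c, i⟩ | j)
  · exact Nat.le_mul_of_pos_left _ (by omega)
  · exact Nat.zero_le _
  · exact min_le_right _ _
  · have := k.isLt
    change slotLayers n m * (k + 1) ≤ layers n m
    rw [mul_comm]
    exact Nat.mul_le_mul_right _ (by omega)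
  · exact le_rfl

/-- The output of the program. -/
def finalOut (D : Decoding n m m' d) (r : BitStr (layers n m)) (s : UWire n m d → Bit) :
    BitStr m' := fun o =>
  postMap ((D (descBits s)).1 n) ((fun j => s (.inr (.inr j))) + (uframe D r s (n + 2)).a)
    ((D (descBits s)).2 o)

/-- The universal program. -/
def uprog {N : ℕ} (e : UWire n m d ≃ Fin N) (D : Decoding n m m' d) :
    MeasProgram N m m' (layers n m) where
  ρ := fun w => readTime (e.symm w)
  τ := fun w => collapseTime (e.symm w)
  τ_le := fun _ => collapseTime_le _
  b := fun w => collapseBasis (e.symm w)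
  f := fun i x r s => layerBit D x r (fun w => s (e w)) ((lay n m).symm i).1 ((lay n m).symm i).2
  g := fun _ r s => finalOut D r (fun w => s (e w))

end Universal

/-! ### The results of the universal program -/

section Frames

variable {ι : Type} [Fintype ι] [DecidableEq ι]

lemma frameAt_congr (q : Frame ι) (o : ℕ → SlotOp ι) {r r' : ℕ → SlotRes ι}
    {s s' : ℕ → SlotVar ι → Bit} (k : ℕ) (hr : ∀ j < k, r j = r' j) (hs : ∀ j < k, s j = s' j) :
    frameAt q o r s k = frameAt q o r' s' k := by
  induction k with
  | zero => rfl
  | succ k ih =>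
    rw [frameAt, frameAt, ih (fun j hj => hr j (by omega)) (fun j hj => hs j (by omega)),
      hr k (by omega), hs k (by omega)]

/-- Outcomes on an outgoing register enter the phase flips at once but the bit flips only one slot
later. So the bit flips before slot `k` need the register outcomes of slots up to `k - 2`, and the
ancilla outcomes up to `k - 1`. This is what allows a register to be collapsed only after the next
slot has read it. -/
lemma frameAt_a_congr {q q' : Frame ι} (o : ℕ → SlotOp ι) {r r' : ℕ → SlotRes ι}
    {s s' : ℕ → SlotVar ι → Bit} (k : ℕ) (ha : q.a = q'.a) (hq : 0 < k → q = q')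
    (hr : ∀ j < k, r j = r' j) (hs : ∀ j < k, ∀ c, s j (.inr c) = s' j (.inr c))
    (hs' : ∀ j, j + 1 < k → ∀ c, s j (.inl c) = s' j (.inl c)) :
    (frameAt q o r s k).a = (frameAt q' o r' s' k).a := by
  cases k with
  | zero => exact ha
  | succ k =>
    obtain rfl := hq (Nat.succ_pos k)
    rw [frameAt, frameAt, frameAt_congr q o k (fun j hj => hr j (by omega)) (s' := s')
      (fun j hj => funext fun v => ?_), hr k (by omega)]
    · funext j
      simp only [Frame.next, Frame.dual, hs k (by omega)]
    · rcases v with c | c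
      · exact hs' j (by omega) c
      · exact hs j (by omega) c

/-- The result that belongs to a layer of a slot. -/
def SlotRes.bit (r : SlotRes ι) : Fin 2 ⊕ Option ι → Bit
  | .inl 0 => r.T
  | .inl 1 => r.S
  | .inr j => r.c j

lemma slotCond_iff_slotBit (o : SlotOp ι) (a : Reg ι) (r : SlotRes ι) (A : Reg ι)
    (b : SlotVar ι → Bit) :
    slotCond o a r A b ↔ ∀ l, slotBit o a r.T A b l = r.bit l := by
  constructor
  · rintro ⟨h1, h2, h3⟩ (l | (_ | i))
    · fin_cases l
      · exact h2
      · exact h3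
    · exact h1 none
    · exact h1 (some i)
  · intro h
    refine ⟨fun j => ?_, h (.inl 0), h (.inl 1)⟩
    rcases j with _ | i
    · exact h (.inr none)
    · exact h (.inr (some i))

lemma slotBit_congr (o : SlotOp ι) (a : Reg ι) {T T' : Bit} {A A' : Reg ι} (b : SlotVar ι → Bit)
    (l : Fin 2 ⊕ Option ι) (hT : l = .inl 1 → T = T') (hA : A = A') :
    slotBit o a T A b l = slotBit o a T' A' b l := by
  subst hA
  rcases l with l | (_ | i)
  · fin_cases l
    · rfl
    · rw [hT rfl]
  · rfl
  · rfl

/-- With the identity map and no phase, each layer reads a single coordinate of the incoming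
register. Slot `0` needs this, since the wires of the program state are not copied and can be read
only once. -/
lemma slotBit_none_congr (a : Reg ι) {T T' : Bit} {A A' : Reg ι} (b : SlotVar ι → Bit)
    (l : Fin 2 ⊕ Option ι) (hA : ∀ j, l = .inr j → A j = A' j) :
    slotBit (gateOp none none) a T A b l = slotBit (gateOp none none) a T' A' b l := by
  rcases l with l | (_ | i)
  · fin_cases l
    · rfl
    · change b _ + T * 0 = b _ + T' * 0
      rw [mul_zero, mul_zero]
  · change b _ + (A none + a none) = b _ + (A' none + a none)
    rw [hA none rfl]
  · change b _ + (A (some i) + a (some i)) = b _ + (A' (some i) + a (some i))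
    rw [hA (some i) rfl]

end Frames

section Universal

variable {n m m' d : ℕ}

/-- The string that layer `i` obtains. -/
def umix (i : ℕ) (s u : UWire n m d → Bit) : UWire n m d → Bit := fun w =>
  if collapseTime w ≤ i then s w else if readTime w = i then u w else 0

lemma slotRes_bit (r : BitStr (layers n m)) (k : Fin (n + 2)) (l : Fin 2 ⊕ Option (CWire n m)) :
    (slotRes r k).bit l = r (lay n m (k, l)) := by
  rw [slotRes, dif_pos k.isLt]
  rcases l with l | j
  · fin_cases l <;> rfl
  · rfl

lemma slotRes_past (r : BitStr (layers n m)) (k : Fin (n + 2)) (i j : ℕ)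
    (hi : slotLayers n m * k ≤ i) (hj : j < k) :
    slotRes (MeasProgram.past i r) j = slotRes r j := by
  have hjn : j < n + 2 := by have := k.isLt; omega
  have h : ∀ l, MeasProgram.past i r (lay n m (⟨j, hjn⟩, l)) = r (lay n m (⟨j, hjn⟩, l)) := by
    intro l
    refine if_pos ((lay_lt _ l).trans_le (le_trans ?_ hi))
    exact Nat.mul_le_mul_left _ hj
  simp only [slotRes, dif_pos hjn, h]

/-- Checks the schedule: everything on which the bit flips of slot `k` depend has been collapsed or
measured when its first layer begins. -/
lemma uframe_umix (D : Decoding n m m' d) (r : BitStr (layers n m)) (s u : UWire n m d → Bit)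
    (k : Fin (n + 2)) (i : ℕ) (hi : slotLayers n m * k ≤ i) :
    (uframe D (MeasProgram.past i r) (umix i s u) k).a = (uframe D r s k).a := by
  have hmix : ∀ w, collapseTime w ≤ i → umix i s u w = s w := fun w hw => if_pos hw
  have hdesc : descBits (umix i s u) = descBits s := funext fun j => hmix _ (Nat.zero_le _)
  have hle : ∀ a : ℕ, a ≤ k → slotLayers n m * a ≤ i := fun a ha =>
    (Nat.mul_le_mul_left _ ha).trans hi
  unfold uframe
  rw [hdesc]
  refine frameAt_a_congr _ k rfl (fun hk => ?_) (fun j hj => slotRes_past r k i j hi hj)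
    (fun j hj c => ?_) (fun j hj c => ?_)
  · unfold initFrame
    congr 1
    funext j
    rcases j with _ | (b | b)
    · rfl
    · rfl
    · refine hmix _ ?_
      have := hle 1 hk
      rwa [mul_one] at this
  · unfold slotOut
    split_ifs
    · exact Finset.sum_congr rfl fun a _ => hmix _ (hle (j + 1) hj)
    · rfl
  · unfold slotOut
    split_ifs
    · exact Finset.sum_congr rfl fun a _ => hmix _ ((min_le_left _ _).trans (hle (j + 2) hj))
    · rfl

/-- Separates what a layer obtains: the circuit, the Pauli corrections and earlier results come from
final outcomes `s`, the register and the slot variables are read from `u`. -/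
lemma layerBit_umix (D : Decoding n m m' d) (x : BitStr m) (r : BitStr (layers n m))
    (s u : UWire n m d → Bit) (k : Fin (n + 2)) (l : Fin 2 ⊕ Option (CWire n m)) :
    layerBit D x (MeasProgram.past (lay n m (k, l)) r) (umix (lay n m (k, l)) s u) k l =
      slotBit (circuitOps (D (descBits s)).1 k) (uframe D r s k).a (slotRes r k).T
        (readReg x u (lay n m (k, l)) k) (fun v => u (.inr (.inl (k, v, lay n m (k, l))))) l := by
  set i := lay n m (k, l) with hi
  have hle : slotLayers n m * k ≤ i := le_lay k l
  have hlt : i.val < slotLayers n m * (k + 1) := lay_lt k l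
  have hread : ∀ w, ¬ collapseTime w ≤ i.val → readTime w = i.val → umix i s u w = u w :=
    fun w h1 h2 => by rw [umix, if_neg h1, if_pos h2]
  have hmix : ∀ w, collapseTime w ≤ i.val → umix i s u w = s w := fun w hw => if_pos hw
  have hdesc : descBits (umix i s u) = descBits s := funext fun j => hmix _ (Nat.zero_le _)
  have hb : (fun v => umix i s u (.inr (.inl (k, v, i)))) = fun v => u (.inr (.inl (k, v, i))) := by
    funext v
    refine hread _ ?_ rfl
    rcases v with j | c
    · change ¬ min _ _ ≤ _
      rw [not_le, lt_min_iff]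
      exact ⟨hlt.trans_le (Nat.mul_le_mul_left _ (by omega)), i.isLt⟩
    · exact not_le.mpr hlt
  unfold layerBit
  rw [← hi, hdesc, uframe_umix D r s u k i hle, hb]
  -- In slot `0` the register lies on the uncopied input wires, each read in the layer of its own
  -- result; later slots read the copy made for the layer in question.
  by_cases hk : k.val = 0
  · have hk0 : k = 0 := Fin.ext hk
    subst hk0
    refine slotBit_none_congr _ _ l fun j hj => ?_
    rw [readReg, readReg, dif_pos hk, dif_pos hk]
    rcases j with _ | (b | b)
    · rfl
    · rfl
    · refine hread (.inl (.inl b)) ?_ ?_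
      · have : i.val < slotLayers n m := by simpa using hlt
        exact not_le.mpr this
      · rw [hi, hj]; rfl
  · refine slotBit_congr _ _ _ l (fun h => ?_) ?_
    · simp only [slotRes, dif_pos k.isLt]
      refine if_pos ?_
      rw [hi, h]
      exact lay_T_lt_S k
    · rw [readReg, readReg, dif_neg hk, dif_neg hk]
      funext j
      refine hread _ ?_ rfl
      change ¬ min _ _ ≤ _
      rw [not_le, lt_min_iff]
      refine ⟨?_, i.isLt⟩
      have : k.val - 1 + 2 = k.val + 1 := by omega
      simp only [this]
      exact hlt

lemma cond_uprog {N : ℕ} (e : UWire n m d ≃ Fin N) (D : Decoding n m m' d) (x : BitStr m)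
    (r : BitStr (layers n m)) (s u : UWire n m d → Bit) (k : Fin (n + 2))
    (l : Fin 2 ⊕ Option (CWire n m)) :
    (uprog e D).cond x r (fun w => s (e.symm w)) (fun w => u (e.symm w)) (lay n m (k, l)) ↔
      slotBit (circuitOps (D (descBits s)).1 k) (uframe D r s k).a (slotRes r k).T
        (readReg x u (lay n m (k, l)) k) (fun v => u (.inr (.inl (k, v, lay n m (k, l))))) l =
      (slotRes r k).bit l := by
  unfold MeasProgram.cond
  have h1 : (uprog e D).f (lay n m (k, l)) x (MeasProgram.past (lay n m (k, l)) r)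
      ((uprog e D).mix (lay n m (k, l)) (fun w => s (e.symm w)) fun w => u (e.symm w)) =
      layerBit D x (MeasProgram.past (lay n m (k, l)) r) (umix (lay n m (k, l)) s u) k l := by
    have hf : ∀ i r' s', (uprog e D).f i x r' s' = layerBit D x r' (fun w => s' (e w))
        ((lay n m).symm i).1 ((lay n m).symm i).2 := fun _ _ _ => rfl
    rw [hf, Equiv.symm_apply_apply]
    congr 1
    funext w
    simp [MeasProgram.mix, uprog, umix]
  rw [h1, layerBit_umix, slotRes_bit]

/-- The wires when the slot variables are `b`, where all copies agree. -/
def fillWires (φ : BitStr n) (c : BitStr d) (b : Fin (n + 2) → SlotVar (CWire n m) → Bit) :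
    UWire n m d → Bit
  | .inl (.inl i) => φ i
  | .inl (.inr i) => c i
  | .inr (.inl (k, v, _)) => b k v
  | .inr (.inr j) => b (Fin.last (n + 1)) (.inl j)

lemma forall_cond_uprog {N : ℕ} (e : UWire n m d ≃ Fin N) (D : Decoding n m m' d) (x : BitStr m)
    (r : BitStr (layers n m)) (s : UWire n m d → Bit) (φ : BitStr n) (c : BitStr d)
    (b : Fin (n + 2) → SlotVar (CWire n m) → Bit) :
    (∀ i, (uprog e D).cond x r (fun w => s (e.symm w))
        (fun w => fillWires φ c b (e.symm w)) i) ↔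
      ∀ k : Fin (n + 2), slotCond (circuitOps (D (descBits s)).1 k) (uframe D r s k).a
        (slotRes r k) (prevReg (inputReg x φ) b k) (b k) := by
  rw [← (lay n m).forall_congr_right (q := fun i => (uprog e D).cond x r (fun w => s (e.symm w))
        (fun w => fillWires φ c b (e.symm w)) i), Prod.forall]
  refine forall_congr' fun k => ?_
  rw [slotCond_iff_slotBit]
  refine forall_congr' fun l => ?_
  rw [cond_uprog]
  have : readReg x (fillWires φ c b) (lay n m (k, l)) k = prevReg (inputReg x φ) b k := by
    obtain ⟨k, hk⟩ := k
    cases k with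
    | zero => rfl
    | succ k =>
      have h : k < n + 2 := by omega
      simp only [readReg, prevReg, dif_pos h, Nat.succ_ne_zero, dif_neg, not_false_eq_true]
      rfl
  rw [this]
  rfl

end Universal

/-! ### The output distribution of the universal program -/

section Universal

variable {n m m' d : ℕ}

/-- The contents of the ancillas when the slot variables are `b`. -/
def fillAnc (b : Fin (n + 2) → SlotVar (CWire n m) → Bit) : AncWire n m → Bit
  | .inl (k, v, _) => b k v
  | .inr j => b (Fin.last (n + 1)) (.inl j)

open Classical in
/-- The state of the ancillas. -/
def ancState (n m : ℕ) : QState (AncWire n m) := fun v =>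
  ∑ b : Fin (n + 2) → SlotVar (CWire n m) → Bit, if v = fillAnc b then
    ∏ k, (rt ^ (Fintype.card (Option (CWire n m)) + 3) * slotAmp (b k)) else 0

open Classical in
/-- The input state of the universal program. -/
def ustate (φ : QState (Fin n)) (c : BitStr d) : QState (UWire n m d) := fun u =>
  φ (fun i => u (.inl (.inl i))) * basisState c (descBits u) *
    ancState n m (fun w => u (.inr w))

open Classical in
lemma ustate_eq (φ : QState (Fin n)) (c : BitStr d) (u : UWire n m d → Bit) :
    ustate φ c u = ∑ f : BitStr n, ∑ b : Fin (n + 2) → SlotVar (CWire n m) → Bit,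
      if u = fillWires f c b then φ f *
        ∏ k, (rt ^ (Fintype.card (Option (CWire n m)) + 3) * slotAmp (b k)) else 0 := by
  have hiff : ∀ (f : BitStr n) (b : Fin (n + 2) → SlotVar (CWire n m) → Bit),
      u = fillWires f c b ↔ f = (fun i => u (.inl (.inl i))) ∧ (descBits u = c ∧
        (fun w => u (.inr w)) = fillAnc b) := by
    intro f b
    constructor
    · rintro rfl
      refine ⟨rfl, rfl, funext fun w => ?_⟩
      rcases w with ⟨k, v, i⟩ | j <;> rfl
    · rintro ⟨rfl, h1, h2⟩
      funext w
      rcases w with (i | i) | w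
      · rfl
      · exact congrFun h1 i
      · refine (congrFun h2 w).trans ?_
        rcases w with ⟨k, v, i⟩ | j <;> rfl
  simp only [hiff, ite_and]
  have h1 : ∀ f : BitStr n, (∑ b : Fin (n + 2) → SlotVar (CWire n m) → Bit,
      if f = (fun i => u (.inl (.inl i))) then (if descBits u = c then
        (if (fun w => u (.inr w)) = fillAnc b then φ f *
        ∏ k, (rt ^ (Fintype.card (Option (CWire n m)) + 3) * slotAmp (b k)) else 0) else 0) else 0) =
      if f = (fun i => u (.inl (.inl i))) then (∑ b : Fin (n + 2) → SlotVar (CWire n m) → Bit,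
        if descBits u = c then
        (if (fun w => u (.inr w)) = fillAnc b then φ f *
        ∏ k, (rt ^ (Fintype.card (Option (CWire n m)) + 3) * slotAmp (b k)) else 0) else 0) else 0 := by
    intro f
    split_ifs <;> simp
  simp only [h1, Finset.sum_ite_eq', Finset.mem_univ, if_true]
  unfold ustate ancState basisState
  rw [Finset.mul_sum]
  refine Finset.sum_congr rfl fun b _ => ?_
  split_ifs <;> simp

/-- The initial state of the register: the input, the program state, and the junk qubit. -/
def inputState (x : BitStr m) (φ : QState (Fin n)) : QState (Option (CWire n m)) :=
  withJunk (fun s => basisState x (fun i => s (.inl i)) * φ (fun i => s (.inr i)))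
    (fun b => if b = 0 then 1 else 0)

open Classical in
lemma inputState_eq (x : BitStr m) (φ : QState (Fin n)) (A : Reg (CWire n m)) :
    inputState x φ A = ∑ f : BitStr n, if A = inputReg x f then φ f else 0 := by
  have hiff : ∀ f : BitStr n, A = inputReg x f ↔ f = (fun i => A (some (.inr i))) ∧
      ((fun i => A (some (.inl i))) = x ∧ A none = 0) := by
    intro f
    constructor
    · rintro rfl; exact ⟨rfl, rfl, rfl⟩
    · rintro ⟨rfl, rfl, h⟩
      funext j
      rcases j with _ | (i | i)
      · exact h
      · rfl
      · rfl
  simp only [hiff, ite_and, Finset.sum_ite_eq', Finset.mem_univ, if_true]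
  unfold inputState withJunk basisState
  by_cases h1 : (fun i => A (some (.inl i))) = x <;> by_cases h2 : A none = 0 <;> simp [h1, h2]

open Classical in
lemma prod_slotWeight (o : ℕ → SlotOp (CWire n m)) (q : ℕ → Frame (CWire n m))
    (r : ℕ → SlotRes (CWire n m)) (s : ℕ → SlotVar (CWire n m) → Bit) (A : Reg (CWire n m))
    (b : Fin (n + 2) → SlotVar (CWire n m) → Bit) :
    ∏ k : Fin (n + 2), slotWeight (o k) (q k).a (r k) (s k) (prevReg A b k) (b k) =
      if ∀ k : Fin (n + 2), slotCond (o k) (q k).a (r k) (prevReg A b k) (b k) then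
        sgn (∑ k : Fin (n + 2), ∑ v, s k v * b k v) * ∏ k, slotAmp (b k) else 0 := by
  unfold slotWeight
  by_cases h : ∀ k : Fin (n + 2), slotCond (o k) (q k).a (r k) (prevReg A b k) (b k)
  · rw [if_pos h, sgn_sum, ← Finset.prod_mul_distrib]
    exact Finset.prod_congr rfl fun k _ => if_pos (h k)
  · rw [if_neg h]
    obtain ⟨k, hk⟩ := not_forall.mp h
    exact Finset.prod_eq_zero (Finset.mem_univ k) (if_neg hk)

/-- All copies of a slot variable have the same content, so their Hadamard outcomes enter only
through the parity `slotOut`. -/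
lemma sign_exponent (x : BitStr m) (s : UWire n m d → Bit) (f : BitStr n) (c : BitStr d)
    (b : Fin (n + 2) → SlotVar (CWire n m) → Bit) :
    ∑ w, (if collapseBasis w = 1 then s w * fillWires f c b w else 0) =
      dotProduct (initFrame s).β (inputReg x f) +
        ∑ k : Fin (n + 2), ∑ v, slotOut s k v * b k v := by
  rw [Fintype.sum_sum_type, Fintype.sum_sum_type, Fintype.sum_sum_type]
  have h1 : dotProduct (initFrame s).β (inputReg x f) = ∑ i, s (.inl (.inl i)) * f i := by
    unfold dotProduct
    rw [Fintype.sum_option, Fintype.sum_sum_type]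
    simp [initFrame, inputReg]
  have h2 : ∀ k : Fin (n + 2), ∀ v, slotOut s k v * b k v =
      ∑ i, s (.inr (.inl (k, v, i))) * b k v := by
    intro k v
    rw [slotOut, dif_pos k.isLt, Finset.sum_mul]
  simp only [h1, h2, collapseBasis, fillWires, if_true, zero_ne_one, if_false,
    Finset.sum_const_zero, add_zero, Fintype.sum_prod_type]

/-- The amplitude is a path sum over the slot variables, evaluated by `exists_path_sum`. Its norm
depends on the results and on the Hadamard outcomes only through the bit flips of the final
register. -/
theorem norm_amp_uprog {N : ℕ} (e : UWire n m d ≃ Fin N) (D : Decoding n m m' d)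
    (φ : QState (Fin n)) (c : BitStr d) (ψ : QState (Fin N))
    (hψ : ∀ u : UWire n m d → Bit, ψ (fun w => u (e.symm w)) = ustate φ c u) (x : BitStr m)
    (r : BitStr (layers n m)) (s : UWire n m d → Bit) :
    ‖(uprog e D).amp e ψ x r s‖ ^ 2 = if descBits s = c then (1 / 2) ^ layers n m *
      ‖evolve (circuitOps (D c).1) (inputState x φ) (n + 2)
        ((fun j => s (.inr (.inr j))) + (uframe D r s (n + 2)).a)‖ ^ 2 else 0 := by
  classical
  set E := Fintype.card (Option (CWire n m)) + 3 with hE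
  have hb : ∀ w, (uprog e D).b (e w) = collapseBasis w := fun w =>
    congrArg collapseBasis (e.symm_apply_apply w)
  have h1 : (uprog e D).amp e ψ x r s = ∑ f : BitStr n,
      ∑ b : Fin (n + 2) → SlotVar (CWire n m) → Bit,
        if descBits s = c ∧ prevReg (inputReg x f) b (n + 2) = fun j => s (.inr (.inr j)) then
          (rt ^ E) ^ (n + 2) * ((sgn (dotProduct (initFrame s).β (inputReg x f)) * φ f) *
            ∏ k : Fin (n + 2), slotWeight (circuitOps (D (descBits s)).1 k) (uframe D r s k).a
              (slotRes r k) (slotOut s k) (prevReg (inputReg x f) b k) (b k)) else 0 := by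
    unfold MeasProgram.amp
    simp only [hψ, ustate_eq, Finset.mul_sum, mul_ite, mul_zero, hb]
    have hpush : ∀ (p : (UWire n m d → Bit) → Prop) [DecidablePred p] (F : (UWire n m d → Bit) → BitStr n →
        (Fin (n + 2) → SlotVar (CWire n m) → Bit) → ℂ),
        ∑ u, (if p u then ∑ f, ∑ b, (if u = fillWires f c b then F u f b else 0) else 0) =
        ∑ f, ∑ b, if p (fillWires f c b) then F (fillWires f c b) f b else 0 := by
      intro p _ F
      have : ∀ u, (if p u then ∑ f, ∑ b, (if u = fillWires f c b then F u f b else 0) else 0) =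
          ∑ f, ∑ b, (if u = fillWires f c b then (if p u then F u f b else 0) else 0) := by
        intro u
        split_ifs <;> simp
      simp only [this]
      rw [Finset.sum_comm]
      refine Finset.sum_congr rfl fun f _ => ?_
      rw [Finset.sum_comm]
      refine Finset.sum_congr rfl fun b _ => ?_
      rw [Finset.sum_ite_eq', if_pos (Finset.mem_univ _)]
    rw [hpush]
    refine Finset.sum_congr rfl fun f _ => Finset.sum_congr rfl fun b _ => ?_
    -- The wires collapsed in the standard basis are the description, which fixes the circuit, and
    -- the output copies, which fix the last register.
    have hagree : (∀ w, collapseBasis w ≠ 1 → fillWires f c b w = s w) ↔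
        descBits s = c ∧ prevReg (inputReg x f) b (n + 2) = fun j => s (.inr (.inr j)) := by
      have hp : prevReg (inputReg x f) b (n + 2) = fun j => b (Fin.last (n + 1)) (.inl j) := by
        have h : n + 1 < n + 2 := by omega
        simp only [prevReg, dif_pos h]
        rfl
      rw [hp]
      constructor
      · intro h
        exact ⟨funext fun i => (h (.inl (.inr i)) zero_ne_one).symm,
          funext fun j => h (.inr (.inr j)) zero_ne_one⟩
      · rintro ⟨h1, h2⟩ w hw
        rcases w with (i | i) | (⟨k, v, i⟩ | j)
        · exact absurd rfl hw
        · exact (congrFun h1 i).symm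
        · exact absurd rfl hw
        · exact congrFun h2 j
    rw [sign_exponent x, prod_slotWeight (q := fun k => uframe D r s k)]
    rw [if_congr (and_congr_left' hagree) rfl rfl]
    by_cases hP : descBits s = c ∧
        prevReg (inputReg x f) b (n + 2) = fun j => s (.inr (.inr j))
    swap
    · rw [if_neg hP, if_neg fun h => hP h.1]
    rw [if_pos hP,
      if_congr ((and_iff_right hP).trans (forall_cond_uprog e D x r s f c b)) rfl rfl,
      mul_ite, mul_ite, mul_zero, mul_zero]
    congr 1
    rw [Finset.prod_mul_distrib, Finset.prod_const, Finset.card_univ, Fintype.card_fin, sgn_add]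
    ring
  rw [h1]
  by_cases hc : descBits s = c
  · rw [if_pos hc]
    simp only [hc, true_and]
    obtain ⟨z, hz, hsum⟩ := exists_path_sum (initFrame s) (circuitOps (D c).1) (slotRes r)
      (slotOut s) (n + 2)
    have hfr : ∀ k, uframe D r s k = frameAt (initFrame s) (circuitOps (D c).1) (slotRes r)
        (slotOut s) k := fun k => by rw [uframe, hc]
    have h2 := hsum (inputState x φ) fun j => s (.inr (.inr j))
    have ha : (initFrame s).a = 0 := rfl
    simp only [ha, add_zero, inputState_eq, Finset.mul_sum, Finset.sum_mul, ← hfr] at h2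
    have h3 : ∀ (F : Reg (CWire n m) → (Fin (n + 2) → SlotVar (CWire n m) → Bit) → ℂ)
        (p : Reg (CWire n m) → (Fin (n + 2) → SlotVar (CWire n m) → Bit) → Prop)
        [∀ A b, Decidable (p A b)],
        ∑ A, ∑ b, (if p A b then ∑ f : BitStr n, (sgn (dotProduct (initFrame s).β A) *
          if A = inputReg x f then φ f else 0) * F A b else 0) =
        ∑ f : BitStr n, ∑ b, if p (inputReg x f) b then
          (sgn (dotProduct (initFrame s).β (inputReg x f)) * φ f) * F (inputReg x f) b else 0 := by
      intro F p _
      have : ∀ A b, (if p A b then ∑ f : BitStr n, (sgn (dotProduct (initFrame s).β A) *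
          if A = inputReg x f then φ f else 0) * F A b else 0) =
          ∑ f : BitStr n, if A = inputReg x f then (if p A b then
            (sgn (dotProduct (initFrame s).β A) * φ f) * F A b else 0) else 0 := by
        intro A b
        by_cases hp : p A b
        · simp only [if_pos hp]
          refine Finset.sum_congr rfl fun f _ => ?_
          split_ifs <;> simp
        · simp [if_neg hp]
      simp only [this]
      rw [Finset.sum_comm]
      refine (Finset.sum_congr rfl fun b _ => Finset.sum_comm).trans ?_
      rw [Finset.sum_comm]
      refine Finset.sum_congr rfl fun f _ => Finset.sum_congr rfl fun b _ => ?_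
      rw [Finset.sum_ite_eq', if_pos (Finset.mem_univ _)]
    rw [h3] at h2
    have h4 : ∑ f : BitStr n, ∑ b : Fin (n + 2) → SlotVar (CWire n m) → Bit,
        (if prevReg (inputReg x f) b (n + 2) = fun j => s (.inr (.inr j)) then
          (rt ^ E) ^ (n + 2) * ((sgn (dotProduct (initFrame s).β (inputReg x f)) * φ f) *
            ∏ k : Fin (n + 2), slotWeight (circuitOps (D c).1 k) (uframe D r s k).a
              (slotRes r k) (slotOut s k) (prevReg (inputReg x f) b k) (b k)) else 0) =
        (rt ^ E) ^ (n + 2) * (z * (sgn (dotProduct (uframe D r s (n + 2)).β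
          fun j => s (.inr (.inr j))) * evolve (circuitOps (D c).1) (inputState x φ) (n + 2)
        ((fun j => s (.inr (.inr j))) + (uframe D r s (n + 2)).a))) := by
      rw [← h2, Finset.mul_sum]
      refine Finset.sum_congr rfl fun f _ => ?_
      rw [Finset.mul_sum]
      refine Finset.sum_congr rfl fun b _ => ?_
      rw [mul_ite, mul_zero]
    rw [h4]
    simp only [norm_mul, norm_sgn, one_mul, mul_pow, norm_pow, hz]
    rw [← mul_assoc]
    congr 1
    rw [← pow_mul, ← pow_mul, mul_comm _ 2, ← mul_assoc, mul_comm _ 2, mul_assoc, pow_mul,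
      norm_rt_sq, layers, slotLayers]
    -- The ancillas contribute `(1/2)^{E (n+2)}` and the path sum `2^{n+2}`; the remaining exponent
    -- is the number of layers, one factor `1/2` per result bit.
    have h5 : E * (n + 2) = (n + 2) * (2 + Fintype.card (Option (CWire n m))) + (n + 2) := by
      rw [hE]; ring
    rw [h5, pow_add, mul_assoc, ← mul_pow]
    norm_num
  · simp [hc]

lemma sum_sum_arrow {α β : Type} [Fintype α] [Fintype β] [DecidableEq α] [DecidableEq β]
    (F : (α ⊕ β → Bit) → ℝ) : ∑ s, F s = ∑ a : α → Bit, ∑ b : β → Bit, F (Sum.elim a b) := by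
  rw [← Equiv.sum_comp (Equiv.sumArrowEquivProdArrow α β Bit).symm, Fintype.sum_prod_type]
  rfl

lemma sum_uwire (F : (UWire n m d → Bit) → ℝ) :
    ∑ s, F s = ∑ f : BitStr n, ∑ c : BitStr d,
      ∑ g : Fin (n + 2) × SlotVar (CWire n m) × Fin (layers n m) → Bit, ∑ R : Reg (CWire n m),
        F (Sum.elim (Sum.elim f c) (Sum.elim g R)) := by
  rw [sum_sum_arrow, sum_sum_arrow]
  refine Finset.sum_congr rfl fun f _ => Finset.sum_congr rfl fun c _ => ?_
  rw [sum_sum_arrow]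

lemma card_collapseBasis :
    (Finset.univ.filter fun w : UWire n m d => collapseBasis w = 1).card =
      n + Fintype.card (Fin (n + 2) × SlotVar (CWire n m) × Fin (layers n m)) := by
  rw [Finset.card_filter, Fintype.sum_sum_type, Fintype.sum_sum_type, Fintype.sum_sum_type]
  simp only [collapseBasis, if_true, zero_ne_one, if_false, Finset.sum_const_zero, add_zero,
    Finset.sum_const, Finset.card_univ, Fintype.card_fin, smul_eq_mul, mul_one]

/-- For every string of results and every Hadamard outcome, the sum over the output copies is the
same after a shift by the bit flips. The powers of `1/2` cancel against the number of these strings,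
and what is left is the output probability of the circuit with a normalised junk qubit. -/
theorem evalProb_uprog {N : ℕ} (e : UWire n m d ≃ Fin N) (D : Decoding n m m' d)
    (φ : QState (Fin n)) (C : QCircuit m n m') (hC : C.gates.length ≤ n) (c : BitStr d)
    (hG : ∀ i, (D c).1 i = C.gates[i]?) (hout : ∀ o, (D c).2 o = some (C.out o))
    (ψ : QState (Fin N))
    (hψ : ∀ u : UWire n m d → Bit, ψ (fun w => u (e.symm w)) = ustate φ c u) (x : BitStr m)
    (y : BitStr m') : (uprog e D).toLM.evalProb ψ x y = C.outProb φ x y := by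
  classical
  rw [(uprog e D).evalProb_eq_sum_amp e]
  have hb : ∀ w, (uprog e D).b (e w) = collapseBasis w := fun w =>
    congrArg collapseBasis (e.symm_apply_apply w)
  have hg : ∀ r (s : UWire n m d → Bit), (uprog e D).g x r (fun w => s (e.symm w)) =
      finalOut D r s := by
    intro r s
    change finalOut D r (fun w => s (e.symm (e w))) = _
    simp only [Equiv.symm_apply_apply]
  simp only [hb, hg, norm_amp_uprog e D φ c ψ hψ, card_collapseBasis]
  set X := n + Fintype.card (Fin (n + 2) × SlotVar (CWire n m) × Fin (layers n m)) with hX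
  set χ := evolve (circuitOps (D c).1) (inputState x φ) (n + 2) with hχ
  let H : Reg (CWire n m) → ℝ := fun Z =>
    if (fun o => postMap ((D c).1 n) Z ((D c).2 o)) = y then ‖χ Z‖ ^ 2 else 0
  have h1 : ∀ r, ∑ s : UWire n m d → Bit, (if finalOut D r s = y then (1 / 2 : ℝ) ^ X *
      (if descBits s = c then (1 / 2) ^ layers n m *
      ‖χ ((fun j => s (.inr (.inr j))) + (uframe D r s (n + 2)).a)‖ ^ 2 else 0) else 0) =
      (1 / 2) ^ layers n m * ∑ Z, H Z := by
    intro r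
    rw [sum_uwire]
    have h2 : ∀ (f : BitStr n) (c' : BitStr d)
        (g : Fin (n + 2) × SlotVar (CWire n m) × Fin (layers n m) → Bit),
        ∑ R : Reg (CWire n m), (if finalOut D r (Sum.elim (Sum.elim f c') (Sum.elim g R)) = y then
          (1 / 2 : ℝ) ^ X * (if descBits (Sum.elim (Sum.elim f c') (Sum.elim g R)) = c then
            (1 / 2) ^ layers n m * ‖χ ((fun j => (Sum.elim (Sum.elim f c') (Sum.elim g R) :
              UWire n m d → Bit) (.inr (.inr j))) +
              (uframe D r (Sum.elim (Sum.elim f c') (Sum.elim g R)) (n + 2)).a)‖ ^ 2 else 0)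
          else 0) = if c' = c then (1 / 2 : ℝ) ^ X * ((1 / 2) ^ layers n m * ∑ Z, H Z) else 0 := by
      intro f c' g
      by_cases hc : c' = c
      · subst hc
        -- The corrections do not read the output copies `R`, so they may be computed at `R = 0` and
        -- the shift by `a` is a bijection in `R`.
        set a := (uframe D r (Sum.elim (Sum.elim f c') (Sum.elim g 0)) (n + 2)).a with ha
        have hsh : ∑ Z, H Z = ∑ R, H (R + a) := (Equiv.sum_comp (Equiv.addRight a) H).symm
        rw [if_pos rfl, hsh, Finset.mul_sum, Finset.mul_sum]
        refine Finset.sum_congr rfl fun R _ => ?_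
        have hd : descBits (Sum.elim (Sum.elim f c') (Sum.elim g R) : UWire n m d → Bit) = c' := rfl
        have hfr : (uframe D r (Sum.elim (Sum.elim f c') (Sum.elim g R)) (n + 2)).a = a := rfl
        have hfin : finalOut D r (Sum.elim (Sum.elim f c') (Sum.elim g R)) =
            fun o => postMap ((D c').1 n) (R + a) ((D c').2 o) := rfl
        rw [hfin, if_pos hd, hfr]
        simp only [H]
        split_ifs
        · rfl
        · simp
      · rw [if_neg hc]
        refine Finset.sum_eq_zero fun R _ => ?_
        have hd : descBits (Sum.elim (Sum.elim f c') (Sum.elim g R) : UWire n m d → Bit) = c' := rfl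
        rw [hd, if_neg hc, mul_zero, ite_self]
    simp only [h2]
    rw [Finset.sum_comm]
    have h3 : ∀ c' : BitStr d, ∑ _f : BitStr n,
        ∑ _g : Fin (n + 2) × SlotVar (CWire n m) × Fin (layers n m) → Bit,
          (if c' = c then (1 / 2 : ℝ) ^ X * ((1 / 2) ^ layers n m * ∑ Z, H Z) else 0) =
          if c' = c then (1 / 2) ^ layers n m * ∑ Z, H Z else 0 := by
      intro c'
      rw [Finset.sum_const, Finset.sum_const, Finset.card_univ, Finset.card_univ]
      simp only [Fintype.card_fun, ZMod.card, Fintype.card_fin, nsmul_eq_mul]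
      split_ifs
      · rw [← mul_assoc, ← mul_assoc]
        push_cast
        have h4 : (2 : ℝ) ^ n * 2 ^ Fintype.card (Fin (n + 2) × SlotVar (CWire n m) ×
            Fin (layers n m)) * (1 / 2) ^ X = 1 := by
          rw [← pow_add, ← hX, ← mul_pow]; norm_num
        rw [h4, one_mul]
      · simp
    simp only [h3, Finset.sum_ite_eq', Finset.mem_univ, if_true]
  simp only [h1]
  rw [Finset.sum_const, Finset.card_univ]
  simp only [Fintype.card_fun, ZMod.card, Fintype.card_fin, nsmul_eq_mul]
  rw [← mul_assoc]
  have h5 : ((2 ^ layers n m : ℕ) : ℝ) * (1 / 2) ^ layers n m = 1 := by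
    push_cast
    rw [← mul_pow]; norm_num
  rw [h5, one_mul]
  obtain ⟨ξ, hξ, hev⟩ := evolve_circuitOps (D c).1
    (fun s : CWire n m → Bit => basisState x (fun i => s (.inl i)) * φ (fun i => s (.inr i)))
    (fun b : Bit => if b = 0 then (1 : ℂ) else 0) (by simp) n
  have hG' : (D c).1 = fun i => C.gates[i]? := funext hG
  have hrun := runOpts_getElem? C.gates
    (fun s : CWire n m → Bit => basisState x (fun i => s (.inl i)) * φ (fun i => s (.inr i)))
    (n + 1) (by omega)
  rw [← hG'] at hrun
  rw [hrun] at hev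
  have hχ' : χ = _ := hev
  rw [QCircuit.outProb, ← weight_withJunk _ ξ hξ, weight]
  -- Undoing the swap left by the last slot permutes the register strings.
  refine Eq.trans ?_ (Equiv.sum_comp (postMap ((D c).1 n)).toEquiv _)
  refine Finset.sum_congr rfl fun Z _ => ?_
  simp only [H, hχ', hout, project_apply, funext_iff, LinearEquiv.coe_toEquiv]
  split_ifs
  · rfl
  · rw [norm_zero, zero_pow two_ne_zero]

end Universal

/-! ### Preparation of the ancillas -/

section Generic

variable {ι : Type} [Fintype ι] [DecidableEq ι]

/-- The gates `gs` multiply each amplitude by a phase. -/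
def Multiplies (gs : List (Gate ι)) (g : (ι → Bit) → ℂ) : Prop :=
  ∀ (ψ : QState ι) (v : ι → Bit), runGates gs ψ v = g v * ψ v

lemma Multiplies.append {gs gs' : List (Gate ι)} {g g' : (ι → Bit) → ℂ} (h : Multiplies gs g)
    (h' : Multiplies gs' g') : Multiplies (gs ++ gs') fun v => g v * g' v := by
  intro ψ v
  rw [runGates_append, h', h]
  ring

lemma multiplies_tgate (i : ι) : Multiplies [.tgate i] fun v => tph (v i) := fun _ _ => rfl

lemma multiplies_cz (i j : ι) (h : i ≠ j) :
    Multiplies [.had j, .cnot i j h, .had j] fun v => sgn (v i * v j) := by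
  intro ψ v
  simp only [runGates_cons, runGates_nil, had_apply, cnot_apply, Function.update_self,
    Function.update_of_ne h, Function.update_idem]
  have h2 := rt_mul_rt
  rcases bit_cases (v i) with hi | hi <;> rcases bit_cases (v j) with hj | hj <;>
    simp only [hi, hj, zero_add, add_zero, mul_zero, mul_one, sgn_zero, sgn_one, one_add_one_bit]
  · have hv : Function.update v j 0 = v := by rw [← hj, Function.update_eq_self]
    rw [hv]
    linear_combination 2 * ψ v * h2
  · have hv : Function.update v j 1 = v := by rw [← hj, Function.update_eq_self]
    rw [hv]
    linear_combination 2 * ψ v * h2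
  · have hv : Function.update v j 0 = v := by rw [← hj, Function.update_eq_self]
    rw [hv]
    linear_combination 2 * ψ v * h2
  · have hv : Function.update v j 1 = v := by rw [← hj, Function.update_eq_self]
    rw [hv]
    linear_combination (-2) * ψ v * h2

lemma multiplies_flatMap {κ : Type} (l : List κ) (gs : κ → List (Gate ι)) (g : κ → (ι → Bit) → ℂ)
    (h : ∀ k, Multiplies (gs k) (g k)) :
    Multiplies (l.flatMap gs) fun v => (l.map fun k => g k v).prod := by
  induction l with
  | nil => intro ψ v; simp
  | cons k l ih =>
    intro ψ v
    rw [List.flatMap_cons, (h k).append ih ψ v]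
    simp only [List.map_cons, List.prod_cons]

lemma hadList_basisState_zero (l : List ι) (hl : l.Nodup) (v : ι → Bit) [Decidable (∀ w, w ∉ l → v w = 0)] :
    hadList l (basisState 0) v = if ∀ w, w ∉ l → v w = 0 then rt ^ l.length else 0 := by
  classical
  rw [hadList_apply _ hl, Finset.sum_eq_single 0]
  · have : (∀ w, w ∉ l → (0 : ι → Bit) w = v w) ↔ ∀ w, w ∉ l → v w = 0 :=
      forall_congr' fun w => imp_congr_right fun _ => eq_comm
    simp only [this]
    split_ifs <;> simp [basisState]
  · intro Y _ hY
    simp [basisState, hY]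
  · simp

/-- Add the bit of the wire `π w` to each wire `w` of `l`. -/
def copyGates (π : ι → ι) (l : List ι) : List (Gate ι) :=
  l.flatMap fun w => if h : π w ≠ w then [.cnot (π w) w h] else []

lemma length_copyGates_le (π : ι → ι) (l : List ι) : (copyGates π l).length ≤ l.length := by
  induction l with
  | nil => exact le_rfl
  | cons w l ih =>
    rw [copyGates, List.flatMap_cons, List.length_append, List.length_cons, add_comm]
    refine Nat.add_le_add ih ?_
    split_ifs <;> simp

/-- The sources lie outside `l`, so they keep their values throughout and the CNOT gates do not
interfere. -/
lemma runGates_copyGates (π : ι → ι) (l : List ι) (hl : l.Nodup) (hπ : ∀ w ∈ l, π w ∉ l)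
    (ψ : QState ι) (v v' : ι → Bit) (h1 : ∀ w ∈ l, v' w = v w + v (π w))
    (h2 : ∀ w, w ∉ l → v' w = v w) : runGates (copyGates π l) ψ v = ψ v' := by
  induction l generalizing ψ v' with
  | nil => exact congrArg ψ (funext fun w => (h2 w List.not_mem_nil).symm)
  | cons w l ih =>
    have hw : π w ≠ w := fun h => hπ w List.mem_cons_self (h.symm ▸ List.mem_cons_self)
    have hwl : π w ∉ l := fun h => hπ w List.mem_cons_self (List.mem_cons_of_mem _ h)
    obtain ⟨hwn, hl⟩ := List.nodup_cons.mp hl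
    have e : copyGates π (w :: l) = .cnot (π w) w hw :: copyGates π l := by
      rw [copyGates, List.flatMap_cons, dif_pos hw]; rfl
    rw [e, runGates_cons,
      ih hl (fun u hu h => hπ u (List.mem_cons_of_mem _ hu) (List.mem_cons_of_mem _ h)) _
        (Function.update v' w (v w)) ?_ ?_, cnot_apply]
    · congr 1
      rw [Function.update_idem, Function.update_self, Function.update_of_ne hw,
        h2 _ (by simp [hw, hwl]), ← h1 w List.mem_cons_self, Function.update_eq_self]
    · intro u hu
      rw [Function.update_of_ne (by rintro rfl; exact hwn hu), h1 u (List.mem_cons_of_mem _ hu)]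
    · intro u hu
      by_cases h : u = w
      · rw [h, Function.update_self]
      · rw [Function.update_of_ne h, h2 u (by simp [h, hu])]

/-- Rename the wires of a gate. -/
def Gate.map {α β : Type} (e : α ≃ β) : Gate α → Gate β
  | .cnot i j h => .cnot (e i) (e j) (e.injective.ne h)
  | .had i => .had (e i)
  | .tgate i => .tgate (e i)

lemma runGates_map {N : ℕ} (e : ι ≃ Fin N) (gs : List (Gate ι)) (ψ : QState (Fin N)) (u : ι → Bit) :
    runGates (gs.map (Gate.map e)) ψ (fun w => u (e.symm w)) =
      runGates gs (fun u => ψ fun w => u (e.symm w)) u := by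
  induction gs generalizing ψ with
  | nil => rfl
  | cons g gs ih =>
    rw [List.map_cons, runGates_cons, runGates_cons, ih]
    congr 1
    funext u
    cases g with
    | cnot i j h => simp only [Gate.map, cnot_apply, update_comp_symm, Equiv.symm_apply_apply]
    | had i => simp only [Gate.map, had_apply, update_comp_symm, Equiv.symm_apply_apply]
    | tgate i => simp only [Gate.map, Gate.apply, Equiv.symm_apply_apply]

end Generic

section Anc

variable {n m : ℕ}

/-- The wire that a wire of the ancillas copies. -/
def copySource : AncWire n m → AncWire n m
  | .inl (k, v, _) => .inl (k, v, ⟨0, layers_pos⟩)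
  | .inr j => .inl (Fin.last (n + 1), .inl j, ⟨0, layers_pos⟩)

/-- The ancilla for a slot variable from which the others are copied. -/
def baseWire (k : Fin (n + 2)) (v : SlotVar (CWire n m)) : AncWire n m :=
  .inl (k, v, ⟨0, layers_pos⟩)

lemma copySource_baseWire (k : Fin (n + 2)) (v : SlotVar (CWire n m)) :
    copySource (baseWire k v) = baseWire k v := rfl

lemma copySource_copySource (w : AncWire n m) : copySource (copySource w) = copySource w := by
  rcases w with ⟨k, v, i⟩ | j <;> rfl

lemma baseWire_injective : Function.Injective
    fun p : Fin (n + 2) × SlotVar (CWire n m) => baseWire p.1 p.2 := by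
  rintro ⟨k, v⟩ ⟨k', v'⟩ h
  simpa [baseWire] using h

lemma exists_eq_baseWire (w : AncWire n m) (h : copySource w = w) : ∃ k v, w = baseWire k v := by
  rcases w with ⟨k, v, i⟩ | j
  · exact ⟨k, v, h.symm⟩
  · simp [copySource] at h

lemma fillAnc_base (v : AncWire n m → Bit) (w : AncWire n m) :
    fillAnc (fun k a => v (baseWire k a)) w = v (copySource w) := by
  rcases w with ⟨k, a, i⟩ | j <;> rfl

lemma ancState_eq (v : AncWire n m → Bit) [Decidable (∀ w, v w = v (copySource w))] :
    ancState n m v = if ∀ w, v w = v (copySource w) then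
      (rt ^ (Fintype.card (Option (CWire n m)) + 3)) ^ (n + 2) *
        ∏ k, slotAmp fun a => v (baseWire k a) else 0 := by
  classical
  unfold ancState
  rw [Finset.sum_eq_single fun k a => v (baseWire k a)]
  · refine if_congr ?_ ?_ rfl
    · exact funext_iff.trans (forall_congr' fun w => by rw [fillAnc_base])
    · rw [Finset.prod_mul_distrib, Finset.prod_const, Finset.card_univ, Fintype.card_fin]
  · intro b _ hb
    refine if_neg fun h => hb ?_
    subst h
    rfl
  · simp

/-- One base wire per slot variable is put into the uniform superposition and receives its phases: a
controlled phase for the junk teleportation (three gates), one `T` gate, and two for `S`. The other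
wires are then CNOT copies, so at most two gates per wire are added to six per slot. -/
theorem exists_ancState_circuit (n m : ℕ) : ∃ gs : List (Gate (AncWire n m)),
    gs.length ≤ 2 * Fintype.card (AncWire n m) + 6 * (n + 2) ∧
      runGates gs (basisState 0) = ancState n m := by
  classical
  let B : List (AncWire n m) := ((Finset.univ : Finset (Fin (n + 2) × SlotVar (CWire n m))).toList).map
    fun p => baseWire p.1 p.2
  have hB : B.Nodup := (Finset.nodup_toList _).map baseWire_injective
  have hmem : ∀ w, w ∈ B ↔ copySource w = w := by
    intro w
    simp only [B, List.mem_map, Finset.mem_toList, Finset.mem_univ, true_and, Prod.exists]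
    constructor
    · rintro ⟨k, v, rfl⟩; exact copySource_baseWire k v
    · intro h
      obtain ⟨k, v, rfl⟩ := exists_eq_baseWire w h
      exact ⟨k, v, rfl⟩
  have hlen : B.length = (n + 2) * (Fintype.card (Option (CWire n m)) + 3) := by
    simp only [B, List.length_map, Finset.length_toList, Finset.card_univ, Fintype.card_prod,
      Fintype.card_sum, Fintype.card_fin]
  let Cp : List (AncWire n m) := (Finset.univ.filter fun w => copySource w ≠ w).toList
  have hCp : ∀ w, w ∈ Cp ↔ copySource w ≠ w := by simp [Cp]
  have hne : ∀ k : Fin (n + 2), baseWire (m := m) k (.inr 0) ≠ baseWire k (.inl none) := by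
    intro k h
    simp [baseWire] at h
  let P : Fin (n + 2) → List (Gate (AncWire n m)) := fun k =>
    [.had (baseWire k (.inl none)), .cnot _ _ (hne k), .had (baseWire k (.inl none))] ++
      ([.tgate (baseWire k (.inr 1))] ++
      ([.tgate (baseWire k (.inr 2))] ++ [.tgate (baseWire k (.inr 2))]))
  have hP : ∀ k, Multiplies (P k) fun v => slotAmp fun a => v (baseWire k a) := fun k =>
    (multiplies_cz _ _ (hne k)).append ((multiplies_tgate _).append
      ((multiplies_tgate _).append (multiplies_tgate _)))
  refine ⟨B.map Gate.had ++ ((List.finRange (n + 2)).flatMap P ++ copyGates copySource Cp), ?_, ?_⟩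
  · have h1 : B.length ≤ Fintype.card (AncWire n m) := hB.length_le_card
    have h2 : Cp.length ≤ Fintype.card (AncWire n m) := (Finset.nodup_toList _).length_le_card
    have h3 := length_copyGates_le copySource Cp
    have h4 : ((List.finRange (n + 2)).flatMap P).length = (n + 2) * 6 := by
      rw [List.length_flatMap]
      simp [P]
    rw [List.length_append, List.length_append, List.length_map, h4]
    omega
  · funext v
    -- `v'` is the string before copying that leads to `v`; it is zero on the copies exactly when
    -- `v` has consistent copies.
    obtain ⟨v', hv₁, hv₂⟩ : ∃ v' : AncWire n m → Bit, (∀ w ∈ Cp, v' w = v w + v (copySource w)) ∧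
        ∀ w, w ∉ Cp → v' w = v w :=
      ⟨fun w => if w ∈ Cp then v w + v (copySource w) else v w, fun _ h => if_pos h,
        fun _ h => if_neg h⟩
    have hbase : ∀ k a, v' (baseWire k a) = v (baseWire k a) := fun k a =>
      hv₂ _ fun h => (hCp _).mp h (copySource_baseWire k a)
    have hiff : (∀ w, w ∉ B → v' w = 0) ↔ ∀ w, v w = v (copySource w) := by
      refine forall_congr' fun w => ?_
      rw [hmem]
      by_cases h : copySource w = w
      · simp [h]
      · rw [hv₁ w ((hCp w).mpr h), bit_add_eq_iff, add_zero]
        exact imp_iff_right h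
    rw [runGates_append, runGates_append, runGates_copyGates _ Cp (Finset.nodup_toList _)
      (fun w _ h => (hCp _).mp h (copySource_copySource w)) _ v v' hv₁ hv₂,
      multiplies_flatMap _ _ _ hP, ancState_eq]
    change _ * hadList B _ _ = _
    rw [hadList_basisState_zero B hB, hlen, ← List.prod_ofFn, List.ofFn_eq_map,
      if_congr hiff rfl rfl]
    simp only [hbase, mul_ite, mul_zero]
    split_ifs
    · rw [← pow_mul, mul_comm (n + 2), mul_comm]
    · rfl

end Anc

/-! ### The universal family -/

section Description

/-- The wires and the kind of a gate. -/
def Gate.code {ι : Type} : Gate ι → ι × ι × Fin 3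
  | .cnot i j _ => (i, j, 0)
  | .had i => (i, i, 1)
  | .tgate i => (i, i, 2)

lemma Gate.code_injective {ι : Type} : Function.Injective (Gate.code (ι := ι)) := by
  intro g g' h
  cases g <;> cases g' <;> simp_all [Gate.code]

/-- A padded list of gates, and the output wires. -/
abbrev CircuitData (n m m' : ℕ) : Type :=
  (Fin n → Option (Gate (CWire n m))) × (Fin m' → Option (CWire n m))

/-- The length of the descriptions of circuits. -/
def descLen (n m m' : ℕ) : ℕ := ((m + n) * ((m + n) * 3) + 1) * n + (m + n + 1) * m'

/-- Counting is enough: a set of `a` elements embeds into `a` bits as `a ≤ 2^a`, and this crude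
length is still polynomial. -/
lemma exists_description (n m m' : ℕ) :
    ∃ code : CircuitData n m m' → BitStr (descLen n m m'), Function.Injective code := by
  have h1 : Function.Injective (Prod.map
      (fun f : Fin n → Option (Gate (CWire n m)) => fun i => (f i).map Gate.code)
      (id : (Fin m' → Option (CWire n m)) → _)) := by
    refine Function.Injective.prodMap (fun f f' h => funext fun i => ?_) Function.injective_id
    exact Option.map_injective Gate.code_injective (congrFun h i)
  have h2 : Fintype.card ((Fin n → Option (CWire n m × CWire n m × Fin 3)) ×
      (Fin m' → Option (CWire n m))) ≤ Fintype.card (BitStr (descLen n m m')) := by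
    have h3 : ∀ d, Fintype.card (BitStr d) = 2 ^ d := fun d => by
      rw [Fintype.card_fun, ZMod.card, Fintype.card_fin]
    rw [h3]
    simp only [Fintype.card_prod, Fintype.card_fun, Fintype.card_option, Fintype.card_sum,
      Fintype.card_fin, descLen, pow_add 2 _ ((m + n + 1) * m'), pow_mul 2]
    exact Nat.mul_le_mul (Nat.pow_le_pow_left Nat.lt_two_pow_self.le _)
      (Nat.pow_le_pow_left Nat.lt_two_pow_self.le _)
  obtain ⟨φ⟩ := Function.Embedding.nonempty_of_card_le h2
  exact ⟨_, φ.injective.comp h1⟩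

/-- The description of circuits. -/
def describe (n m m' : ℕ) : CircuitData n m m' → BitStr (descLen n m m') :=
  (exists_description n m m').choose

lemma describe_injective (n m m' : ℕ) : Function.Injective (describe n m m') :=
  (exists_description n m m').choose_spec

/-- The data of a circuit. -/
def QCircuit.data {m n m' : ℕ} (C : QCircuit m n m') : CircuitData n m m' :=
  (fun i => C.gates[i.val]?, fun o => some (C.out o))

/-- The decoding of descriptions. -/
def decoding (n m m' : ℕ) : Decoding n m m' (descLen n m m') := fun c =>
  (fun i => if h : i < n then (Function.invFun (describe n m m') c).1 ⟨i, h⟩ else none,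
    (Function.invFun (describe n m m') c).2)

lemma decoding_fst {m n m' : ℕ} (C : QCircuit m n m') (hC : C.gates.length ≤ n) (i : ℕ) :
    (decoding n m m' (describe n m m' C.data)).1 i = C.gates[i]? := by
  simp only [decoding, Function.leftInverse_invFun (describe_injective n m m') C.data]
  split_ifs with h
  · rfl
  · rw [List.getElem?_eq_none (by omega)]

lemma decoding_snd {m n m' : ℕ} (C : QCircuit m n m') (o : Fin m') :
    (decoding n m m' (describe n m m' C.data)).2 o = some (C.out o) := by
  simp only [decoding, Function.leftInverse_invFun (describe_injective n m m') C.data]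
  rfl

end Description

/-- The order of the wires of the universal program. -/
def uwireEquiv (n m d : ℕ) : UWire n m d ≃ Fin (n + d + Fintype.card (AncWire n m)) :=
  (Equiv.sumCongr finSumFinEquiv (Fintype.equivFin (AncWire n m))).trans finSumFinEquiv

/-- The universal family. -/
def universal (n m m' : ℕ → ℕ) : UniversalLM n m m' where
  d := fun lam => descLen (n lam) (m lam) (m' lam)
  a := fun lam => Fintype.card (AncWire (n lam) (m lam))
  t := fun lam => layers (n lam) (m lam)
  prog := fun lam => (uprog (uwireEquiv (n lam) (m lam) _) (decoding (n lam) (m lam) (m' lam))).toLM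
  desc := fun lam C => describe (n lam) (m lam) (m' lam) C.data
  anc := fun lam => (exists_ancState_circuit (n lam) (m lam)).choose.map
    (Gate.map (Fintype.equivFin (AncWire (n lam) (m lam))))

lemma universal_input (n m m' : ℕ → ℕ) (lam : ℕ) (C : QCircuit (m lam) (n lam) (m' lam))
    (φ : QState (Fin (n lam)))
    (u : UWire (n lam) (m lam) (descLen (n lam) (m lam) (m' lam)) → Bit) :
    (universal n m m').input lam C φ
        (fun w => u ((uwireEquiv (n lam) (m lam) (descLen (n lam) (m lam) (m' lam))).symm w)) =
      ustate φ (describe (n lam) (m lam) (m' lam) C.data) u := by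
  set e := uwireEquiv (n lam) (m lam) (descLen (n lam) (m lam) (m' lam)) with he
  have h1 : ∀ i, e.symm (Fin.castAdd _ (Fin.castAdd _ i)) = .inl (.inl i) := fun i =>
    e.symm_apply_eq.mpr rfl
  have h2 : ∀ i, e.symm (Fin.castAdd _ (Fin.natAdd _ i)) = .inl (.inr i) := fun i =>
    e.symm_apply_eq.mpr rfl
  have h3 : ∀ i, e.symm (Fin.natAdd _ i) =
      .inr ((Fintype.equivFin (AncWire (n lam) (m lam))).symm i) := fun i =>
    e.symm_apply_eq.mpr (by simp [he, uwireEquiv])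
  have h4 : (fun v : AncWire (n lam) (m lam) → Bit => (basisState 0 : QState (Fin _))
      fun w => v ((Fintype.equivFin (AncWire (n lam) (m lam))).symm w)) = basisState 0 := by
    funext v
    unfold basisState
    refine if_congr ⟨fun h => funext fun w => ?_, fun h => by rw [h]; rfl⟩ rfl rfl
    simpa using congrFun h (Fintype.equivFin _ w)
  have h5 := runGates_map (Fintype.equivFin (AncWire (n lam) (m lam)))
    (exists_ancState_circuit (n lam) (m lam)).choose (basisState 0) fun w => u (.inr w)
  rw [h4, (exists_ancState_circuit (n lam) (m lam)).choose_spec.2] at h5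
  unfold ustate
  rw [← h5]
  exact congrArg₂ (· * ·) (congrArg₂ (· * ·) (congrArg φ (funext fun i => congrArg u (h1 i)))
    (congrArg (basisState _) (funext fun i => congrArg u (h2 i))))
    (congrArg (runGates _ _) (funext fun i => congrArg u (h3 i)))

/-- Purity of the program state is not needed for equality of the distributions: both sides are the
same function of its amplitudes. -/
theorem exists_universal (n m m' : ℕ → ℕ) (hn : PolyBounded n) (hm : PolyBounded m)
    (hm' : PolyBounded m') : ∃ U : UniversalLM n m m', U.IsUniversal := by
  have hM : PolyBounded fun lam => m lam + n lam := hm.add hn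
  have hd : PolyBounded fun lam => descLen (n lam) (m lam) (m' lam) :=
    (((hM.mul (hM.mul (.const 3))).add (.const 1)).mul hn).add ((hM.add (.const 1)).mul hm')
  have hcard : PolyBounded fun lam => Fintype.card (Option (CWire (n lam) (m lam))) := by
    simp only [Fintype.card_option, Fintype.card_sum, Fintype.card_fin]
    exact hM.add (.const 1)
  have ht : PolyBounded fun lam => layers (n lam) (m lam) :=
    (hn.add (.const 2)).mul ((PolyBounded.const 2).add hcard)
  have ha : PolyBounded fun lam => Fintype.card (AncWire (n lam) (m lam)) := by
    have := ((hn.add (.const 2)).mul ((hcard.add (.const 3)).mul ht)).add hcard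
    refine this.mono fun lam => le_of_eq ?_
    simp only [Fintype.card_sum, Fintype.card_prod, Fintype.card_fin]
  refine ⟨universal n m m', ⟨hm, hm', (hn.add hd).add ha, ht, ?_⟩, ?_, ?_, ?_⟩
  · exact (PolyBounded.const 0).mono fun lam => (MeasProgram.linSize_toLM _).le
  · refine (((PolyBounded.const 2).mul ha).add
      ((PolyBounded.const 6).mul (hn.add (.const 2)))).mono fun lam => ?_
    exact List.length_map _ |>.trans_le (exists_ancState_circuit (n lam) (m lam)).choose_spec.1
  · exact fun lam => MeasProgram.collapsible_toLM _
  · exact fun lam C φ hC _ x y => evalProb_uprog _ _ φ C hC _ (decoding_fst C hC) (decoding_snd C)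
      _ (universal_input n m m' lam C φ) x y

end QObf

end

/-! ### The main theorem. -/

theorem mainTheorem6 :
    (∀ (m m' : ℕ → ℕ) (A : QObf.LMFamily m m') (tok : QObf.TokenScheme)
        (F : QObf.KeyedFn A.kap),
      A.PolySize → tok.Correct → QObf.IsPRF F →
      QObf.SchemePolyTime tok A ∧
      ∀ (ψ : ∀ lam : ℕ, QObf.QState (Fin (A.n lam))) (ε : ℕ → ℝ)
        (Q : ∀ lam : ℕ, QObf.BitStr (m lam) → QObf.BitStr (m' lam)),
        (∀ lam, QObf.IsPure (ψ lam)) → QObf.Negligible ε →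
        QObf.IsPseudoDet (fun lam => (A.prog lam).evalProb (ψ lam)) ε Q →
        QObf.SchemeCorrectOn tok A F ψ Q) ∧
    (∀ (n m m' : ℕ → ℕ),
      QObf.PolyBounded n → QObf.PolyBounded m → QObf.PolyBounded m' →
      ∃ U : QObf.UniversalLM n m m', U.IsUniversal ∧
        ∀ (tok : QObf.TokenScheme) (F : QObf.KeyedFn U.fam.kap),
          tok.Correct → QObf.IsPRF F →
          QObf.SchemePolyTime tok U.fam ∧
          ∀ (C : ∀ lam : ℕ, QObf.QCircuit (m lam) (n lam) (m' lam))
            (φ : ∀ lam : ℕ, QObf.QState (Fin (n lam))) (ε : ℕ → ℝ)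
            (Q : ∀ lam : ℕ, QObf.BitStr (m lam) → QObf.BitStr (m' lam)),
            (∀ lam, (C lam).gates.length ≤ n lam) → (∀ lam, QObf.IsPure (φ lam)) →
            QObf.Negligible ε →
            QObf.IsPseudoDet (fun lam => (C lam).outProb (φ lam)) ε Q →
            QObf.SchemeCorrectOn tok U.fam F (fun lam => U.input lam (C lam) (φ lam)) Q) := by
  refine ⟨fun m m' A tok F hA hc hF => ?_, fun n m m' hn hm hm' => ?_⟩
  · obtain ⟨h1, h2⟩ := QObf.scheme_of_polySize A tok F hA hc hF
    exact ⟨h1, fun ψ ε Q _ hε hQ => h2 ψ ε Q hε hQ⟩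
  · obtain ⟨U, hU⟩ := QObf.exists_universal n m m' hn hm hm'
    exact ⟨U, hU, fun tok F hc hF => QObf.universal_scheme U hU tok F hc hF⟩
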